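/- **Theorem (Effective Hamiltonian in the $n$-th Landau level).** Let $B>0$ and $n,N\in\mathbb N_0$. Identify $\mathbf r=(x,y)\in\mathbb R^2$ with $z=x+\mathrm i y$ and put $\mathbf r^\perp=(y,-x)$. The $n$-th Landau level is $$n\mathrm{LL}=\{\psi\in L^2(\mathbb R^2):\ (-\mathrm i\nabla+\tfrac B2\mathbf r^\perp)^2\psi=2B(n+\tfrac12)\psi\ \text{weakly}\},$$ $\mathrm{LLL}$ is the case $n=0$, and $n\mathrm{LL}_N=\bigotimes^N_{\rm asym}n\mathrm{LL}\subset L^2_{\rm asym}(\mathbb R^{2N})$. Let $$\varphi_{0,m}^{B}(z)=\Big(\tfrac{(B/2)^{m+1}}{\pi\,m!}\Big)^{1/2}z^m e^{-\frac B4|z|^2},\qquad \varphi_{n,m}=(n!)^{-1/2}(a^\dagger)^n\varphi^B_{0,m},\qquad a^\dagger=\sqrt{\tfrac B2}\,\big(\tfrac12\bar z-\tfrac2B\partial_z\big),$$ and let $\mathcal D_{n,N}$ be the linear span of the antisymmetrized products of the states $\varphi_{n,m}$, $m\ge 0$. There is a unitary $U_n:n\mathrm{LL}\to\mathrm{LLL}$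 with $U_n\varphi_{n,m}=\varphi_{0,m}$ for all $m$, and, for each $N$, a unitary $\mathcal U_{N,n}=U_n^{\otimes N}:n\mathrm{LL}_N\to\mathrm{LLL}_N$ (that is, it maps antisymmetrized products of $\psi_1,\dots,\psi_N\in n\mathrm{LL}$ to those of $U_n\psi_1,\dots,U_n\psi_N$). The subspaces $\mathcal D_{n,N}\subset n\mathrm{LL}_N$ and $\mathcal D_{0,N}\subset\mathrm{LLL}_N$ are dense and $\mathcal U_{N,n}\mathcal D_{n,N}=\mathcal D_{0,N}$. Let $V,w:\mathbb R^2\to\mathbb R$ be measurable, $w$ radial, with finite moments $$\int|V(\mathbf r)|\,r^{2m}e^{-\frac B2r^2}\,d\mathbf r<\infty,\qquad\int|w(\mathbf r)|\,r^{2m}e^{-\frac B4r^2}\,d\mathbf r<\infty\qquad\text{for all }m\ge0,$$ and let $$H=\sum_{j=1}^N\Big[\big(-\mathrm i\nabla_{\mathbf r_j}+\tfrac B2\mathbf r_j^\perp\big)^2-B+V(\mathbf r_j)\Big]+\sum_{i<j}w(\mathbf r_i-\mathbf r_j),\qquad H^{n\mathrm{LL}}=P^{n\mathrm{LL}}HP^{n\mathrm{LL}},$$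 with $P^{n\mathrm{LL}}$ the orthogonal projector from $L^2_{\rm asym}(\mathbb R^{2N})$ onto $n\mathrm{LL}_N$. Define, in the sense of distributions (the derivatives are moved to the test functions, which may be polynomials times Gaussians), $$V_n=L_n\big(-\tfrac1{2B}\Delta\big)V,\qquad w_n=L_n\big(-\tfrac1{2B}\Delta\big)^2w,\qquad L_n(u)=\sum_{l=0}^n\binom nl\frac{(-u)^l}{l!};$$ in units with $B=2$ these are $L_n(-\frac14\Delta)V$ and $L_n(-\frac14\Delta)^2w$. Then the pairings of $V_n$, $w_n$ in the formula below converge, $w_n$ is radial, and, as quadratic forms on these dense subspaces, $$H^{n\mathrm{LL}}-2nBN=\mathcal U_{N,n}^*\,H^{\mathrm{LLL}}_{V_n,w_n}\,\mathcal U_{N,n},$$ where $$H^{\mathrm{LLL}}_{V,w}=\sum_{j=1}^N\sum_{m,\ell\ge0}\langle\varphi_m|V|\varphi_\ell\rangle\,|\varphi_m\rangle\langle\varphi_\ell|_j+\sum_{i<j}\sum_{m\ge0}\langle\chi_m|w|\chi_m\rangle\,(|\chi_m\rangle\langle\chi_m|)_{ij},$$ $\varphi_m=\varphi^B_{0,m}$,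 and $(|\chi_m\rangle\langle\chi_m|)_{ij}$ projects the relative coordinate $\mathbf r_i-\mathbf r_j$ (at fixed centre $\frac12(\mathbf r_i+\mathbf r_j)$) onto the relative lowest-level state $\chi_m=\varphi^{B/2}_{0,m}\propto z^me^{-\frac B8|z|^2}$. The same identity holds with $P^{n\mathrm{LL}}$ applied to the vector $H\Phi$ for every $\Phi\in\mathcal D_{n,N}$ with $H\Phi\in L^2$. -/

import Mathlib

open MeasureTheory
open scoped SchwartzMap LineDeriv ComplexConjugate

noncomputable section

namespace LandauLevels

/-! The plane is identified with `ℂ`, a point `(x, y)` being `x + i y`; a configuration of `N`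
particles is a point of `Fin N → ℂ`, with Lebesgue measure. -/

/-- The kinetic momentum `π_x = -i ∂_x + (B/2) y` in the symmetric gauge. -/
def piX (B : ℝ) (f : ℂ → ℂ) (z : ℂ) : ℂ :=
  -Complex.I * fderiv ℝ f z 1 + ((B / 2 * z.im : ℝ) : ℂ) * f z

/-- The kinetic momentum `π_y = -i ∂_y - (B/2) x` in the symmetric gauge. -/
def piY (B : ℝ) (f : ℂ → ℂ) (z : ℂ) : ℂ :=
  -Complex.I * fderiv ℝ f z Complex.I - ((B / 2 * z.re : ℝ) : ℂ) * f z

/-- The Landau Hamiltonian `(-i∇ + (B/2) r^⊥)² = π_x² + π_y²`, `r^⊥ = (y, -x)`, acting on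
smooth functions. -/
def landauOp (B : ℝ) (f : ℂ → ℂ) (z : ℂ) : ℂ :=
  piX B (piX B f) z + piY B (piY B f) z

theorem exists_schwartz_piX (B : ℝ) (η : 𝓢(ℂ, ℂ)) : ∃ θ : 𝓢(ℂ, ℂ), ⇑θ = piX B η := by
  have hg : (fun z : ℂ => ((B / 2 * z.im : ℝ) : ℂ)).HasTemperateGrowth :=
    ContinuousLinearMap.hasTemperateGrowth
      (Complex.ofRealCLM.comp ((B / 2) • Complex.imCLM))
  refine ⟨(-Complex.I) • ∂_{(1 : ℂ)} η
    + SchwartzMap.smulLeftCLM ℂ (fun z : ℂ => ((B / 2 * z.im : ℝ) : ℂ)) η, ?_⟩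
  funext z
  simp [-Complex.ofReal_mul, -Complex.ofReal_div, piX, SchwartzMap.smulLeftCLM_apply_apply hg, SchwartzMap.lineDerivOp_apply_eq_fderiv]

theorem exists_schwartz_piY (B : ℝ) (η : 𝓢(ℂ, ℂ)) : ∃ θ : 𝓢(ℂ, ℂ), ⇑θ = piY B η := by
  have hg : (fun z : ℂ => ((B / 2 * z.re : ℝ) : ℂ)).HasTemperateGrowth :=
    ContinuousLinearMap.hasTemperateGrowth
      (Complex.ofRealCLM.comp ((B / 2) • Complex.reCLM))
  refine ⟨(-Complex.I) • ∂_{Complex.I} η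
    - SchwartzMap.smulLeftCLM ℂ (fun z : ℂ => ((B / 2 * z.re : ℝ) : ℂ)) η, ?_⟩
  funext z
  simp [-Complex.ofReal_mul, -Complex.ofReal_div, piY, SchwartzMap.smulLeftCLM_apply_apply hg, SchwartzMap.lineDerivOp_apply_eq_fderiv]

theorem exists_schwartz_landauOp (B : ℝ) (η : 𝓢(ℂ, ℂ)) :
    ∃ θ : 𝓢(ℂ, ℂ), ⇑θ = landauOp B η := by
  obtain ⟨a, ha⟩ := exists_schwartz_piX B η
  obtain ⟨a', ha'⟩ := exists_schwartz_piX B a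
  obtain ⟨b, hb⟩ := exists_schwartz_piY B η
  obtain ⟨b', hb'⟩ := exists_schwartz_piY B b
  refine ⟨a' + b', ?_⟩
  funext z
  simp [landauOp, ha', hb', ha, hb]

theorem integrable_schwartz_mul (θ : 𝓢(ℂ, ℂ)) (ψ : Lp ℂ 2 (volume : Measure ℂ)) :
    Integrable (fun z => conj (θ z) * ψ z) := by
  have h := (θ.memLp 2 (volume : Measure ℂ)).star
  exact h.integrable_mul (Lp.memLp ψ)

/-- The `n`-th Landau level: all `ψ ∈ L²(ℝ²)` with `(-i∇ + (B/2) r^⊥)² ψ = 2B(n + 1/2) ψ` in the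
weak sense (the equation is tested against Schwartz functions; the operator is symmetric). -/
def landauLevel (B : ℝ) (n : ℕ) : Submodule ℂ (Lp ℂ 2 (volume : Measure ℂ)) where
  carrier := {ψ | ∀ η : 𝓢(ℂ, ℂ),
    ∫ z, conj (landauOp B η z) * ψ z
      = ((2 * B * (n + 1 / 2) : ℝ) : ℂ) * ∫ z, conj (η z) * ψ z}
  zero_mem' := by
    intro η
    have h : ∀ g : ℂ → ℂ, ∫ z, g z * (0 : Lp ℂ 2 (volume : Measure ℂ)) z = 0 := by
      intro g
      rw [integral_congr_ae (g := fun _ => (0 : ℂ)), integral_zero]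
      filter_upwards [Lp.coeFn_zero ℂ 2 (volume : Measure ℂ)] with z hz
      rw [hz, Pi.zero_apply, mul_zero]
    rw [h, h, mul_zero]
  add_mem' := by
    intro ψ φ hψ hφ η
    have h : ∀ θ : 𝓢(ℂ, ℂ), ∫ z, conj (θ z) * (ψ + φ) z
        = (∫ z, conj (θ z) * ψ z) + ∫ z, conj (θ z) * φ z := by
      intro θ
      rw [← integral_add (integrable_schwartz_mul θ ψ) (integrable_schwartz_mul θ φ)]
      refine integral_congr_ae ?_
      filter_upwards [Lp.coeFn_add ψ φ] with z hz
      rw [hz, Pi.add_apply, mul_add]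
    obtain ⟨θ, hθ⟩ := exists_schwartz_landauOp B η
    rw [← hθ, h, h, mul_add, hθ, hψ η, hφ η]
  smul_mem' := by
    intro c ψ hψ η
    have h : ∀ g : ℂ → ℂ, ∫ z, g z * (c • ψ) z = c * ∫ z, g z * ψ z := by
      intro g
      rw [← integral_const_mul]
      refine integral_congr_ae ?_
      filter_upwards [Lp.coeFn_smul c ψ] with z hz
      simp only [hz, Pi.smul_apply, smul_eq_mul]
      ring
    rw [h, h, hψ η]
    ring

/-- The creation operator `a† = (√2 ℓ)⁻¹ (z̄/2 - 2ℓ² ∂_z)` of the cyclotron oscillator, where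
`ℓ = B^(-1/2)` and `∂_z = (∂_x - i ∂_y)/2`. -/
def creation (B : ℝ) (f : ℂ → ℂ) (z : ℂ) : ℂ :=
  (Real.sqrt (B / 2) : ℂ) *
    (conj z / 2 * f z
      - ((2 / B : ℝ) : ℂ) * ((fderiv ℝ f z 1 - Complex.I * fderiv ℝ f z Complex.I) / 2))

/-- The normalized lowest level states `φ_{0,m}`, proportional to `z^m exp(-B|z|²/4)`. -/
def lowestState (B : ℝ) (m : ℕ) (z : ℂ) : ℂ :=
  (Real.sqrt ((B / 2) ^ (m + 1) / (Real.pi * m.factorial)) : ℂ) * z ^ m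
    * (Real.exp (-(B / 4) * ‖z‖ ^ 2) : ℂ)

/-- The states `φ_{n,m} = (n!)^(-1/2) (a†)^n φ_{0,m}` of the `n`-th level. -/
def landauState (B : ℝ) (n m : ℕ) : ℂ → ℂ :=
  fun z => ((Real.sqrt n.factorial)⁻¹ : ℂ) * (creation B)^[n] (lowestState B m) z

/-- The (unnormalized) antisymmetrized product
`∑_σ sgn(σ) ∏_i ψ_i(r_{σ(i)})` of one-particle functions. -/
def slater {N : ℕ} (ψ : Fin N → ℂ → ℂ) (X : Fin N → ℂ) : ℂ :=
  Matrix.det (Matrix.of fun i j => ψ j (X i))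

/-- `L²(ℝ^{2N})`. -/
abbrev L2N (N : ℕ) := Lp ℂ 2 (volume : Measure (Fin N → ℂ))

/-- `Ψ ∈ L²_asym(ℝ^{2N})`. -/
def IsAntisymmetric {N : ℕ} (Ψ : L2N N) : Prop :=
  ∀ σ : Equiv.Perm (Fin N),
    (fun X : Fin N → ℂ => Ψ (X ∘ σ)) =ᵐ[volume] fun X => ((Equiv.Perm.sign σ : ℤ) : ℂ) * Ψ X

/-- The `N`-particle fermionic space of the `n`-th Landau level: the antisymmetric tensor power
of `landauLevel B n`, realized as a closed subspace of `L²(ℝ^{2N})`. -/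
def landauLevelN (B : ℝ) (n N : ℕ) : Submodule ℂ (L2N N) :=
  (Submodule.span ℂ {Ψ : L2N N | ∃ ψ : Fin N → landauLevel B n,
    Ψ =ᵐ[volume] slater fun i => (ψ i : ℂ → ℂ)}).topologicalClosure

instance (B : ℝ) (n N : ℕ) : CompleteSpace (landauLevelN B n N) :=
  Submodule.topologicalClosure.completeSpace _

/-- The orthogonal projector `P` onto the `N`-particle space of the `n`-th level. -/
abbrev projLevelN (B : ℝ) (n N : ℕ) : L2N N →L[ℂ] landauLevelN B n N :=
  (landauLevelN B n N).orthogonalProjectionOnto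

/-- The wave functions (polynomials times a Gaussian) on which the quadratic forms are
considered: finite linear combinations of antisymmetrized products of the states `φ_{n,m}`, `m = 0, 1, …`. -/
def formCore (B : ℝ) (n N : ℕ) : Submodule ℂ ((Fin N → ℂ) → ℂ) :=
  Submodule.span ℂ (Set.range fun m : Fin N → ℕ => slater fun i => landauState B n (m i))

/-- The form domain as a subset of the Hilbert space of the level. -/
def formDomain (B : ℝ) (n N : ℕ) : Set (landauLevelN B n N) :=
  {Ψ | ∃ F ∈ formCore B n N, (Ψ : L2N N) =ᵐ[volume] F}

/-- The full `N`-body Hamiltonian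
`∑_j ((-i∇_j + (B/2) r_j^⊥)² - B + V(r_j)) + ∑_{i<j} w(r_i - r_j)` on smooth functions. -/
def hamiltonian (B : ℝ) (V w : ℂ → ℝ) {N : ℕ} (Φ : (Fin N → ℂ) → ℂ) (X : Fin N → ℂ) : ℂ :=
  (∑ j, (landauOp B (fun r => Φ (Function.update X j r)) (X j)
      - (B : ℂ) * Φ X + (V (X j) : ℂ) * Φ X))
    + ∑ i, ∑ j ∈ Finset.univ.filter (fun j => i < j), (w (X i - X j) : ℂ) * Φ X

/-- The quadratic (sesquilinear) form `⟨Ψ, H Φ⟩`. -/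
def hamiltonianForm (B : ℝ) (V w : ℂ → ℝ) {N : ℕ} (Ψ Φ : (Fin N → ℂ) → ℂ) : ℂ :=
  ∫ X, conj (Ψ X) * hamiltonian B V w Φ X

/-- A generalized potential (distribution), given by its pairing `T η = ∫ T(r) η(r) dr` with
test functions `η`. Besides smooth functions of compact support, polynomials times Gaussians
serve as test functions here. -/
abbrev GenPotential := (ℂ → ℂ) → ℂ

/-- A function as a generalized potential. -/
def ofFunction (V : ℂ → ℝ) : GenPotential := fun η => ∫ z, (V z : ℂ) * η z

/-- The distributional Laplacian, `(ΔT)(η) = T(Δη)`. -/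
def distLaplacian : Module.End ℝ GenPotential where
  toFun T := fun η => T (Laplacian.laplacian η)
  map_add' _ _ := rfl
  map_smul' _ _ := rfl

/-- The Laguerre polynomial `L_n(u) = ∑_{l ≤ n} binom(n,l) (-u)^l / l!`. -/
def laguerre (n : ℕ) : Polynomial ℝ :=
  ∑ l ∈ Finset.range (n + 1),
    Polynomial.C ((n.choose l : ℝ) / (l.factorial : ℝ)) * (-Polynomial.X) ^ l

/-- `V_n = L_n(-Δ/(2B)) V`, in the sense of distributions. -/
def effExternal (B : ℝ) (n : ℕ) (V : ℂ → ℝ) : GenPotential :=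
  Polynomial.aeval (-((1 / (2 * B)) • distLaplacian)) (laguerre n) (ofFunction V)

/-- `w_n = L_n(-Δ/(2B))² w`, in the sense of distributions. -/
def effInteraction (B : ℝ) (n : ℕ) (w : ℂ → ℝ) : GenPotential :=
  Polynomial.aeval (-((1 / (2 * B)) • distLaplacian)) (laguerre n ^ 2) (ofFunction w)

/-- `conj φ_m · φ_l` for the lowest level states, so that `⟨φ_m|T|φ_l⟩ = T (stateProduct B m l)`. -/
def stateProduct (B : ℝ) (m l : ℕ) (z : ℂ) : ℂ :=
  conj (landauState B 0 m z) * landauState B 0 l z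

/-- The operator `|φ_m⟩⟨φ_l|_j`, acting on the `j`-th variable only. -/
def ketBra (B : ℝ) {N : ℕ} (j : Fin N) (m l : ℕ) (Φ : (Fin N → ℂ) → ℂ) (X : Fin N → ℂ) : ℂ :=
  landauState B 0 m (X j) *
    ∫ r, conj (landauState B 0 l r) * Φ (Function.update X j r)

/-- The operator `(|φ_m⟩⟨φ_m|)_{ij}`: the projection of the relative coordinate
`s = r_i - r_j` on the normalized `m`-th lowest level state of the relative motion, at fixed centre
`(r_i + r_j)/2` and fixed other variables. The relative motion of two particles in the lowest
level is described by the lowest level for the field `B/2`, i.e. by states proportional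
to `s^m exp(-B|s|²/8)`. -/
def relProj (B : ℝ) {N : ℕ} (i j : Fin N) (m : ℕ) (Φ : (Fin N → ℂ) → ℂ) (X : Fin N → ℂ) : ℂ :=
  landauState (B / 2) 0 m (X i - X j) *
    ∫ s, conj (landauState (B / 2) 0 m s) *
      Φ (Function.update (Function.update X i ((X i + X j) / 2 + s / 2)) j
        ((X i + X j) / 2 - s / 2))

/-- The term `⟨φ_m|T|φ_l⟩ ⟨Ψ| (|φ_m⟩⟨φ_l|_j) |Φ⟩`, with `p = (m, l)`. -/
def oneBodyTerm (B : ℝ) (T : GenPotential) {N : ℕ} (Ψ Φ : (Fin N → ℂ) → ℂ) (j : Fin N)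
    (p : ℕ × ℕ) : ℂ :=
  T (stateProduct B p.1 p.2) * ∫ X, conj (Ψ X) * ketBra B j p.1 p.2 Φ X

/-- The term `⟨φ_m|S|φ_m⟩ ⟨Ψ| (|φ_m⟩⟨φ_m|)_{ij} |Φ⟩`, where the coefficient is the Haldane
pseudo-potential of `S`. -/
def twoBodyTerm (B : ℝ) (S : GenPotential) {N : ℕ} (Ψ Φ : (Fin N → ℂ) → ℂ) (i j : Fin N)
    (m : ℕ) : ℂ :=
  S (stateProduct (B / 2) m m) * ∫ X, conj (Ψ X) * relProj B i j m Φ X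

/-- The sesquilinear form of the lowest Landau level Hamiltonian with external potential `T` and
radial interaction potential `S`,
`∑_j ∑_{m,l} ⟨φ_m|T|φ_l⟩ |φ_m⟩⟨φ_l|_j + ∑_{i<j} ∑_m ⟨φ_m|S|φ_m⟩ (|φ_m⟩⟨φ_m|)_{ij}`. -/
def lllForm (B : ℝ) (T S : GenPotential) {N : ℕ} (Ψ Φ : (Fin N → ℂ) → ℂ) : ℂ :=
  (∑ j, ∑' p : ℕ × ℕ, oneBodyTerm B T Ψ Φ j p)
    + ∑ i, ∑ j ∈ Finset.univ.filter (fun j => i < j), ∑' m : ℕ, twoBodyTerm B S Ψ Φ i j m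

end LandauLevels

end

/-!
The proof rests on the ladder operators of the cyclotron oscillator and on the behaviour of
densities under the Laplacian. On Schwartz functions let `a` and `a†` be the annihilation and
creation operators; then `landauOp B = 2B (a† a + 1/2)` and `[a, a†] = 1`, so the states `φ_{n,m}`
are orthonormal eigenvectors. They are total, because their span contains all polynomials times
the Gaussian `exp(-B|z|²/4)`, and a weak eigenvector of `landauOp B` is orthogonal to every
`φ_{n',m}` with `n' ≠ n`. So `φ_{n,0}, φ_{n,1}, …` is a Hilbert basis of the `n`-th level
(`levelBasis`), which gives the unitary to the lowest level (`levelUnitary`). Since inner products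
of antisymmetrized products depend only on the one-particle inner products, the tensor power of a
unitary is defined and isometric (`exists_tensor_power`).

For the effective potentials, a derivative of the density `ū v` can be written with commutators of
the ladder operators (`laplacian_overlap`), so that `-Δ/(2B)` maps `φ̄_{n,a} φ_{n,b}` to a
combination of the densities of the levels `n - 1`, `n`, `n + 1`. The coefficients are those of
the three-term recurrence of the Laguerre polynomials, whence `L_n(-Δ/(2B)) (φ̄_{0,a} φ_{0,b}) =
φ̄_{n,a} φ_{n,b}` (`laguerre_laplacian_overlap`). Paired with `V` this is the equality of the
one-body matrix elements (`effExternal_stateProduct`). For two particles, the energy of two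
densities depends on them through their correlation `s ↦ ∫ ρ₁(R + s/2) ρ₂(R - s/2) dR`, a
convolution, in which the two operators `L_n(-Δ/(2B))` acting on `ρ₁` and on `ρ₂` become the
square `L_n(-Δ/(2B))²` acting on `s` (`correlation_aeval`). In the lowest level, `φ_{0,c}(R + s/2)
φ_{0,d}(R - s/2)` is a finite sum of relative states `χ_m(s)` with coefficients depending on `R`.
A radial `w` has no matrix elements between different `χ_m`, so only the pseudo-potentials
`⟨χ_m|w_n|χ_m⟩` remain (`integral_interaction_state`).

On product states of `N` particles all integrals factorize. The resulting identities are extended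
sesquilinearly to the span of product states (`formExpansion_of_prodState`), which contains the
antisymmetrized products. The kinetic energy is constant on the `n`-th level (`hamiltonian_eq`),
and the identity of forms follows (`hamiltonianForm_eq_lllForm`).
-/

noncomputable section

namespace LandauLevels

/-! ### Ladder operators on Schwartz space -/

/-- The Wirtinger derivative `∂_z = (∂_x - i ∂_y)/2` on Schwartz functions. -/
def wirtinger : Module.End ℂ 𝓢(ℂ, ℂ) :=
  (1 / 2 : ℂ) • ((LineDeriv.lineDerivOpCLM ℂ 𝓢(ℂ, ℂ) (1 : ℂ)).toLinearMap
    - Complex.I • (LineDeriv.lineDerivOpCLM ℂ 𝓢(ℂ, ℂ) Complex.I).toLinearMap)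

/-- The conjugate Wirtinger derivative `∂_z̄ = (∂_x + i ∂_y)/2` on Schwartz functions. -/
def wirtingerBar : Module.End ℂ 𝓢(ℂ, ℂ) :=
  (1 / 2 : ℂ) • ((LineDeriv.lineDerivOpCLM ℂ 𝓢(ℂ, ℂ) (1 : ℂ)).toLinearMap
    + Complex.I • (LineDeriv.lineDerivOpCLM ℂ 𝓢(ℂ, ℂ) Complex.I).toLinearMap)

/-- Multiplication by `z` on Schwartz functions. -/
def mulZ : Module.End ℂ 𝓢(ℂ, ℂ) := (SchwartzMap.smulLeftCLM ℂ (fun z : ℂ => z)).toLinearMap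

/-- Multiplication by `z̄` on Schwartz functions. -/
def mulZBar : Module.End ℂ 𝓢(ℂ, ℂ) :=
  (SchwartzMap.smulLeftCLM ℂ (fun z : ℂ => conj z)).toLinearMap

lemma wirtinger_apply (η : 𝓢(ℂ, ℂ)) (z : ℂ) :
    wirtinger η z = (fderiv ℝ η z 1 - Complex.I * fderiv ℝ η z Complex.I) / 2 := by
  simp [wirtinger, SchwartzMap.lineDerivOp_apply_eq_fderiv]
  ring

lemma wirtingerBar_apply (η : 𝓢(ℂ, ℂ)) (z : ℂ) :
    wirtingerBar η z = (fderiv ℝ η z 1 + Complex.I * fderiv ℝ η z Complex.I) / 2 := by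
  simp [wirtingerBar, SchwartzMap.lineDerivOp_apply_eq_fderiv]
  ring

lemma mulZ_apply (η : 𝓢(ℂ, ℂ)) (z : ℂ) : mulZ η z = z * η z := by
  simp [mulZ, SchwartzMap.smulLeftCLM_apply_apply Function.HasTemperateGrowth.id']

lemma hasTemperateGrowth_conj : (fun z : ℂ => conj z).HasTemperateGrowth :=
  ContinuousLinearMap.hasTemperateGrowth (Complex.conjCLE : ℂ →L[ℝ] ℂ)

lemma mulZBar_apply (η : 𝓢(ℂ, ℂ)) (z : ℂ) : mulZBar η z = conj z * η z := by
  simp [mulZBar, SchwartzMap.smulLeftCLM_apply_apply hasTemperateGrowth_conj]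

lemma coe_mulZ (η : 𝓢(ℂ, ℂ)) : ⇑(mulZ η) = fun z => z * η z := funext (mulZ_apply η)

lemma coe_mulZBar (η : 𝓢(ℂ, ℂ)) : ⇑(mulZBar η) = fun z => conj z * η z :=
  funext (mulZBar_apply η)

lemma fderiv_mulZ (η : 𝓢(ℂ, ℂ)) (z v : ℂ) :
    fderiv ℝ (mulZ η) z v = z * fderiv ℝ η z v + v * η z := by
  rw [coe_mulZ, fderiv_fun_mul differentiableAt_fun_id η.differentiableAt]
  simp [mul_comm]

lemma fderiv_mulZBar (η : 𝓢(ℂ, ℂ)) (z v : ℂ) :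
    fderiv ℝ (mulZBar η) z v = conj z * fderiv ℝ η z v + conj v * η z := by
  have h : HasFDerivAt (fun z : ℂ => conj z) (Complex.conjCLE : ℂ →L[ℝ] ℂ) z :=
    (Complex.conjCLE : ℂ →L[ℝ] ℂ).hasFDerivAt
  rw [coe_mulZBar, fderiv_fun_mul h.differentiableAt η.differentiableAt, h.fderiv]
  simp [mul_comm]

lemma fderiv_fderiv_comm (η : 𝓢(ℂ, ℂ)) (z v w : ℂ) :
    fderiv ℝ (fun y => fderiv ℝ η y v) z w = fderiv ℝ (fun y => fderiv ℝ η y w) z v := by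
  have hd : DifferentiableAt ℝ (fderiv ℝ η) z :=
    ((η.smooth 2).contDiffAt.fderiv_right (m := 1) (by norm_num)).differentiableAt (by norm_num)
  rw [fderiv_clm_apply hd (differentiableAt_const _),
    fderiv_clm_apply hd (differentiableAt_const _)]
  simpa using ((η.smooth 2).contDiffAt.isSymmSndFDerivAt (by simp)).eq w v

lemma lineDerivOp_comm (v w : ℂ) (η : 𝓢(ℂ, ℂ)) : ∂_{v} (∂_{w} η) = ∂_{w} (∂_{v} η) := by
  ext z
  exact fderiv_fderiv_comm η z w v

lemma wirtinger_comm : wirtinger * wirtingerBar = wirtingerBar * wirtinger := by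
  have h : (LineDeriv.lineDerivOpCLM ℂ 𝓢(ℂ, ℂ) (1 : ℂ)).toLinearMap
      * (LineDeriv.lineDerivOpCLM ℂ 𝓢(ℂ, ℂ) Complex.I).toLinearMap
      = (LineDeriv.lineDerivOpCLM ℂ 𝓢(ℂ, ℂ) Complex.I).toLinearMap
      * (LineDeriv.lineDerivOpCLM ℂ 𝓢(ℂ, ℂ) (1 : ℂ)).toLinearMap :=
    LinearMap.ext fun η => lineDerivOp_comm 1 Complex.I η
  simp only [wirtinger, wirtingerBar, smul_mul_assoc, mul_smul_comm, sub_mul, mul_sub, add_mul,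
    mul_add, h]
  module

lemma wirtinger_mulZ : wirtinger * mulZ = mulZ * wirtinger + 1 := by
  ext η z
  simp only [Module.End.mul_apply, LinearMap.add_apply, add_apply, wirtinger_apply,
    mulZ_apply, fderiv_mulZ, Module.End.one_apply]
  linear_combination (- η z / 2) * Complex.I_mul_I

lemma wirtingerBar_mulZ : wirtingerBar * mulZ = mulZ * wirtingerBar := by
  ext η z
  simp only [Module.End.mul_apply, wirtingerBar_apply, mulZ_apply, fderiv_mulZ]
  linear_combination (η z / 2) * Complex.I_mul_I

lemma wirtinger_mulZBar : wirtinger * mulZBar = mulZBar * wirtinger := by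
  ext η z
  simp only [Module.End.mul_apply, wirtinger_apply, mulZBar_apply, fderiv_mulZBar, map_one,
    Complex.conj_I]
  linear_combination (η z / 2) * Complex.I_mul_I

lemma wirtingerBar_mulZBar : wirtingerBar * mulZBar = mulZBar * wirtingerBar + 1 := by
  ext η z
  simp only [Module.End.mul_apply, LinearMap.add_apply, add_apply, wirtingerBar_apply,
    mulZBar_apply, fderiv_mulZBar, Module.End.one_apply, map_one, Complex.conj_I]
  linear_combination (- η z / 2) * Complex.I_mul_I

lemma mulZ_comm : mulZ * mulZBar = mulZBar * mulZ := by
  ext η z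
  simp only [Module.End.mul_apply, mulZ_apply, mulZBar_apply]
  ring

/-- The cyclotron annihilation operator `a = √(2/B) (∂_z̄ + (B/4) z)`. -/
def annihilate (B : ℝ) : Module.End ℂ 𝓢(ℂ, ℂ) :=
  (Real.sqrt (2 / B) : ℂ) • (wirtingerBar + ((B / 4 : ℝ) : ℂ) • mulZ)

/-- The cyclotron creation operator `a† = √(2/B) ((B/4) z̄ - ∂_z)` on Schwartz functions. -/
def create (B : ℝ) : Module.End ℂ 𝓢(ℂ, ℂ) :=
  (Real.sqrt (2 / B) : ℂ) • (((B / 4 : ℝ) : ℂ) • mulZBar - wirtinger)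

lemma sqrt_two_div_mul_self {B : ℝ} (hB : 0 < B) :
    (Real.sqrt (2 / B) : ℂ) * (Real.sqrt (2 / B) : ℂ) = 2 / B := by
  rw [← Complex.ofReal_mul, Real.mul_self_sqrt (by positivity)]
  push_cast; rfl

lemma annihilate_mul_create {B : ℝ} (hB : 0 < B) :
    annihilate B * create B = create B * annihilate B + 1 := by
  have hB' : (B : ℂ) ≠ 0 := by exact_mod_cast hB.ne'
  simp only [annihilate, create, smul_mul_assoc, mul_smul_comm, smul_smul,
    add_mul, mul_add, sub_mul, mul_sub, wirtinger_mulZ, wirtingerBar_mulZBar, wirtinger_comm,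
    mulZ_comm]
  push_cast
  have h2 := sqrt_two_div_mul_self hB
  set s : ℂ := (Real.sqrt (2 / B) : ℂ)
  have h3 : s * s * B = 2 := by rw [h2]; field_simp
  match_scalars
  all_goals try ring1
  linear_combination h3 / 2

lemma create_apply {B : ℝ} (hB : 0 < B) (η : 𝓢(ℂ, ℂ)) : ⇑(create B η) = creation B η := by
  have hB' : (B : ℂ) ≠ 0 := by exact_mod_cast hB.ne'
  have h : (Real.sqrt (2 / B) : ℂ) = Real.sqrt (B / 2) * (2 / B) := by
    rw [show (2 / B : ℝ) = (B / 2) * (2 / B) ^ 2 by field_simp, Real.sqrt_mul (by positivity),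
      Real.sqrt_sq (by positivity)]
    push_cast; rfl
  funext z
  simp only [create, creation, LinearMap.smul_apply, LinearMap.sub_apply, smul_apply,
    sub_apply, mulZBar_apply, wirtinger_apply, smul_eq_mul, h]
  push_cast
  field_simp
  ring

/-- `(-i∇ + (B/2) r^⊥)² = B (2 a†a + 1)`. -/
lemma landauOp_eq {B : ℝ} (hB : 0 < B) (η : 𝓢(ℂ, ℂ)) :
    landauOp B η = ⇑((B : ℂ) • ((2 : ℂ) • create B (annihilate B η) + η)) := by
  have hB' : (B : ℂ) ≠ 0 := by exact_mod_cast hB.ne'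
  -- With `A = ∂_z̄ + (B/4) z` and `C = (B/4) z̄ - ∂_z` one has `π_x = -i (A - C)`, `π_y = -(A + C)`.
  set A : Module.End ℂ 𝓢(ℂ, ℂ) := wirtingerBar + ((B / 4 : ℝ) : ℂ) • mulZ with hA
  set C : Module.End ℂ 𝓢(ℂ, ℂ) := ((B / 4 : ℝ) : ℂ) • mulZBar - wirtinger with hC
  have hx : ∀ θ : 𝓢(ℂ, ℂ), piX B θ = ⇑((-Complex.I) • (A θ - C θ)) := by
    intro θ; funext z
    simp only [piX, hA, hC, LinearMap.add_apply, LinearMap.sub_apply, LinearMap.smul_apply,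
      smul_apply, sub_apply, add_apply, mulZ_apply,
      mulZBar_apply, wirtinger_apply, wirtingerBar_apply, smul_eq_mul]
    have : (z.im : ℂ) = (z - conj z) / (2 * Complex.I) := by
      rw [Complex.sub_conj]; field_simp; push_cast; ring
    push_cast
    rw [this]
    field_simp
    linear_combination (4 * (B : ℂ) * (z - conj z) * θ z) * Complex.I_sq
  have hy : ∀ θ : 𝓢(ℂ, ℂ), piY B θ = ⇑(-(A θ + C θ)) := by
    intro θ; funext z
    simp only [piY, hA, hC, LinearMap.add_apply, LinearMap.sub_apply, LinearMap.smul_apply,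
      smul_apply, sub_apply, add_apply, mulZ_apply,
      neg_apply,
      mulZBar_apply, wirtinger_apply, wirtingerBar_apply, smul_eq_mul]
    have : (z.re : ℂ) = (z + conj z) / 2 := by
      rw [Complex.add_conj]; push_cast; ring
    push_cast
    rw [this]
    ring
  have hAC : ∀ θ, A (C θ) = C (A θ) + ((B / 2 : ℝ) : ℂ) • θ := by
    have h := annihilate_mul_create hB
    simp only [annihilate, create, ← hA, ← hC, smul_mul_assoc, mul_smul_comm, smul_smul,
      sqrt_two_div_mul_self hB] at h
    intro θ
    have h1 := congrArg (fun T => (B / 2 : ℂ) • T θ) h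
    simp only [LinearMap.smul_apply, LinearMap.add_apply, Module.End.mul_apply, smul_add,
      smul_smul, Module.End.one_apply] at h1
    rw [show (B / 2 : ℂ) * (2 / B) = 1 by field_simp, one_smul, one_smul] at h1
    rw [h1]; push_cast; rfl
  funext z
  rw [landauOp, hx, hx, hy, hy, ← add_apply]
  congr 1
  have hcr : create B (annihilate B η) = (2 / B : ℂ) • C (A η) := by
    simp only [create, annihilate, ← hA, ← hC, LinearMap.smul_apply, map_smul, smul_smul,
      sqrt_two_div_mul_self hB]
  rw [hcr]
  simp only [map_smul, map_sub, map_add, map_neg, hAC]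
  have : Complex.I * Complex.I = -1 := Complex.I_mul_I
  push_cast
  match_scalars <;> field_simp <;> simp <;> ring

/-! ### Overlap densities -/

/-- The density `ū v` of two Schwartz functions. -/
def overlap (u v : 𝓢(ℂ, ℂ)) : 𝓢(ℂ, ℂ) :=
  SchwartzMap.pairing (𝕜 := ℝ) (ContinuousLinearMap.mul ℝ ℂ)
    (SchwartzMap.postcompCLM (𝕜 := ℝ) (Complex.conjCLE : ℂ →L[ℝ] ℂ) u) v

lemma overlap_apply (u v : 𝓢(ℂ, ℂ)) (z : ℂ) : overlap u v z = conj (u z) * v z := by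
  simp [overlap]

lemma coe_overlap (u v : 𝓢(ℂ, ℂ)) : ⇑(overlap u v) = fun z => conj (u z) * v z :=
  funext (overlap_apply u v)

lemma overlap_add_left (u u' v : 𝓢(ℂ, ℂ)) :
    overlap (u + u') v = overlap u v + overlap u' v := by
  ext z; simp [overlap_apply, add_mul]

lemma overlap_smul_left (c : ℂ) (u v : 𝓢(ℂ, ℂ)) :
    overlap (c • u) v = conj c • overlap u v := by
  ext z; simp [overlap_apply, mul_assoc]

lemma overlap_smul_right (c : ℂ) (u v : 𝓢(ℂ, ℂ)) :
    overlap u (c • v) = c • overlap u v := by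
  ext z; simp [overlap_apply]; ring

@[simp] lemma overlap_zero_left (v : 𝓢(ℂ, ℂ)) : overlap 0 v = 0 := by
  ext z; simp [overlap_apply]

@[simp] lemma overlap_zero_right (v : 𝓢(ℂ, ℂ)) : overlap v 0 = 0 := by
  ext z; simp [overlap_apply]

lemma fderiv_overlap (u v : 𝓢(ℂ, ℂ)) (z w : ℂ) :
    fderiv ℝ (overlap u v) z w = conj (fderiv ℝ u z w) * v z + conj (u z) * fderiv ℝ v z w := by
  have h : HasFDerivAt (fun z : ℂ => conj (u z))
      ((Complex.conjCLE : ℂ →L[ℝ] ℂ).comp (fderiv ℝ u z)) z :=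
    (Complex.conjCLE : ℂ →L[ℝ] ℂ).hasFDerivAt.comp z u.differentiableAt.hasFDerivAt
  rw [coe_overlap, fderiv_fun_mul h.differentiableAt v.differentiableAt, h.fderiv]
  simp
  ring

lemma wirtinger_overlap (u v : 𝓢(ℂ, ℂ)) :
    wirtinger (overlap u v) = overlap (wirtingerBar u) v + overlap u (wirtinger v) := by
  ext z
  simp only [wirtinger_apply, fderiv_overlap, add_apply, overlap_apply, wirtingerBar_apply,
    map_div₀, map_add, map_mul, Complex.conj_I, Complex.conj_ofNat]
  ring

lemma wirtingerBar_overlap (u v : 𝓢(ℂ, ℂ)) :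
    wirtingerBar (overlap u v) = overlap (wirtinger u) v + overlap u (wirtingerBar v) := by
  ext z
  simp only [wirtinger_apply, fderiv_overlap, add_apply, overlap_apply, wirtingerBar_apply,
    map_div₀, map_sub, map_mul, Complex.conj_I, Complex.conj_ofNat]
  ring

lemma sqrt_mul_sqrt_two_div {B : ℝ} (hB : 0 < B) :
    (Real.sqrt (B / 2) : ℂ) * (Real.sqrt (2 / B) : ℂ) = 1 := by
  rw [← Complex.ofReal_mul, ← Real.sqrt_mul (by positivity),
    show B / 2 * (2 / B) = 1 by field_simp]
  simp

lemma wirtinger_overlap_eq_ladder {B : ℝ} (hB : 0 < B) (u v : 𝓢(ℂ, ℂ)) :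
    wirtinger (overlap u v)
      = (Real.sqrt (B / 2) : ℂ) • (overlap (annihilate B u) v - overlap u (create B v)) := by
  rw [wirtinger_overlap]
  ext z
  simp only [annihilate, create, LinearMap.smul_apply, LinearMap.sub_apply, LinearMap.add_apply,
    add_apply, sub_apply, smul_apply, overlap_apply, mulZ_apply, mulZBar_apply, smul_eq_mul,
    map_mul, map_add, Complex.conj_ofReal]
  linear_combination (-(conj (wirtingerBar u z) * v z + conj (u z) * wirtinger v z)) *
    sqrt_mul_sqrt_two_div hB

lemma wirtingerBar_overlap_eq_ladder {B : ℝ} (hB : 0 < B) (u v : 𝓢(ℂ, ℂ)) :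
    wirtingerBar (overlap u v)
      = (Real.sqrt (B / 2) : ℂ) • (overlap u (annihilate B v) - overlap (create B u) v) := by
  rw [wirtingerBar_overlap]
  ext z
  simp only [annihilate, create, LinearMap.smul_apply, LinearMap.sub_apply, LinearMap.add_apply,
    add_apply, sub_apply, smul_apply, overlap_apply, mulZ_apply, mulZBar_apply, smul_eq_mul,
    map_mul, map_sub, Complex.conj_ofReal, Complex.conj_conj]
  linear_combination (-(conj (wirtinger u z) * v z + conj (u z) * wirtingerBar v z)) *
    sqrt_mul_sqrt_two_div hB

lemma laplacian_eq_wirtinger (η : 𝓢(ℂ, ℂ)) :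
    Laplacian.laplacian η = (4 : ℂ) • wirtinger (wirtingerBar η) := by
  have h : (Laplacian.laplacian η : 𝓢(ℂ, ℂ))
      = ∂_{(1 : ℂ)} (∂_{(1 : ℂ)} η) + ∂_{Complex.I} (∂_{Complex.I} η) := by
    simpa using SchwartzMap.laplacian_eq_sum Complex.orthonormalBasisOneI η
  have hI : Complex.I * Complex.I = -1 := Complex.I_mul_I
  rw [h]
  simp only [wirtinger, wirtingerBar, LinearMap.smul_apply, LinearMap.sub_apply,
    LinearMap.add_apply, map_smul, map_add, ContinuousLinearMap.coe_coe,
    LineDeriv.lineDerivOpCLM_apply, lineDerivOp_comm Complex.I 1, smul_add, smul_sub, smul_smul]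
  match_scalars
  · ring
  · linear_combination (1 : ℂ) * hI
  · ring

/-- On densities the Laplacian is `-2B` times the double commutator with the ladder operators. -/
lemma laplacian_overlap {B : ℝ} (hB : 0 < B) (u v : 𝓢(ℂ, ℂ)) :
    Laplacian.laplacian (overlap u v) = (2 * B : ℂ) •
      (overlap (annihilate B u) (annihilate B v) - overlap u (create B (annihilate B v))
        - overlap (annihilate B (create B u)) v + overlap (create B u) (create B v)) := by
  have h2 : (Real.sqrt (B / 2) : ℂ) * (Real.sqrt (B / 2) : ℂ) = B / 2 := by
    rw [← Complex.ofReal_mul, Real.mul_self_sqrt (by positivity)]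
    push_cast; rfl
  rw [laplacian_eq_wirtinger, wirtingerBar_overlap_eq_ladder hB, map_smul, map_sub,
    wirtinger_overlap_eq_ladder hB, wirtinger_overlap_eq_ladder hB, ← smul_sub, smul_smul,
    smul_smul, mul_assoc, h2]
  module

lemma integral_lineDerivOp (η : 𝓢(ℂ, ℂ)) (v : ℂ) : ∫ z, (∂_{v} η : 𝓢(ℂ, ℂ)) z = 0 := by
  have hint : Integrable (fun z => fderiv ℝ η z v) := (∂_{v} η : 𝓢(ℂ, ℂ)).integrable
  have h := integral_mul_fderiv_eq_neg_fderiv_mul_of_integrable (𝕜 := ℂ)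
    (μ := (volume : Measure ℂ)) (f := fun _ : ℂ => (1 : ℂ)) (g := ⇑η) (v := v)
    (by simp) (by simpa only [one_mul] using hint)
    (by simpa only [one_mul] using η.integrable)
    (fun _ _ => differentiableAt_const _) (fun _ _ => η.differentiableAt)
  simp only [one_mul, fderiv_fun_const, Pi.zero_apply, _root_.zero_apply, zero_mul,
    integral_zero, neg_zero] at h
  exact h

lemma integral_wirtinger (η : 𝓢(ℂ, ℂ)) : ∫ z, wirtinger η z = 0 := by
  have h : ∀ z, wirtinger η z = (1 / 2 : ℂ) * ((∂_{(1 : ℂ)} η : 𝓢(ℂ, ℂ)) z)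
      - (Complex.I / 2) * ((∂_{Complex.I} η : 𝓢(ℂ, ℂ)) z) := by
    intro z
    rw [wirtinger_apply, SchwartzMap.lineDerivOp_apply_eq_fderiv,
      SchwartzMap.lineDerivOp_apply_eq_fderiv]
    ring
  simp_rw [h]
  rw [integral_sub ((SchwartzMap.integrable _).const_mul _)
    ((SchwartzMap.integrable _).const_mul _), integral_const_mul, integral_const_mul,
    integral_lineDerivOp, integral_lineDerivOp]
  simp

lemma integral_overlap_annihilate {B : ℝ} (hB : 0 < B) (u v : 𝓢(ℂ, ℂ)) :
    ∫ z, overlap (annihilate B u) v z = ∫ z, overlap u (create B v) z := by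
  have h := integral_wirtinger (overlap u v)
  have hs : (Real.sqrt (B / 2) : ℂ) ≠ 0 := by
    have : Real.sqrt (B / 2) ≠ 0 := by positivity
    exact_mod_cast this
  rw [wirtinger_overlap_eq_ladder hB] at h
  simp only [smul_apply, sub_apply, smul_eq_mul] at h
  rw [integral_const_mul, integral_sub (SchwartzMap.integrable _) (SchwartzMap.integrable _)] at h
  exact sub_eq_zero.1 ((mul_eq_zero.1 h).resolve_left hs)

lemma conj_integral_overlap (u v : 𝓢(ℂ, ℂ)) :
    conj (∫ z, overlap u v z) = ∫ z, overlap v u z := by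
  rw [← integral_conj]
  simp only [overlap_apply, map_mul, Complex.conj_conj, mul_comm]

lemma integral_overlap_create {B : ℝ} (hB : 0 < B) (u v : 𝓢(ℂ, ℂ)) :
    ∫ z, overlap (create B u) v z = ∫ z, overlap u (annihilate B v) z := by
  rw [← conj_integral_overlap, ← integral_overlap_annihilate hB, conj_integral_overlap]

/-! ### Gaussians and Landau states as Schwartz functions -/

lemma one_add_pow_mul_exp_le {c : ℝ} (hc : 0 < c) (j : ℕ) :
    ∃ M : ℝ, ∀ t : ℝ, 0 ≤ t → (1 + t) ^ j * Real.exp (-c * t ^ 2) ≤ M := by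
  refine ⟨2 ^ j * (j.factorial * Real.exp c / c ^ j), fun t ht => ?_⟩
  have h1 : (1 + t) ^ j ≤ (2 * (1 + t ^ 2)) ^ j := by
    gcongr
    nlinarith [sq_nonneg (1 - t)]
  have h2 := Real.pow_div_factorial_le_exp (c * (1 + t ^ 2)) (by positivity) j
  rw [div_le_iff₀ (by positivity), mul_pow, mul_add, mul_one] at h2
  have h3 : (1 + t ^ 2) ^ j ≤ j.factorial * Real.exp c / c ^ j * Real.exp (c * t ^ 2) := by
    rw [div_mul_eq_mul_div, le_div_iff₀ (by positivity), mul_assoc, ← Real.exp_add]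
    linarith
  calc (1 + t) ^ j * Real.exp (-c * t ^ 2)
      ≤ (2 ^ j * (j.factorial * Real.exp c / c ^ j * Real.exp (c * t ^ 2)))
        * Real.exp (-c * t ^ 2) := by
        gcongr
        rw [mul_pow] at h1
        exact h1.trans (by gcongr)
    _ = 2 ^ j * (j.factorial * Real.exp c / c ^ j)
        * (Real.exp (c * t ^ 2) * Real.exp (-c * t ^ 2)) := by ring
    _ = _ := by rw [← Real.exp_add]; simp

lemma exists_schwartz_gaussian {c : ℝ} (hc : 0 < c) :
    ∃ θ : 𝓢(ℂ, ℂ), ∀ z, θ z = (Real.exp (-c * ‖z‖ ^ 2) : ℂ) := by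
  have hg : (fun z : ℂ => -c * ‖z‖ ^ 2).HasTemperateGrowth :=
    (Function.HasTemperateGrowth.const (-c)).mul (Function.hasTemperateGrowth_norm_sq ℂ)
  let θ : 𝓢(ℂ, ℝ) :=
    { toFun := Real.exp ∘ fun z : ℂ => -c * ‖z‖ ^ 2
      smooth' := Real.contDiff_exp.comp hg.1
      decay' := by
        intro k n
        obtain ⟨l, C, hC, hl⟩ := hg.norm_iteratedFDeriv_le_uniform n
        obtain ⟨M, hM⟩ := one_add_pow_mul_exp_le hc (k + l * n)
        refine ⟨n.factorial * (1 + C) ^ n * M, fun z => ?_⟩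
        have hz : (0 : ℝ) ≤ ‖z‖ := norm_nonneg z
        have h := norm_iteratedFDeriv_comp_le (N := (n : ℕ∞)) Real.contDiff_exp
          (hg.1.of_le (mod_cast le_top)) le_rfl z
          (C := Real.exp (-c * ‖z‖ ^ 2)) (D := (1 + C) * (1 + ‖z‖) ^ l)
          (fun i _ => by
            rw [norm_iteratedFDeriv_eq_norm_iteratedDeriv, iteratedDeriv_eq_iterate,
              Real.iter_deriv_exp, Real.norm_of_nonneg (Real.exp_pos _).le])
          (fun i hi hin => by
            refine (hl i hin z).trans ?_
            have h1 : 1 ≤ (1 + C) * (1 + ‖z‖) ^ l :=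
              one_le_mul_of_one_le_of_one_le (by linarith) (one_le_pow₀ (by linarith))
            refine le_trans ?_ (le_self_pow₀ h1 (by omega))
            gcongr
            linarith)
        calc _ ≤ (1 + ‖z‖) ^ k * (n.factorial * Real.exp (-c * ‖z‖ ^ 2)
                * ((1 + C) * (1 + ‖z‖) ^ l) ^ n) := by
              gcongr
              linarith
          _ = n.factorial * (1 + C) ^ n
                * ((1 + ‖z‖) ^ (k + l * n) * Real.exp (-c * ‖z‖ ^ 2)) := by
              rw [mul_pow, ← pow_mul, pow_add]; ring
          _ ≤ _ := by
              gcongr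
              exact hM _ hz }
  exact ⟨SchwartzMap.postcompCLM (𝕜 := ℝ) Complex.ofRealCLM θ, fun z => by
    rw [SchwartzMap.postcompCLM_apply]; rfl⟩

/-- The Gaussian monomial `z^a z̄^b exp(-c |z|²)` as a Schwartz function. -/
def gaussMonomial {c : ℝ} (hc : 0 < c) (a b : ℕ) : 𝓢(ℂ, ℂ) :=
  (mulZ ^ a) ((mulZBar ^ b) (exists_schwartz_gaussian hc).choose)

lemma mulZ_pow_apply (a : ℕ) (η : 𝓢(ℂ, ℂ)) (z : ℂ) : (mulZ ^ a) η z = z ^ a * η z := by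
  induction a with
  | zero => simp
  | succ k ih => rw [pow_succ', Module.End.mul_apply, mulZ_apply, ih, pow_succ]; ring

lemma mulZBar_pow_apply (a : ℕ) (η : 𝓢(ℂ, ℂ)) (z : ℂ) :
    (mulZBar ^ a) η z = conj z ^ a * η z := by
  induction a with
  | zero => simp
  | succ k ih => rw [pow_succ', Module.End.mul_apply, mulZBar_apply, ih, pow_succ]; ring

lemma gaussMonomial_apply {c : ℝ} (hc : 0 < c) (a b : ℕ) (z : ℂ) :
    gaussMonomial hc a b z = z ^ a * conj z ^ b * (Real.exp (-c * ‖z‖ ^ 2) : ℂ) := by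
  rw [gaussMonomial, mulZ_pow_apply, mulZBar_pow_apply,
    (exists_schwartz_gaussian hc).choose_spec, mul_assoc]

lemma hasFDerivAt_gaussian (c : ℝ) (z : ℂ) :
    HasFDerivAt (fun z : ℂ => (Real.exp (-c * ‖z‖ ^ 2) : ℂ))
      (Complex.ofRealCLM.comp (Real.exp (-c * ‖z‖ ^ 2) • (-c) • (2 : ℕ) • innerSL ℝ z)) z := by
  have h := ((hasStrictFDerivAt_norm_sq z).hasFDerivAt.const_mul (-c)).exp
  exact Complex.ofRealCLM.hasFDerivAt.comp z h

lemma wirtinger_gaussMonomial {c : ℝ} (hc : 0 < c) (a b : ℕ) :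
    wirtinger (gaussMonomial hc a b)
      = (a : ℂ) • gaussMonomial hc (a - 1) b - (c : ℂ) • gaussMonomial hc a (b + 1) := by
  have h0 : wirtinger (gaussMonomial hc 0 0) = -(c : ℂ) • gaussMonomial hc 0 1 := by
    ext z
    have : ⇑(gaussMonomial hc 0 0) = fun z : ℂ => (Real.exp (-c * ‖z‖ ^ 2) : ℂ) := by
      funext z; simp [gaussMonomial_apply]
    rw [wirtinger_apply, this, (hasFDerivAt_gaussian c z).fderiv]
    simp only [smul_apply, gaussMonomial_apply, ContinuousLinearMap.comp_apply,
      innerSL_apply_apply, Complex.inner, smul_eq_mul,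
      Complex.ofRealCLM_apply]
    have hz : conj z = z.re - z.im * Complex.I := by
      apply Complex.ext <;> simp
    simp [hz]
    ring
  have hb : ∀ b, wirtinger * mulZBar ^ b = mulZBar ^ b * wirtinger := fun b =>
    (show Commute wirtinger mulZBar from wirtinger_mulZBar).pow_right b
  have ha : ∀ a : ℕ, wirtinger * mulZ ^ a = mulZ ^ a * wirtinger + (a : ℂ) • mulZ ^ (a - 1) := by
    intro a
    induction a with
    | zero => simp
    | succ k ih =>
      rw [pow_succ, ← mul_assoc, ih, add_mul, mul_assoc, wirtinger_mulZ]
      rcases k with _ | k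
      · simp
      · simp only [Nat.add_sub_cancel, smul_mul_assoc, ← pow_succ, mul_add, ← mul_assoc]
        push_cast
        module
  have hab := congrArg (fun T => T ((mulZBar ^ b) (exists_schwartz_gaussian hc).choose)) (ha a)
  have hbb := congrArg (fun T => T (exists_schwartz_gaussian hc).choose) (hb b)
  simp only [Module.End.mul_apply, LinearMap.add_apply, LinearMap.smul_apply] at hab hbb
  have h00 : gaussMonomial hc 0 0 = (exists_schwartz_gaussian hc).choose := by
    simp [gaussMonomial]
  rw [gaussMonomial, hab, hbb, ← h00, h0]
  ext z
  simp only [add_apply, sub_apply, smul_apply, gaussMonomial_apply, mulZ_pow_apply,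
    mulZBar_pow_apply, smul_eq_mul]
  ring

lemma wirtingerBar_gaussMonomial {c : ℝ} (hc : 0 < c) (a : ℕ) :
    wirtingerBar (gaussMonomial hc a 0) = -(c : ℂ) • gaussMonomial hc (a + 1) 0 := by
  have h0 : wirtingerBar (gaussMonomial hc 0 0) = -(c : ℂ) • gaussMonomial hc 1 0 := by
    ext z
    have : ⇑(gaussMonomial hc 0 0) = fun z : ℂ => (Real.exp (-c * ‖z‖ ^ 2) : ℂ) := by
      funext z; simp [gaussMonomial_apply]
    rw [wirtingerBar_apply, this, (hasFDerivAt_gaussian c z).fderiv]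
    simp only [smul_apply, gaussMonomial_apply, ContinuousLinearMap.comp_apply,
      innerSL_apply_apply, Complex.inner, smul_eq_mul,
      Complex.ofRealCLM_apply]
    simp
    linear_combination (-c * Complex.exp (-(c * ‖z‖ ^ 2))) * Complex.re_add_im z
  have ha : wirtingerBar * mulZ ^ a = mulZ ^ a * wirtingerBar :=
    (show Commute wirtingerBar mulZ from wirtingerBar_mulZ).pow_right a
  have hab := congrArg (fun T => T (gaussMonomial hc 0 0)) ha
  simp only [Module.End.mul_apply] at hab
  have h1 : gaussMonomial hc a 0 = (mulZ ^ a) (gaussMonomial hc 0 0) := by simp [gaussMonomial]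
  rw [h1, hab, h0]
  ext z
  simp only [smul_apply, gaussMonomial_apply, mulZ_pow_apply, smul_eq_mul]
  ring

/-- The Landau state `φ_{n,m}` as a Schwartz function. -/
def state {B : ℝ} (hB : 0 < B) (n m : ℕ) : 𝓢(ℂ, ℂ) :=
  ((Real.sqrt n.factorial)⁻¹ : ℂ) • ((create B) ^ n)
    ((Real.sqrt ((B / 2) ^ (m + 1) / (Real.pi * m.factorial)) : ℂ) •
      gaussMonomial (show 0 < B / 4 by positivity) m 0)

lemma coe_state {B : ℝ} (hB : 0 < B) (n m : ℕ) : ⇑(state hB n m) = landauState B n m := by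
  have h : ∀ (k : ℕ) (η : 𝓢(ℂ, ℂ)), ⇑(((create B) ^ k) η) = (creation B)^[k] η := by
    intro k η
    induction k with
    | zero => rfl
    | succ k ih =>
      rw [pow_succ', Module.End.mul_apply, create_apply hB, ih, Function.iterate_succ_apply']
  have h0 : ⇑((Real.sqrt ((B / 2) ^ (m + 1) / (Real.pi * m.factorial)) : ℂ) •
      gaussMonomial (show 0 < B / 4 by positivity) m 0) = lowestState B m := by
    funext z
    simp [gaussMonomial_apply, lowestState, mul_assoc]
  funext z
  rw [state, smul_apply, h, h0, landauState, smul_eq_mul]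

lemma create_state {B : ℝ} (hB : 0 < B) (n m : ℕ) :
    create B (state hB n m) = (Real.sqrt (n + 1) : ℂ) • state hB (n + 1) m := by
  have h1 : (Real.sqrt (n + 1) : ℂ) ≠ 0 := by
    have : Real.sqrt (n + 1) ≠ 0 := by positivity
    exact_mod_cast this
  rw [state, state, map_smul, smul_smul, pow_succ' (create B) n, Module.End.mul_apply,
    Nat.factorial_succ, Nat.cast_mul, Real.sqrt_mul (by positivity)]
  congr 1
  push_cast
  field_simp

lemma annihilate_state_zero {B : ℝ} (hB : 0 < B) (m : ℕ) :
    annihilate B (state hB 0 m) = 0 := by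
  simp only [state, pow_zero, Module.End.one_apply, map_smul]
  have : annihilate B (gaussMonomial (show 0 < B / 4 by positivity) m 0) = 0 := by
    simp only [annihilate, LinearMap.smul_apply, LinearMap.add_apply, wirtingerBar_gaussMonomial]
    ext z
    simp only [smul_apply, add_apply, gaussMonomial_apply, mulZ_apply, smul_eq_mul, zero_apply]
    ring
  rw [this, smul_zero, smul_zero]

lemma annihilate_state_succ {B : ℝ} (hB : 0 < B) (n m : ℕ) :
    annihilate B (state hB (n + 1) m) = (Real.sqrt (n + 1) : ℂ) • state hB n m := by
  have hs : ∀ k : ℕ, (Real.sqrt (k + 1) : ℂ) * (Real.sqrt (k + 1) : ℂ) = k + 1 := by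
    intro k
    rw [← Complex.ofReal_mul, Real.mul_self_sqrt (by positivity)]
    push_cast; rfl
  have h1 : ∀ k : ℕ, (Real.sqrt (k + 1) : ℂ) ≠ 0 := by
    intro k
    have : Real.sqrt (k + 1) ≠ 0 := by positivity
    exact_mod_cast this
  have hcomm : ∀ η, annihilate B (create B η) = create B (annihilate B η) + η := fun η => by
    simpa using congrArg (fun T => T η) (annihilate_mul_create hB)
  have key : ∀ n : ℕ, annihilate B (create B (state hB n m)) = (n + 1 : ℂ) • state hB n m := by
    intro n
    rw [hcomm]
    induction n with
    | zero => simp [annihilate_state_zero]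
    | succ n ih =>
      have e : state hB (n + 1) m = (Real.sqrt (n + 1) : ℂ)⁻¹ • create B (state hB n m) := by
        rw [create_state, smul_smul, inv_mul_cancel₀ (h1 n), one_smul]
      rw [← hcomm] at ih
      rw [e, map_smul, ih, map_smul, map_smul]
      push_cast
      module
  have e : state hB (n + 1) m = (Real.sqrt (n + 1) : ℂ)⁻¹ • create B (state hB n m) := by
    rw [create_state, smul_smul, inv_mul_cancel₀ (h1 n), one_smul]
  rw [e, map_smul, key, smul_smul, ← hs n, inv_mul_cancel_left₀ (h1 n)]

lemma create_annihilate_state {B : ℝ} (hB : 0 < B) (n m : ℕ) :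
    create B (annihilate B (state hB n m)) = (n : ℂ) • state hB n m := by
  rcases n with _ | n
  · simp [annihilate_state_zero]
  · rw [annihilate_state_succ, map_smul, create_state, smul_smul, ← Complex.ofReal_mul,
      Real.mul_self_sqrt (by positivity)]
    push_cast; rfl

lemma landauOp_state {B : ℝ} (hB : 0 < B) (n m : ℕ) :
    landauOp B (state hB n m) = ⇑(((2 * B * (n + 1 / 2) : ℝ) : ℂ) • state hB n m) := by
  rw [landauOp_eq hB, create_annihilate_state]
  congr 1
  push_cast
  module

/-! ### Orthonormality of the Landau states -/

lemma exists_circle_pow_eq_neg_one {p q : ℕ} (h : p ≠ q) :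
    ∃ a : Circle, conj (a : ℂ) ^ p * (a : ℂ) ^ q = -1 := by
  have hd : ((q : ℂ) - p) ≠ 0 := by
    rw [sub_ne_zero]; exact_mod_cast h.symm
  refine ⟨Circle.exp (Real.pi / (q - p)), ?_⟩
  rw [Circle.coe_exp, ← Complex.exp_conj, ← Complex.exp_nat_mul, ← Complex.exp_nat_mul,
    ← Complex.exp_add, ← Complex.exp_pi_mul_I]
  congr 1
  simp only [map_mul, Complex.conj_ofReal, Complex.conj_I]
  push_cast
  field_simp
  ring

lemma integral_eq_zero_of_rotation {f : ℂ → ℂ} (a : Circle) (h : ∀ z, f (a * z) = -f z) :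
    ∫ z, f z = 0 := by
  have h1 : ∫ z, f (rotation a z) = ∫ z, f z :=
    (rotation a).measurePreserving.integral_comp
      (rotation a).toHomeomorph.measurableEmbedding f
  simp only [rotation_apply, h, integral_neg] at h1
  linear_combination (-1 / 2 : ℂ) * h1

lemma state_zero_apply {B : ℝ} (hB : 0 < B) (m : ℕ) (z : ℂ) :
    state hB 0 m z = (Real.sqrt ((B / 2) ^ (m + 1) / (Real.pi * m.factorial)) : ℂ) *
      (z ^ m * (Real.exp (-(B / 4) * ‖z‖ ^ 2) : ℂ)) := by
  simp [state, gaussMonomial_apply]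

lemma overlap_state_zero_rotation {B : ℝ} (hB : 0 < B) (m l : ℕ) (a : Circle)
    (ha : conj (a : ℂ) ^ m * (a : ℂ) ^ l = -1) (z : ℂ) :
    overlap (state hB 0 m) (state hB 0 l) (a * z)
      = -overlap (state hB 0 m) (state hB 0 l) z := by
  simp only [overlap_apply, state_zero_apply, norm_mul, Circle.norm_coe, one_mul, map_mul, map_pow,
    Complex.conj_ofReal, mul_pow]
  linear_combination (conj z ^ m * z ^ l * (Real.exp (-(B / 4) * ‖z‖ ^ 2) : ℂ) ^ 2
    * (Real.sqrt ((B / 2) ^ (m + 1) / (Real.pi * m.factorial)) : ℂ)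
    * (Real.sqrt ((B / 2) ^ (l + 1) / (Real.pi * l.factorial)) : ℂ)) * ha

lemma integral_overlap_state_zero {B : ℝ} (hB : 0 < B) (m l : ℕ) :
    ∫ z, overlap (state hB 0 m) (state hB 0 l) z = if m = l then 1 else 0 := by
  split_ifs with h
  · subst h
    have h1 : ∀ z : ℂ, overlap (state hB 0 m) (state hB 0 m) z
        = ((((B / 2) ^ (m + 1) / (Real.pi * m.factorial)) *
          (‖z‖ ^ ((2 * m : ℕ) : ℝ) * Real.exp (-(B / 2) * ‖z‖ ^ (2 : ℝ))) : ℝ) : ℂ) := by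
      intro z
      have hs : (Real.sqrt ((B / 2) ^ (m + 1) / (Real.pi * m.factorial)) : ℂ)
          * (Real.sqrt ((B / 2) ^ (m + 1) / (Real.pi * m.factorial)) : ℂ)
          = (((B / 2) ^ (m + 1) / (Real.pi * m.factorial) : ℝ) : ℂ) := by
        rw [← Complex.ofReal_mul, Real.mul_self_sqrt (by positivity)]
      have hz : conj z ^ m * z ^ m = ((‖z‖ ^ (2 * m) : ℝ) : ℂ) := by
        rw [← mul_pow, mul_comm, Complex.mul_conj, Complex.normSq_eq_norm_sq, ← Complex.ofReal_pow,
          ← pow_mul]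
      have he : (Real.exp (-(B / 4) * ‖z‖ ^ 2) : ℂ) * (Real.exp (-(B / 4) * ‖z‖ ^ 2) : ℂ)
          = (Real.exp (-(B / 2) * ‖z‖ ^ 2) : ℂ) := by
        rw [← Complex.ofReal_mul, ← Real.exp_add]
        ring_nf
      rw [Real.rpow_natCast, Real.rpow_ofNat, Complex.ofReal_mul, Complex.ofReal_mul, ← hs, ← hz,
        ← he]
      simp only [overlap_apply, state_zero_apply, map_mul, map_pow, Complex.conj_ofReal]
      ring
    simp_rw [h1]
    rw [integral_complex_ofReal, integral_const_mul,
      Complex.integral_rpow_mul_exp_neg_mul_rpow (by norm_num)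
        (by have : (0 : ℝ) ≤ ((2 * m : ℕ) : ℝ) := by positivity
            linarith) (by positivity)]
    have : (((2 * m : ℕ) : ℝ) + 2) / 2 = m + 1 := by push_cast; ring
    rw [neg_div, this, Real.Gamma_nat_eq_factorial, Real.rpow_neg (by positivity)]
    rw [show ((m : ℝ) + 1) = ((m + 1 : ℕ) : ℝ) by push_cast; rfl, Real.rpow_natCast]
    have := Real.pi_pos
    norm_cast
    field_simp
  · obtain ⟨a, ha⟩ := exists_circle_pow_eq_neg_one h
    exact integral_eq_zero_of_rotation a (overlap_state_zero_rotation hB m l a ha)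

lemma sqrt_succ_ne_zero (n : ℕ) : (Real.sqrt (n + 1) : ℂ) ≠ 0 := by
  have : Real.sqrt (n + 1) ≠ 0 := by positivity
  exact_mod_cast this

lemma integral_overlap_state {B : ℝ} (hB : 0 < B) (n n' m m' : ℕ) :
    ∫ z, overlap (state hB n m) (state hB n' m') z = if n = n' ∧ m = m' then 1 else 0 := by
  have hl : ∀ (c : ℂ) (u v : 𝓢(ℂ, ℂ)),
      ∫ z, overlap (c • u) v z = conj c * ∫ z, overlap u v z := by
    intro c u v
    rw [overlap_smul_left, ← integral_const_mul]; rfl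
  have hr : ∀ (c : ℂ) (u v : 𝓢(ℂ, ℂ)),
      ∫ z, overlap u (c • v) z = c * ∫ z, overlap u v z := by
    intro c u v
    rw [overlap_smul_right, ← integral_const_mul]; rfl
  have hsucc : ∀ n m, state hB (n + 1) m
      = (Real.sqrt (n + 1) : ℂ)⁻¹ • create B (state hB n m) := fun n m => by
    rw [create_state, smul_smul, inv_mul_cancel₀ (sqrt_succ_ne_zero n), one_smul]
  induction n generalizing n' with
  | zero =>
    rcases n' with _ | n'
    · simpa using integral_overlap_state_zero hB m m'
    · rw [hsucc, hr, ← integral_overlap_annihilate hB, annihilate_state_zero]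
      simp
  | succ n ih =>
    rw [hsucc, hl, integral_overlap_create hB]
    rcases n' with _ | n'
    · simp [annihilate_state_zero]
    · rw [annihilate_state_succ, hr, ih]
      by_cases h : n = n' ∧ m = m'
      · obtain ⟨rfl, rfl⟩ := h
        have := sqrt_succ_ne_zero n
        simp [this]
      · rw [if_neg h, if_neg (by simpa using h)]
        simp

/-! ### Span of the Landau states -/

lemma create_gaussMonomial {B : ℝ} (hB : 0 < B / 4) (a b : ℕ) :
    create B (gaussMonomial hB a b) = (Real.sqrt (2 / B) : ℂ) •
      (((B / 2 : ℝ) : ℂ) • gaussMonomial hB a (b + 1) - (a : ℂ) • gaussMonomial hB (a - 1) b) := by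
  rw [create, LinearMap.smul_apply, LinearMap.sub_apply, LinearMap.smul_apply,
    wirtinger_gaussMonomial]
  have : mulZBar (gaussMonomial hB a b) = gaussMonomial hB a (b + 1) := by
    ext z
    rw [mulZBar_apply, gaussMonomial_apply, gaussMonomial_apply]
    ring
  rw [this]
  push_cast
  module

lemma state_mem_span_gaussMonomial {B : ℝ} (hB : 0 < B) (n m : ℕ) :
    state hB n m ∈ Submodule.span ℂ (Set.range fun p : ℕ × ℕ =>
      gaussMonomial (show 0 < B / 4 by positivity) p.1 p.2) := by
  set G := Submodule.span ℂ (Set.range fun p : ℕ × ℕ =>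
      gaussMonomial (show 0 < B / 4 by positivity) p.1 p.2) with hG
  have hmem : ∀ a b, gaussMonomial (show 0 < B / 4 by positivity) a b ∈ G := fun a b =>
    Submodule.subset_span ⟨(a, b), rfl⟩
  have hcr : G ≤ G.comap (create B) := by
    rw [hG, Submodule.span_le]
    rintro _ ⟨⟨a, b⟩, rfl⟩
    change create B _ ∈ G
    rw [create_gaussMonomial]
    exact G.smul_mem _ (G.sub_mem (G.smul_mem _ (hmem _ _)) (G.smul_mem _ (hmem _ _)))
  refine G.smul_mem _ ?_
  induction n with
  | zero => exact G.smul_mem _ (hmem _ _)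
  | succ k ih =>
    rw [pow_succ', Module.End.mul_apply]
    exact hcr ih

lemma gaussMonomial_mem_span_state {B : ℝ} (hB : 0 < B) (a b : ℕ) :
    gaussMonomial (show 0 < B / 4 by positivity) a b ∈
      Submodule.span ℂ (Set.range fun p : ℕ × ℕ => state hB p.1 p.2) := by
  set S := Submodule.span ℂ (Set.range fun p : ℕ × ℕ => state hB p.1 p.2) with hS
  have hmem : ∀ n m, state hB n m ∈ S := fun n m => Submodule.subset_span ⟨(n, m), rfl⟩
  have hcr : S ≤ S.comap (create B) := by
    rw [hS, Submodule.span_le]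
    rintro _ ⟨⟨n, m⟩, rfl⟩
    change create B _ ∈ S
    rw [create_state]
    exact S.smul_mem _ (hmem _ _)
  induction b generalizing a with
  | zero =>
    have h := hmem 0 a
    have hc : (Real.sqrt ((B / 2) ^ (a + 1) / (Real.pi * a.factorial)) : ℂ) ≠ 0 := by
      have := Real.pi_pos
      have : Real.sqrt ((B / 2) ^ (a + 1) / (Real.pi * a.factorial)) ≠ 0 := by positivity
      exact_mod_cast this
    rwa [state, pow_zero, Module.End.one_apply, Submodule.smul_mem_iff _ (by simp),
      Submodule.smul_mem_iff _ hc] at h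
  | succ b ih =>
    have h := hcr (ih a)
    rw [Submodule.mem_comap, create_gaussMonomial] at h
    have hc : (Real.sqrt (2 / B) : ℂ) ≠ 0 := by
      have : Real.sqrt (2 / B) ≠ 0 := by positivity
      exact_mod_cast this
    have hB2 : ((B / 2 : ℝ) : ℂ) ≠ 0 := by
      have : B / 2 ≠ 0 := by positivity
      exact_mod_cast this
    rw [Submodule.smul_mem_iff _ hc, Submodule.sub_mem_iff_left _ (S.smul_mem _ (ih _)),
      Submodule.smul_mem_iff _ hB2] at h
    exact h

lemma exists_norm_state_le {B : ℝ} (hB : 0 < B) (n m : ℕ) :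
    ∃ (C : ℝ) (j : ℕ), 0 ≤ C ∧
      ∀ z, ‖state hB n m z‖ ≤ C * (1 + ‖z‖) ^ j * Real.exp (-(B / 4) * ‖z‖ ^ 2) := by
  have hs := state_mem_span_gaussMonomial hB n m
  generalize state hB n m = u at hs ⊢
  induction hs using Submodule.span_induction with
  | mem _ h =>
    obtain ⟨⟨a, b⟩, rfl⟩ := h
    refine ⟨1, a + b, zero_le_one, fun z => ?_⟩
    simp only [gaussMonomial_apply, norm_mul, norm_pow, RCLike.norm_conj, Complex.norm_real,
      Real.norm_eq_abs, Real.abs_exp, ← pow_add, one_mul]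
    gcongr
    linarith
  | zero => exact ⟨0, 0, le_rfl, fun z => by simp⟩
  | add x y _ _ hx hy =>
    obtain ⟨C, j, hC, h⟩ := hx
    obtain ⟨C', j', hC', h'⟩ := hy
    refine ⟨C + C', max j j', by positivity, fun z => ?_⟩
    have hz : 1 ≤ 1 + ‖z‖ := by linarith [norm_nonneg z]
    calc ‖(x + y) z‖ ≤ ‖x z‖ + ‖y z‖ := norm_add_le _ _
      _ ≤ C * (1 + ‖z‖) ^ (max j j') * Real.exp (-(B / 4) * ‖z‖ ^ 2)
          + C' * (1 + ‖z‖) ^ (max j j') * Real.exp (-(B / 4) * ‖z‖ ^ 2) := by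
        refine add_le_add ((h z).trans ?_) ((h' z).trans ?_)
        · gcongr
          exact le_max_left _ _
        · gcongr
          exact le_max_right _ _
      _ = _ := by ring
  | smul c x _ hx =>
    obtain ⟨C, j, hC, h⟩ := hx
    refine ⟨‖c‖ * C, j, by positivity, fun z => ?_⟩
    rw [smul_apply, norm_smul, mul_assoc, mul_assoc, ← mul_assoc C]
    gcongr
    exact h z

/-! ### Completeness of the Landau states -/

/-- Integrable functions with vanishing Fourier transform vanish almost everywhere. -/
lemma ae_eq_zero_of_fourier_eq_zero {g : ℂ → ℂ} (hg : Integrable g)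
    (h : ∀ w, FourierTransform.fourier g w = 0) : ∀ᵐ z, g z = 0 := by
  refine ae_eq_zero_of_integral_contDiff_smul_eq_zero hg.locallyIntegrable fun η hη hc => ?_
  have hη' : HasCompactSupport (fun z => (η z : ℂ)) := hc.comp_left Complex.ofReal_zero
  let θ : 𝓢(ℂ, ℂ) := hη'.toSchwartzMap (Complex.ofRealCLM.contDiff.comp hη)
  have hθ : ∀ z, θ z = (η z : ℂ) := fun z => rfl
  set ξ : 𝓢(ℂ, ℂ) := FourierTransformInv.fourierInv θ
  have hξ : (FourierTransform.fourier ξ : 𝓢(ℂ, ℂ)) = θ := FourierTransform.fourier_fourierInv_eq θ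
  have h1 : ∫ z, (FourierTransform.fourier ⇑ξ z) * g z = ∫ z, ξ z * FourierTransform.fourier g z := by
    simpa using! VectorFourier.integral_bilin_fourierIntegral_eq_flip
      (ContinuousLinearMap.mul ℂ ℂ) (L := innerₗ ℂ)
      Real.continuous_fourierChar continuous_inner ξ.integrable hg
  rw [← SchwartzMap.fourier_coe, hξ] at h1
  simpa [h, hθ] using h1

lemma exp_linear_sub_le {c κ r : ℝ} (hc : 0 < c) :
    Real.exp (κ * r) * Real.exp (-c * r ^ 2)
      ≤ Real.exp (κ ^ 2 / (2 * c)) * Real.exp (-(c / 2) * r ^ 2) := by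
  rw [← Real.exp_add, ← Real.exp_add, Real.exp_le_exp]
  have : κ * r ≤ κ ^ 2 / (2 * c) + c / 2 * r ^ 2 := by
    rw [← sub_nonneg]
    have : κ ^ 2 / (2 * c) + c / 2 * r ^ 2 - κ * r = (κ - c * r) ^ 2 / (2 * c) := by
      field_simp
      ring
    rw [this]
    positivity
  linarith

lemma integrable_schwartz_mul' (θ : 𝓢(ℂ, ℂ)) (ψ : Lp ℂ 2 (volume : Measure ℂ)) :
    Integrable (fun z => θ z * ψ z) :=
  (θ.memLp 2 (volume : Measure ℂ)).integrable_mul (Lp.memLp ψ)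

lemma norm_gaussian_apply {c : ℝ} (hc : 0 < c) (z : ℂ) :
    ‖gaussMonomial hc 0 0 z‖ = Real.exp (-c * ‖z‖ ^ 2) := by
  simp only [gaussMonomial_apply, pow_zero, one_mul, Complex.norm_real, Real.norm_eq_abs,
    Real.abs_exp]

lemma gaussian_ne_zero {c : ℝ} (hc : 0 < c) (z : ℂ) : gaussMonomial hc 0 0 z ≠ 0 := by
  rw [← norm_ne_zero_iff, norm_gaussian_apply]
  exact (Real.exp_pos _).ne'

/-- Polynomials times a Gaussian are total in `L²`: if `ψ` is orthogonal to all of them, the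
Fourier transform of `exp(-c|z|²) ψ`, expanded in powers of the frequency, vanishes. -/
lemma eq_zero_of_integral_gaussMonomial {c : ℝ} (hc : 0 < c) (ψ : Lp ℂ 2 (volume : Measure ℂ))
    (h : ∀ a b, ∫ z, gaussMonomial hc a b z * ψ z = 0) : ψ = 0 := by
  set G := Submodule.span ℂ (Set.range fun p : ℕ × ℕ => gaussMonomial hc p.1 p.2) with hG
  have hmem : ∀ a b, gaussMonomial hc a b ∈ G := fun a b => Submodule.subset_span ⟨(a, b), rfl⟩
  have hG0 : ∀ η ∈ G, ∫ z, η z * ψ z = 0 := by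
    intro η hη
    induction hη using Submodule.span_induction with
    | mem _ h' => obtain ⟨p, rfl⟩ := h'; exact h _ _
    | zero => simp
    | add x y _ _ hx hy =>
      simp only [add_apply, add_mul]
      rw [integral_add (integrable_schwartz_mul' x ψ) (integrable_schwartz_mul' y ψ), hx, hy,
        add_zero]
    | smul a x _ hx =>
      simp only [smul_apply, smul_eq_mul, mul_assoc]
      rw [integral_const_mul, hx, mul_zero]
  have hZ : ∀ η ∈ G, mulZ η ∈ G := by
    intro η hη
    have : G ≤ G.comap mulZ := by
      rw [hG, Submodule.span_le]
      rintro _ ⟨⟨a, b⟩, rfl⟩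
      have : mulZ (gaussMonomial hc a b) = gaussMonomial hc (a + 1) b := by
        ext z; rw [mulZ_apply, gaussMonomial_apply, gaussMonomial_apply]; ring
      change mulZ (gaussMonomial hc a b) ∈ G
      rw [this]; exact hmem _ _
    exact this hη
  have hZB : ∀ η ∈ G, mulZBar η ∈ G := by
    intro η hη
    have : G ≤ G.comap mulZBar := by
      rw [hG, Submodule.span_le]
      rintro _ ⟨⟨a, b⟩, rfl⟩
      have : mulZBar (gaussMonomial hc a b) = gaussMonomial hc a (b + 1) := by
        ext z; rw [mulZBar_apply, gaussMonomial_apply, gaussMonomial_apply]; ring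
      change mulZBar (gaussMonomial hc a b) ∈ G
      rw [this]; exact hmem _ _
    exact this hη
  have hF : ∀ w, FourierTransform.fourier (fun z => gaussMonomial hc 0 0 z * ψ z) w = 0 := by
    intro w
    set T : Module.End ℂ 𝓢(ℂ, ℂ) :=
      (-(Real.pi : ℂ) * Complex.I * w) • mulZBar + (-(Real.pi : ℂ) * Complex.I * conj w) • mulZ
      with hT
    set t : ℂ → ℂ := fun z => ((-2 * Real.pi * inner ℝ z w : ℝ) : ℂ) * Complex.I with ht
    have hTt : ∀ (η : 𝓢(ℂ, ℂ)) z, T η z = t z * η z := by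
      intro η z
      have hin : ((inner ℝ z w : ℝ) : ℂ) = (conj z * w + z * conj w) / 2 := by
        rw [Complex.inner, Complex.re_eq_add_conj]
        simp only [map_mul, Complex.conj_conj]
        ring
      rw [ht]
      push_cast
      rw [hin]
      simp only [hT, LinearMap.add_apply, LinearMap.smul_apply, add_apply, smul_apply,
        mulZ_apply, mulZBar_apply, smul_eq_mul]
      ring
    have hTk : ∀ k : ℕ, (T ^ k) (gaussMonomial hc 0 0) ∈ G ∧
        ∀ z, (T ^ k) (gaussMonomial hc 0 0) z = t z ^ k * gaussMonomial hc 0 0 z := by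
      intro k
      induction k with
      | zero => exact ⟨hmem 0 0, fun z => by simp⟩
      | succ k ih =>
        rw [pow_succ', Module.End.mul_apply]
        refine ⟨G.add_mem (G.smul_mem _ (hZB _ ih.1)) (G.smul_mem _ (hZ _ ih.1)), fun z => ?_⟩
        rw [hTt, ih.2, pow_succ]; ring
    set κ : ℝ := 2 * Real.pi * ‖w‖ with hκ
    have htn : ∀ z, ‖t z‖ ≤ κ * ‖z‖ := by
      intro z
      rw [ht, norm_mul, Complex.norm_I, mul_one, Complex.norm_real, norm_mul, norm_mul]
      have := norm_inner_le_norm (𝕜 := ℝ) z w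
      have hpi := Real.pi_pos
      simp only [norm_neg, Real.norm_ofNat, Real.norm_eq_abs, abs_of_pos hpi] at this ⊢
      calc _ ≤ 2 * Real.pi * (‖z‖ * ‖w‖) := by gcongr
        _ = _ := by rw [hκ]; ring
    have hsum := hasSum_integral_of_dominated_convergence (μ := (volume : Measure ℂ))
      (F := fun (k : ℕ) z => ((k.factorial : ℂ)⁻¹ • (T ^ k) (gaussMonomial hc 0 0)) z * ψ z)
      (f := fun z => Complex.exp (t z) * (gaussMonomial hc 0 0 z * ψ z))
      (fun k z => ((κ * ‖z‖) ^ k / k.factorial) * ‖gaussMonomial hc 0 0 z * ψ z‖)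
      (fun k => (integrable_schwartz_mul' _ ψ).aestronglyMeasurable)
      (fun k => Filter.Eventually.of_forall fun z => by
        rw [smul_apply, (hTk k).2, smul_eq_mul, mul_assoc, mul_assoc, norm_mul, norm_mul (t z ^ k),
          norm_inv, norm_pow, Complex.norm_natCast, ← mul_assoc, inv_mul_eq_div]
        gcongr
        exact htn z)
      (Filter.Eventually.of_forall fun z =>
        (Real.summable_pow_div_factorial _).mul_right _)
      (by
        have he : ∀ z : ℂ, ∑' k : ℕ, (κ * ‖z‖) ^ k / k.factorial
            * ‖gaussMonomial hc 0 0 z * ψ z‖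
            = Real.exp (κ * ‖z‖) * ‖gaussMonomial hc 0 0 z * ψ z‖ := by
          intro z
          rw [tsum_mul_right, Real.exp_eq_exp_ℝ, NormedSpace.exp_eq_tsum_div]
        simp_rw [he]
        have hc2 : 0 < c / 2 := by positivity
        refine ((integrable_schwartz_mul' (gaussMonomial hc2 0 0) ψ).norm.const_mul
          (Real.exp (κ ^ 2 / (2 * c)))).mono' ?_ (Filter.Eventually.of_forall fun z => ?_)
        · exact (by fun_prop : Continuous fun z : ℂ => Real.exp (κ * ‖z‖)).aestronglyMeasurable.mul
            (integrable_schwartz_mul' _ ψ).aestronglyMeasurable.norm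
        · rw [norm_mul, Real.norm_eq_abs, Real.abs_exp, norm_norm, norm_mul, norm_mul,
            norm_gaussian_apply, norm_gaussian_apply, ← mul_assoc, ← mul_assoc]
          exact mul_le_mul_of_nonneg_right (exp_linear_sub_le hc) (norm_nonneg _))
      (Filter.Eventually.of_forall fun z => by
        have h1 := (NormedSpace.expSeries_div_hasSum_exp (t z)).mul_right
          (gaussMonomial hc 0 0 z * ψ z)
        rw [← Complex.exp_eq_exp_ℂ] at h1
        have h2 : (fun k : ℕ => ((k.factorial : ℂ)⁻¹ • (T ^ k) (gaussMonomial hc 0 0)) z * ψ z)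
            = fun k => t z ^ k / k.factorial * (gaussMonomial hc 0 0 z * ψ z) := by
          funext k
          rw [smul_apply, (hTk k).2, smul_eq_mul]
          ring
        exact h2 ▸ h1)
    have h0 : ∀ k : ℕ, ∫ z, ((k.factorial : ℂ)⁻¹ • (T ^ k) (gaussMonomial hc 0 0)) z * ψ z = 0 :=
      fun k => hG0 _ (G.smul_mem _ (hTk k).1)
    simp only [h0] at hsum
    rw [Real.fourier_eq']
    exact hsum.unique hasSum_zero
  have hae := ae_eq_zero_of_fourier_eq_zero (integrable_schwartz_mul' _ ψ) hF
  rw [Lp.eq_zero_iff_ae_eq_zero]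
  filter_upwards [hae] with z hz
  exact (mul_eq_zero.1 hz).resolve_left (gaussian_ne_zero hc z)

/-! ### The Landau levels as Hilbert spaces -/

lemma inner_toLp_eq (η : 𝓢(ℂ, ℂ)) (ψ : Lp ℂ 2 (volume : Measure ℂ)) :
    inner ℂ (η.toLp 2) ψ = ∫ z, conj (η z) * ψ z := by
  rw [L2.inner_def]
  refine integral_congr_ae ?_
  filter_upwards [η.coeFn_toLp 2 (volume : Measure ℂ)] with z hz
  rw [hz, RCLike.inner_apply, mul_comm]

lemma inner_toLp_toLp (η θ : 𝓢(ℂ, ℂ)) :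
    inner ℂ (η.toLp 2 (volume : Measure ℂ)) (θ.toLp 2) = ∫ z, overlap η θ z := by
  rw [inner_toLp_eq]
  refine integral_congr_ae ?_
  filter_upwards [θ.coeFn_toLp 2 (volume : Measure ℂ)] with z hz
  rw [hz, overlap_apply]

lemma landauLevel_isClosed (B : ℝ) (n : ℕ) :
    IsClosed (landauLevel B n : Set (Lp ℂ 2 (volume : Measure ℂ))) := by
  have h : (landauLevel B n : Set (Lp ℂ 2 (volume : Measure ℂ))) =
      ⋂ η : 𝓢(ℂ, ℂ), {ψ | inner ℂ ((exists_schwartz_landauOp B η).choose.toLp 2) ψ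
        = ((2 * B * (n + 1 / 2) : ℝ) : ℂ) * inner ℂ (η.toLp 2) ψ} := by
    ext ψ
    simp only [Set.mem_iInter, Set.mem_ofPred_eq, inner_toLp_eq,
      (exists_schwartz_landauOp B _).choose_spec]
    rfl
  rw [h]
  exact isClosed_iInter fun η => isClosed_eq (by fun_prop) (by fun_prop)

instance (B : ℝ) (n : ℕ) : CompleteSpace (landauLevel B n) :=
  (landauLevel_isClosed B n).completeSpace_coe

lemma state_mem_landauLevel {B : ℝ} (hB : 0 < B) (n m : ℕ) :
    (state hB n m).toLp 2 volume ∈ landauLevel B n := by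
  intro η
  have hae := (state hB n m).coeFn_toLp 2 (volume : Measure ℂ)
  have h1 : ∀ θ : 𝓢(ℂ, ℂ), ∫ z, conj (θ z) * (state hB n m).toLp 2 volume z
      = ∫ z, overlap θ (state hB n m) z := by
    intro θ
    refine integral_congr_ae ?_
    filter_upwards [hae] with z hz
    rw [hz, overlap_apply]
  have hi : ∀ u v : 𝓢(ℂ, ℂ), Integrable (overlap u v) := fun u v => (overlap u v).integrable
  have h2 : ∫ z, overlap (create B (annihilate B η)) (state hB n m) z
      = n * ∫ z, overlap η (state hB n m) z := by
    rw [integral_overlap_create hB, integral_overlap_annihilate hB, create_annihilate_state,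
      overlap_smul_right, ← integral_const_mul]
    rfl
  rw [landauOp_eq hB, h1, h1]
  simp only [overlap_smul_left, overlap_add_left, smul_apply, add_apply, smul_eq_mul,
    Complex.conj_ofReal, Complex.conj_ofNat]
  rw [integral_const_mul, integral_add ((hi _ _).const_mul _) (hi _ _), integral_const_mul, h2]
  push_cast
  ring

/-- The Landau state `φ_{n,m}` as an element of the `n`-th Landau level. -/
def levelState {B : ℝ} (hB : 0 < B) (n m : ℕ) : landauLevel B n :=
  ⟨(state hB n m).toLp 2, state_mem_landauLevel hB n m⟩

lemma levelState_ae {B : ℝ} (hB : 0 < B) (n m : ℕ) :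
    (levelState hB n m : Lp ℂ 2 (volume : Measure ℂ)) =ᵐ[volume] landauState B n m := by
  rw [← coe_state hB]
  exact (state hB n m).coeFn_toLp 2 volume

lemma orthonormal_levelState {B : ℝ} (hB : 0 < B) (n : ℕ) :
    Orthonormal ℂ (levelState hB n) := by
  rw [orthonormal_iff_ite]
  intro m l
  rw [Submodule.coe_inner, levelState, levelState, inner_toLp_toLp, integral_overlap_state]
  simp

/-- The weak eigenvalue equation, tested against an eigenfunction with another eigenvalue. -/
lemma inner_state_eq_zero {B : ℝ} (hB : 0 < B) {n n' : ℕ} (hn : n' ≠ n) (m : ℕ)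
    (ψ : landauLevel B n) :
    inner ℂ ((state hB n' m).toLp 2) (ψ : Lp ℂ 2 (volume : Measure ℂ)) = 0 := by
  have h := ψ.2 (state hB n' m)
  rw [landauOp_state] at h
  simp only [smul_apply, smul_eq_mul, map_mul, Complex.conj_ofReal, mul_assoc] at h
  rw [integral_const_mul, ← sub_eq_zero, ← sub_mul, ← inner_toLp_eq] at h
  refine (mul_eq_zero.1 h).resolve_left ?_
  rw [← Complex.ofReal_sub]
  have : (n' : ℝ) - n ≠ 0 := by rw [sub_ne_zero]; exact_mod_cast hn
  have : 2 * (B * (n' + 1 / 2)) - 2 * (B * (n + 1 / 2)) = 2 * B * ((n' : ℝ) - n) := by ring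
  exact_mod_cast (by rw [this]; positivity :
    2 * (B * ((n' : ℝ) + 1 / 2)) - 2 * (B * (n + 1 / 2)) ≠ 0)

lemma eq_zero_of_inner_levelState {B : ℝ} (hB : 0 < B) (n : ℕ) (ψ : landauLevel B n)
    (h : ∀ m, inner ℂ (levelState hB n m) ψ = 0) : ψ = 0 := by
  have hst : ∀ p : ℕ × ℕ,
      ∫ z, conj (state hB p.1 p.2 z) * (ψ : Lp ℂ 2 (volume : Measure ℂ)) z = 0 := by
    rintro ⟨n', m⟩
    rw [← inner_toLp_eq]
    by_cases hn : n' = n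
    · subst hn; exact h m
    · exact inner_state_eq_zero hB hn m ψ
  have hall : ∀ η ∈ Submodule.span ℂ (Set.range fun p : ℕ × ℕ => state hB p.1 p.2),
      ∫ z, conj (η z) * (ψ : Lp ℂ 2 (volume : Measure ℂ)) z = 0 := by
    intro η hη
    induction hη using Submodule.span_induction with
    | mem _ h' => obtain ⟨p, rfl⟩ := h'; exact hst p
    | zero => simp
    | add x y _ _ hx hy =>
      simp only [add_apply, add_mul, map_add]
      rw [integral_add (integrable_schwartz_mul x ψ) (integrable_schwartz_mul y ψ), hx, hy,
        add_zero]
    | smul a x _ hx =>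
      simp only [smul_apply, smul_eq_mul, mul_assoc, map_mul]
      rw [integral_const_mul, hx, mul_zero]
  refine Subtype.ext (eq_zero_of_integral_gaussMonomial (show 0 < B / 4 by positivity) _
    fun a b => ?_)
  rw [← hall _ (gaussMonomial_mem_span_state hB b a)]
  congr 1
  funext z
  simp only [gaussMonomial_apply, map_mul, map_pow, Complex.conj_conj, Complex.conj_ofReal]
  ring

/-- The Hilbert basis `φ_{n,m}`, `m ≥ 0`, of the `n`-th Landau level. -/
def levelBasis {B : ℝ} (hB : 0 < B) (n : ℕ) : HilbertBasis ℕ ℂ (landauLevel B n) :=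
  HilbertBasis.mkOfOrthogonalEqBot (orthonormal_levelState hB n) <| by
    rw [Submodule.eq_bot_iff]
    intro ψ hψ
    refine eq_zero_of_inner_levelState hB n ψ fun m => ?_
    exact (Submodule.mem_orthogonal _ _).1 hψ _ (Submodule.subset_span ⟨m, rfl⟩)

lemma levelBasis_apply {B : ℝ} (hB : 0 < B) (n m : ℕ) :
    levelBasis hB n m = levelState hB n m := by
  rw [levelBasis, HilbertBasis.coe_mkOfOrthogonalEqBot]

/-- The unitary from the `n`-th level to the lowest one with `φ_{n,m} ↦ φ_{0,m}`. -/
def levelUnitary {B : ℝ} (hB : 0 < B) (n : ℕ) : landauLevel B n ≃ₗᵢ[ℂ] landauLevel B 0 :=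
  (levelBasis hB n).repr.trans (levelBasis hB 0).repr.symm

lemma levelUnitary_levelState {B : ℝ} (hB : 0 < B) (n m : ℕ) :
    levelUnitary hB n (levelState hB n m) = levelState hB 0 m := by
  classical
  rw [← levelBasis_apply, ← levelBasis_apply, levelUnitary, LinearIsometryEquiv.trans_apply,
    HilbertBasis.repr_self, HilbertBasis.repr_symm_single]

lemma span_levelState_dense {B : ℝ} (hB : 0 < B) (n : ℕ) :
    (Submodule.span ℂ (Set.range (levelState hB n))).topologicalClosure = ⊤ := by
  rw [← (levelBasis hB n).dense_span]
  congr 3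
  funext m
  rw [levelBasis_apply]

/-! ### Tensor products and Slater determinants in `L²` -/

/-- `L²(ℝ²)`. -/
abbrev L2one := Lp ℂ 2 (volume : Measure ℂ)

/-- The product function `∏ᵢ ψᵢ(rᵢ)`. -/
def tensorFun {N : ℕ} (ψ : Fin N → ℂ → ℂ) (X : Fin N → ℂ) : ℂ := ∏ i, ψ i (X i)

lemma slater_eq_sum {N : ℕ} (ψ : Fin N → ℂ → ℂ) :
    slater ψ = ∑ σ : Equiv.Perm (Fin N),
      ((Equiv.Perm.sign σ : ℤ) : ℂ) • tensorFun fun j => ψ (σ j) := by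
  funext X
  rw [slater, ← Matrix.det_transpose, Matrix.det_apply, Finset.sum_apply]
  refine Finset.sum_congr rfl fun σ _ => ?_
  rw [Pi.smul_apply, tensorFun, Units.smul_def, ← Int.cast_smul_eq_zsmul ℂ]
  rfl

lemma aestronglyMeasurable_tensorFun {N : ℕ} {ψ : Fin N → ℂ → ℂ}
    (h : ∀ i, AEStronglyMeasurable (ψ i) volume) :
    AEStronglyMeasurable (tensorFun ψ) (volume : Measure (Fin N → ℂ)) := by
  have : tensorFun ψ = fun X => ∏ i, (fun X : Fin N → ℂ => ψ i (X i)) X := rfl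
  rw [this]
  exact Finset.aestronglyMeasurable_fun_prod _ fun i _ =>
    (h i).comp_quasiMeasurePreserving
      (Measure.quasiMeasurePreserving_eval (μ := fun _ : Fin N => (volume : Measure ℂ)) i)

lemma ae_eval {N : ℕ} (i : Fin N) {p : ℂ → Prop} (h : ∀ᵐ z, p z) :
    ∀ᵐ X : Fin N → ℂ, p (X i) :=
  (Measure.quasiMeasurePreserving_eval (μ := fun _ : Fin N => (volume : Measure ℂ)) i).ae h

lemma memLp_tensorFun {N : ℕ} {ψ : Fin N → ℂ → ℂ} (h : ∀ i, MemLp (ψ i) 2 volume) :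
    MemLp (tensorFun ψ) 2 (volume : Measure (Fin N → ℂ)) := by
  rw [memLp_two_iff_integrable_sq_norm (aestronglyMeasurable_tensorFun fun i => (h i).1)]
  simp only [tensorFun, norm_prod, ← Finset.prod_pow]
  exact Integrable.fintype_prod (f := fun i z => ‖ψ i z‖ ^ 2) fun i =>
    (memLp_two_iff_integrable_sq_norm (h i).1).1 (h i)

lemma tensorFun_update {N : ℕ} (ψ : Fin N → L2one) (i : Fin N) (χ : L2one) (X : Fin N → ℂ) :
    tensorFun (fun j => (Function.update ψ i χ j : ℂ → ℂ)) X
      = χ (X i) * ∏ j ∈ Finset.univ \ {i}, ψ j (X j) := by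
  rw [tensorFun, ← Finset.prod_update_of_mem (Finset.mem_univ i)]
  refine Finset.prod_congr rfl fun j _ => ?_
  by_cases h : j = i
  · subst h; simp
  · simp [h]

/-- The tensor product `ψ ↦ ∏ᵢ ψᵢ(rᵢ)` as a multilinear map. -/
def tensorMultilinear (N : ℕ) : MultilinearMap ℂ (fun _ : Fin N => L2one) (L2N N) where
  toFun ψ := (memLp_tensorFun fun i => Lp.memLp (ψ i)).toLp _
  map_update_add' {inst} ψ i x y := by
    obtain rfl : inst = instDecidableEqFin N := Subsingleton.elim _ _
    refine Lp.ext ?_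
    filter_upwards [MemLp.coeFn_toLp (memLp_tensorFun fun j =>
        Lp.memLp (Function.update ψ i (x + y) j)),
      MemLp.coeFn_toLp (memLp_tensorFun fun j => Lp.memLp (Function.update ψ i x j)),
      MemLp.coeFn_toLp (memLp_tensorFun fun j => Lp.memLp (Function.update ψ i y j)),
      Lp.coeFn_add ((memLp_tensorFun fun j => Lp.memLp (Function.update ψ i x j)).toLp _)
        ((memLp_tensorFun fun j => Lp.memLp (Function.update ψ i y j)).toLp _),
      ae_eval i (Lp.coeFn_add x y)] with X h1 h2 h3 h4 h5
    rw [h1, h4, Pi.add_apply, h2, h3, tensorFun_update, tensorFun_update, tensorFun_update, h5,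
      Pi.add_apply, add_mul]
  map_update_smul' {inst} ψ i c x := by
    obtain rfl : inst = instDecidableEqFin N := Subsingleton.elim _ _
    refine Lp.ext ?_
    filter_upwards [MemLp.coeFn_toLp (memLp_tensorFun fun j =>
        Lp.memLp (Function.update ψ i (c • x) j)),
      MemLp.coeFn_toLp (memLp_tensorFun fun j => Lp.memLp (Function.update ψ i x j)),
      Lp.coeFn_smul c ((memLp_tensorFun fun j => Lp.memLp (Function.update ψ i x j)).toLp _),
      ae_eval i (Lp.coeFn_smul c x)] with X h1 h2 h4 h5
    rw [h1, h4, Pi.smul_apply, h2, tensorFun_update, tensorFun_update, h5, Pi.smul_apply,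
      smul_eq_mul, smul_eq_mul, mul_assoc]

lemma tensorMultilinear_ae {N : ℕ} (ψ : Fin N → L2one) :
    (tensorMultilinear N ψ : (Fin N → ℂ) → ℂ) =ᵐ[volume] tensorFun fun i => ψ i :=
  MemLp.coeFn_toLp (memLp_tensorFun fun i => Lp.memLp (ψ i))

lemma inner_tensorMultilinear {N : ℕ} (ψ φ : Fin N → L2one) :
    inner ℂ (tensorMultilinear N ψ) (tensorMultilinear N φ) = ∏ i, inner ℂ (ψ i) (φ i) := by
  simp only [L2.inner_def]
  rw [← integral_fintype_prod_volume_eq_prod (fun i z => inner ℂ (ψ i z) (φ i z))]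
  refine integral_congr_ae ?_
  filter_upwards [tensorMultilinear_ae ψ, tensorMultilinear_ae φ] with X h1 h2
  rw [h1, h2]
  simp [tensorFun, RCLike.inner_apply, Finset.prod_mul_distrib]

lemma norm_tensorMultilinear {N : ℕ} (ψ : Fin N → L2one) :
    ‖tensorMultilinear N ψ‖ = ∏ i, ‖ψ i‖ := by
  have h := inner_tensorMultilinear ψ ψ
  simp only [inner_self_eq_norm_sq_to_K, Finset.prod_pow] at h
  have h2 : ‖tensorMultilinear N ψ‖ ^ 2 = (∏ i, ‖ψ i‖) ^ 2 := by exact_mod_cast h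
  exact (pow_left_inj₀ (norm_nonneg _) (Finset.prod_nonneg fun i _ => norm_nonneg _)
    two_ne_zero).1 h2

/-- The antisymmetrized product of one-particle states as a continuous multilinear map. -/
def slaterMultilinear (N : ℕ) : ContinuousMultilinearMap ℂ (fun _ : Fin N => L2one) (L2N N) :=
  ∑ σ : Equiv.Perm (Fin N), ((Equiv.Perm.sign σ : ℤ) : ℂ) •
    ((tensorMultilinear N).mkContinuous 1 fun ψ => by
      rw [norm_tensorMultilinear, one_mul]).domDomCongr σ

lemma slaterMultilinear_apply {N : ℕ} (ψ : Fin N → L2one) :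
    slaterMultilinear N ψ = ∑ σ : Equiv.Perm (Fin N), ((Equiv.Perm.sign σ : ℤ) : ℂ) •
      tensorMultilinear N fun j => ψ (σ j) := by
  simp [slaterMultilinear]

lemma ae_finset_sum {α ι : Type*} [MeasurableSpace α] {μ : Measure α} (s : Finset ι)
    {f : ι → Lp ℂ 2 μ} {g : ι → α → ℂ} (h : ∀ i ∈ s, f i =ᵐ[μ] g i) :
    ((∑ i ∈ s, f i : Lp ℂ 2 μ) : α → ℂ) =ᵐ[μ] ∑ i ∈ s, g i := by
  classical
  induction s using Finset.induction_on with
  | empty => simpa using Lp.coeFn_zero ℂ 2 μ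
  | insert i s hi ih =>
    rw [Finset.sum_insert hi, Finset.sum_insert hi]
    exact (Lp.coeFn_add _ _).trans ((h i (by simp)).add (ih fun j hj => h j (by simp [hj])))

lemma slaterMultilinear_ae {N : ℕ} (ψ : Fin N → L2one) :
    (slaterMultilinear N ψ : (Fin N → ℂ) → ℂ) =ᵐ[volume] slater fun i => ψ i := by
  rw [slaterMultilinear_apply, slater_eq_sum]
  exact ae_finset_sum _ fun σ _ =>
    (Lp.coeFn_smul _ _).trans ((tensorMultilinear_ae _).const_smul _)

/-- Inner products of antisymmetrized products depend only on the one-particle Gram matrix. -/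
lemma inner_slaterMultilinear_congr {N : ℕ} {ψ φ ψ' φ' : Fin N → L2one}
    (h : ∀ i j, inner ℂ (ψ i) (φ j) = inner ℂ (ψ' i) (φ' j)) :
    inner ℂ (slaterMultilinear N ψ) (slaterMultilinear N φ)
      = inner ℂ (slaterMultilinear N ψ') (slaterMultilinear N φ') := by
  simp only [slaterMultilinear_apply, sum_inner, inner_sum, inner_smul_left, inner_smul_right,
    inner_tensorMultilinear, h]

lemma slater_congr_ae {N : ℕ} {f g : Fin N → ℂ → ℂ} (h : ∀ i, f i =ᵐ[volume] g i) :
    slater f =ᵐ[volume] slater g := by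
  have h' : ∀ᵐ X : Fin N → ℂ, ∀ i j, f j (X i) = g j (X i) :=
    ae_all_iff.2 fun i => ae_all_iff.2 fun j => ae_eval i (h j)
  filter_upwards [h'] with X hX
  simp only [slater, hX]

/-! ### Unitaries from Gram matrices, and density of products -/

lemma denseRange_linearCombination {ι E : Type*} [NormedAddCommGroup E] [InnerProductSpace ℂ E]
    (v : ι → E) (hv : ∀ x : ι →₀ ℂ, Finsupp.linearCombination ℂ v x
      ∈ (Submodule.span ℂ (Set.range v)).topologicalClosure) :
    DenseRange ((Finsupp.linearCombination ℂ v).codRestrict _ hv) := by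
  rw [DenseRange, Subtype.dense_iff]
  refine fun x hx => closure_mono ?_ hx
  rintro y hy
  obtain ⟨a, rfl⟩ := (Finsupp.range_linearCombination (R := ℂ) (v := v)).ge hy
  exact ⟨_, ⟨a, rfl⟩, rfl⟩

/-- Two families with the same Gram matrix have unitarily equivalent closed spans. -/
lemma exists_isometryEquiv_of_inner_eq {ι E F : Type*} [NormedAddCommGroup E]
    [InnerProductSpace ℂ E] [CompleteSpace E] [NormedAddCommGroup F] [InnerProductSpace ℂ F]
    [CompleteSpace F] (v : ι → E) (w : ι → F) (K : Submodule ℂ E) (L : Submodule ℂ F)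
    (hK : K = (Submodule.span ℂ (Set.range v)).topologicalClosure)
    (hL : L = (Submodule.span ℂ (Set.range w)).topologicalClosure)
    (h : ∀ i j, inner ℂ (v i) (v j) = inner ℂ (w i) (w j)) :
    ∃ U : K ≃ₗᵢ[ℂ] L, ∀ (i : ι) (x : K), (x : E) = v i → (U x : F) = w i := by
  subst hK hL
  have hv : ∀ x : ι →₀ ℂ, Finsupp.linearCombination ℂ v x
      ∈ (Submodule.span ℂ (Set.range v)).topologicalClosure := fun x =>
    Submodule.le_topologicalClosure _
      ((Finsupp.range_linearCombination (R := ℂ) (v := v)).le ⟨x, rfl⟩)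
  have hw : ∀ x : ι →₀ ℂ, Finsupp.linearCombination ℂ w x
      ∈ (Submodule.span ℂ (Set.range w)).topologicalClosure := fun x =>
    Submodule.le_topologicalClosure _
      ((Finsupp.range_linearCombination (R := ℂ) (v := w)).le ⟨x, rfl⟩)
  have : CompleteSpace (Submodule.span ℂ (Set.range v)).topologicalClosure :=
    Submodule.topologicalClosure.completeSpace _
  have : CompleteSpace (Submodule.span ℂ (Set.range w)).topologicalClosure :=
    Submodule.topologicalClosure.completeSpace _
  have hnorm : ∀ x : ι →₀ ℂ,
      ‖(Finsupp.linearCombination ℂ w).codRestrict _ hw (LinearEquiv.refl ℂ _ x)‖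
        = ‖(Finsupp.linearCombination ℂ v).codRestrict _ hv x‖ := by
    intro x
    have h1 : inner ℂ (Finsupp.linearCombination ℂ v x) (Finsupp.linearCombination ℂ v x)
        = inner ℂ (Finsupp.linearCombination ℂ w x) (Finsupp.linearCombination ℂ w x) := by
      simp only [Finsupp.linearCombination_apply, Finsupp.sum, sum_inner, inner_sum,
        inner_smul_left, inner_smul_right, h]
    rw [inner_self_eq_norm_sq_to_K, inner_self_eq_norm_sq_to_K] at h1
    have h2 : ‖Finsupp.linearCombination ℂ v x‖ ^ 2 = ‖Finsupp.linearCombination ℂ w x‖ ^ 2 := by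
      exact_mod_cast h1
    exact ((pow_left_inj₀ (norm_nonneg _) (norm_nonneg _) two_ne_zero).1 h2).symm
  refine ⟨(LinearEquiv.refl ℂ (ι →₀ ℂ)).extendOfIsometry _ _ (denseRange_linearCombination v hv)
    (denseRange_linearCombination w hw) hnorm,
    fun i x hx => ?_⟩
  have hx' : x = (Finsupp.linearCombination ℂ v).codRestrict _ hv (Finsupp.single i 1) :=
    Subtype.ext (by simp [hx])
  rw [hx', LinearEquiv.extendOfIsometry_eq]
  simp

/-- A closed subspace that contains the values of a continuous multilinear map on a total family
contains all its values. -/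
lemma multilinear_mem_of_total {N : ℕ} {ι E F : Type*} [NormedAddCommGroup E] [NormedSpace ℂ E]
    [NormedAddCommGroup F] [NormedSpace ℂ F]
    (T : ContinuousMultilinearMap ℂ (fun _ : Fin N => E) F) (K : Submodule ℂ F)
    (hK : IsClosed (K : Set F)) (e : ι → E)
    (he : (Submodule.span ℂ (Set.range e)).topologicalClosure = ⊤)
    (h : ∀ m : Fin N → ι, T (fun i => e (m i)) ∈ K) (ψ : Fin N → E) : T ψ ∈ K := by
  classical
  have key : ∀ (s : Finset (Fin N)) (ψ : Fin N → E), (∀ i ∉ s, ψ i ∈ Set.range e) → T ψ ∈ K := by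
    intro s
    induction s using Finset.induction_on with
    | empty =>
      intro ψ hψ
      choose m hm using fun i => hψ i (Finset.notMem_empty i)
      have : ψ = fun i => e (m i) := funext fun i => (hm i).symm
      rw [this]; exact h m
    | insert i s hi ih =>
      intro ψ hψ
      have hle : (Submodule.span ℂ (Set.range e)).topologicalClosure
          ≤ K.comap (T.toContinuousLinearMap ψ i).toLinearMap := by
        refine Submodule.topologicalClosure_minimal _ ?_
          (hK.preimage (T.toContinuousLinearMap ψ i).continuous)
        rw [Submodule.span_le]
        rintro _ ⟨m, rfl⟩
        change T (Function.update ψ i (e m)) ∈ K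
        refine ih _ fun j hj => ?_
        by_cases hji : j = i
        · subst hji; simp
        · rw [Function.update_of_ne hji]
          exact hψ j (by simp [hji, hj])
      have h1 : ψ i ∈ K.comap (T.toContinuousLinearMap ψ i).toLinearMap := hle (by rw [he]; trivial)
      have h2 : T (Function.update ψ i (ψ i)) ∈ K := h1
      rwa [Function.update_eq_self] at h2
  exact key Finset.univ ψ fun i hi => absurd (Finset.mem_univ i) hi

/-! ### The `N`-particle spaces and the tensor power of the unitary -/

/-- Antisymmetrized products of states of the `n`-th level. -/
def levelSlater (B : ℝ) (n N : ℕ) :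
    ContinuousMultilinearMap ℂ (fun _ : Fin N => landauLevel B n) (L2N N) :=
  (slaterMultilinear N).compContinuousLinearMap fun _ => (landauLevel B n).subtypeL

lemma levelSlater_ae {B : ℝ} {n N : ℕ} (ψ : Fin N → landauLevel B n) :
    (levelSlater B n N ψ : (Fin N → ℂ) → ℂ) =ᵐ[volume] slater fun i => (ψ i : ℂ → ℂ) :=
  slaterMultilinear_ae fun i => (ψ i : L2one)

lemma landauLevelN_eq (B : ℝ) (n N : ℕ) :
    landauLevelN B n N
      = (Submodule.span ℂ (Set.range (levelSlater B n N))).topologicalClosure := by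
  rw [landauLevelN]
  congr 2
  ext Ψ
  constructor
  · rintro ⟨ψ, hψ⟩
    exact ⟨ψ, Lp.ext ((levelSlater_ae ψ).trans hψ.symm)⟩
  · rintro ⟨ψ, rfl⟩
    exact ⟨ψ, levelSlater_ae ψ⟩

lemma levelSlater_mem {B : ℝ} {n N : ℕ} (ψ : Fin N → landauLevel B n) :
    levelSlater B n N ψ ∈ landauLevelN B n N := by
  rw [landauLevelN_eq]
  exact Submodule.le_topologicalClosure _ (Submodule.subset_span ⟨ψ, rfl⟩)

/-- The `N`-fold antisymmetric tensor power of a unitary between the levels. -/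
lemma exists_tensor_power {B : ℝ} {n : ℕ} (U : landauLevel B n ≃ₗᵢ[ℂ] landauLevel B 0) (N : ℕ) :
    ∃ UN : landauLevelN B n N ≃ₗᵢ[ℂ] landauLevelN B 0 N,
      ∀ (ψ : Fin N → landauLevel B n) (Ψ : landauLevelN B n N),
        (Ψ : L2N N) = levelSlater B n N ψ →
          (UN Ψ : L2N N) = levelSlater B 0 N fun i => U (ψ i) := by
  refine exists_isometryEquiv_of_inner_eq (levelSlater B n N)
    (fun ψ => levelSlater B 0 N fun i => U (ψ i)) _ _ (landauLevelN_eq B n N) ?_ fun ψ φ => ?_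
  · rw [landauLevelN_eq]
    congr 2
    have : Function.Surjective fun (ψ : Fin N → landauLevel B n) i => U (ψ i) := fun φ =>
      ⟨fun i => U.symm (φ i), by simp⟩
    exact (this.range_comp (levelSlater B 0 N)).symm
  · refine inner_slaterMultilinear_congr fun i j => ?_
    change inner ℂ (ψ i) (φ j) = inner ℂ (U (ψ i)) (U (φ j))
    rw [U.inner_map_map]

lemma levelSlater_levelState_ae {B : ℝ} (hB : 0 < B) (n : ℕ) {N : ℕ} (m : Fin N → ℕ) :
    (levelSlater B n N (fun i => levelState hB n (m i)) : (Fin N → ℂ) → ℂ)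
      =ᵐ[volume] slater fun i => landauState B n (m i) :=
  (levelSlater_ae _).trans (slater_congr_ae fun i => levelState_ae hB n (m i))

lemma formDomain_dense {B : ℝ} (hB : 0 < B) (n N : ℕ) : Dense (formDomain B n N) := by
  rw [Subtype.dense_iff]
  set K := Submodule.span ℂ (Set.range fun m : Fin N → ℕ =>
    levelSlater B n N fun i => levelState hB n (m i)) with hK
  have hKl : K ≤ landauLevelN B n N := by
    rw [hK, Submodule.span_le]
    rintro _ ⟨m, rfl⟩
    exact levelSlater_mem _
  have hsub : (K : Set (L2N N)) ⊆ (↑) '' formDomain B n N := by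
    intro Ψ hΨ
    refine ⟨⟨Ψ, hKl hΨ⟩, ?_, rfl⟩
    change ∃ F ∈ formCore B n N, Ψ =ᵐ[volume] F
    rw [SetLike.mem_coe, hK] at hΨ
    induction hΨ using Submodule.span_induction with
    | mem _ h =>
      obtain ⟨m, rfl⟩ := h
      exact ⟨_, Submodule.subset_span ⟨m, rfl⟩, levelSlater_levelState_ae hB n m⟩
    | zero => exact ⟨0, Submodule.zero_mem _, Lp.coeFn_zero _ _ _⟩
    | add x y _ _ hx hy =>
      obtain ⟨F, hF, hxF⟩ := hx
      obtain ⟨G, hG, hyG⟩ := hy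
      exact ⟨F + G, Submodule.add_mem _ hF hG, (Lp.coeFn_add _ _).trans (hxF.add hyG)⟩
    | smul c x _ hx =>
      obtain ⟨F, hF, hxF⟩ := hx
      exact ⟨c • F, Submodule.smul_mem _ _ hF, (Lp.coeFn_smul _ _).trans (hxF.const_smul c)⟩
  have hcl : landauLevelN B n N ≤ K.topologicalClosure := by
    rw [landauLevelN_eq]
    refine Submodule.topologicalClosure_minimal _ ?_ K.isClosed_topologicalClosure
    rw [Submodule.span_le]
    rintro _ ⟨ψ, rfl⟩
    exact multilinear_mem_of_total (levelSlater B n N) _ K.isClosed_topologicalClosure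
      (levelState hB n) (span_levelState_dense hB n)
      (fun m => Submodule.le_topologicalClosure _ (Submodule.subset_span ⟨m, rfl⟩)) ψ
  exact fun Ψ hΨ => closure_mono hsub (hcl hΨ)

/-- The pairs `(F, F₀)` of wave functions in the `n`-th and in the lowest level that correspond
to each other under the tensor power of the level unitary. -/
def corePairs (B : ℝ) (n N : ℕ) : Submodule ℂ (((Fin N → ℂ) → ℂ) × ((Fin N → ℂ) → ℂ)) :=
  Submodule.span ℂ (Set.range fun m : Fin N → ℕ =>
    (slater fun i => landauState B n (m i), slater fun i => landauState B 0 (m i)))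

lemma exists_corePairs_of_mem_formCore {B : ℝ} {n N : ℕ} {F : (Fin N → ℂ) → ℂ}
    (hF : F ∈ formCore B n N) : ∃ F₀, (F, F₀) ∈ corePairs B n N := by
  have h : formCore B n N = (corePairs B n N).map (LinearMap.fst ℂ _ _) := by
    rw [formCore, corePairs, Submodule.map_span, ← Set.range_comp]
    rfl
  rw [h] at hF
  obtain ⟨⟨F', F₀⟩, hp, rfl⟩ := hF
  exact ⟨F₀, hp⟩

lemma exists_corePairs_of_mem_formCore_zero {B : ℝ} {n N : ℕ} {F₀ : (Fin N → ℂ) → ℂ}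
    (hF : F₀ ∈ formCore B 0 N) : ∃ F, (F, F₀) ∈ corePairs B n N := by
  have h : formCore B 0 N = (corePairs B n N).map (LinearMap.snd ℂ _ _) := by
    rw [formCore, corePairs, Submodule.map_span, ← Set.range_comp]
    rfl
  rw [h] at hF
  obtain ⟨⟨F, F₀'⟩, hp, rfl⟩ := hF
  exact ⟨F, hp⟩

lemma mem_formCore_of_corePairs {B : ℝ} {n N : ℕ} {p : ((Fin N → ℂ) → ℂ) × ((Fin N → ℂ) → ℂ)}
    (hp : p ∈ corePairs B n N) : p.1 ∈ formCore B n N ∧ p.2 ∈ formCore B 0 N := by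
  induction hp using Submodule.span_induction with
  | mem _ h =>
    obtain ⟨m, rfl⟩ := h
    exact ⟨Submodule.subset_span ⟨m, rfl⟩, Submodule.subset_span ⟨m, rfl⟩⟩
  | zero => exact ⟨Submodule.zero_mem _, Submodule.zero_mem _⟩
  | add x y _ _ hx hy => exact ⟨Submodule.add_mem _ hx.1 hy.1, Submodule.add_mem _ hx.2 hy.2⟩
  | smul c x _ hx => exact ⟨Submodule.smul_mem _ _ hx.1, Submodule.smul_mem _ _ hx.2⟩

lemma continuous_slater_landauState {B : ℝ} (hB : 0 < B) (n : ℕ) {N : ℕ} (m : Fin N → ℕ) :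
    Continuous (slater fun i => landauState B n (m i)) := by
  unfold slater
  refine Continuous.matrix_det ?_
  refine continuous_matrix fun i j => ?_
  simp only [Matrix.of_apply, ← coe_state hB]
  exact (state hB n (m j)).continuous.comp (continuous_apply i)

lemma continuous_of_mem_formCore {B : ℝ} (hB : 0 < B) {n N : ℕ} {F : (Fin N → ℂ) → ℂ}
    (hF : F ∈ formCore B n N) : Continuous F := by
  induction hF using Submodule.span_induction with
  | mem _ h =>
    obtain ⟨m, rfl⟩ := h
    exact continuous_slater_landauState hB n m
  | zero => exact continuous_const
  | add x y _ _ hx hy => exact hx.add hy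
  | smul c x _ hx => exact hx.const_smul c

lemma eq_of_ae_eq_of_mem_formCore {B : ℝ} (hB : 0 < B) {n N : ℕ} {F G : (Fin N → ℂ) → ℂ}
    (hF : F ∈ formCore B n N) (hG : G ∈ formCore B n N) (h : F =ᵐ[volume] G) : F = G :=
  (Continuous.ae_eq_iff_eq volume (continuous_of_mem_formCore hB hF)
    (continuous_of_mem_formCore hB hG)).1 h

lemma exists_image_of_corePairs {B : ℝ} (hB : 0 < B) {n N : ℕ}
    {UN : landauLevelN B n N ≃ₗᵢ[ℂ] landauLevelN B 0 N}
    (hUN : ∀ (ψ : Fin N → landauLevel B n) (Ψ : landauLevelN B n N),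
        (Ψ : L2N N) = levelSlater B n N ψ →
          (UN Ψ : L2N N) = levelSlater B 0 N fun i => levelUnitary hB n (ψ i))
    {p : ((Fin N → ℂ) → ℂ) × ((Fin N → ℂ) → ℂ)} (hp : p ∈ corePairs B n N) :
    ∃ Ψ : landauLevelN B n N, (Ψ : L2N N) =ᵐ[volume] p.1 ∧ (UN Ψ : L2N N) =ᵐ[volume] p.2 := by
  induction hp using Submodule.span_induction with
  | mem _ h =>
    obtain ⟨m, rfl⟩ := h
    refine ⟨⟨_, levelSlater_mem fun i => levelState hB n (m i)⟩,
      levelSlater_levelState_ae hB n m, ?_⟩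
    rw [hUN _ _ rfl]
    simp only [levelUnitary_levelState]
    exact levelSlater_levelState_ae hB 0 m
  | zero =>
    refine ⟨0, Lp.coeFn_zero _ _ _, ?_⟩
    rw [map_zero]
    exact Lp.coeFn_zero _ _ _
  | add x y _ _ hx hy =>
    obtain ⟨Ψ, h1, h2⟩ := hx
    obtain ⟨Φ, h3, h4⟩ := hy
    refine ⟨Ψ + Φ, (Lp.coeFn_add _ _).trans (h1.add h3), ?_⟩
    rw [map_add]
    exact (Lp.coeFn_add _ _).trans (h2.add h4)
  | smul c x _ hx =>
    obtain ⟨Ψ, h1, h2⟩ := hx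
    refine ⟨c • Ψ, (Lp.coeFn_smul _ _).trans (h1.const_smul c), ?_⟩
    rw [map_smul]
    exact (Lp.coeFn_smul _ _).trans (h2.const_smul c)

lemma mem_corePairs_of_ae {B : ℝ} (hB : 0 < B) {n N : ℕ}
    {UN : landauLevelN B n N ≃ₗᵢ[ℂ] landauLevelN B 0 N}
    (hUN : ∀ (ψ : Fin N → landauLevel B n) (Ψ : landauLevelN B n N),
        (Ψ : L2N N) = levelSlater B n N ψ →
          (UN Ψ : L2N N) = levelSlater B 0 N fun i => levelUnitary hB n (ψ i))
    {F F₀ : (Fin N → ℂ) → ℂ} (hF : F ∈ formCore B n N) (hF₀ : F₀ ∈ formCore B 0 N)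
    {Ψ : landauLevelN B n N} (h : (Ψ : L2N N) =ᵐ[volume] F) (h₀ : (UN Ψ : L2N N) =ᵐ[volume] F₀) :
    (F, F₀) ∈ corePairs B n N := by
  obtain ⟨G₀, hG⟩ := exists_corePairs_of_mem_formCore hF
  obtain ⟨Φ, h1, h2⟩ := exists_image_of_corePairs hB hUN hG
  have hΦ : Φ = Ψ := Subtype.ext (Lp.ext (h1.trans h.symm))
  subst hΦ
  rw [eq_of_ae_eq_of_mem_formCore hB hF₀ (mem_formCore_of_corePairs hG).2 (h₀.symm.trans h2)]
  exact hG

lemma image_formDomain {B : ℝ} (hB : 0 < B) {n N : ℕ}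
    {UN : landauLevelN B n N ≃ₗᵢ[ℂ] landauLevelN B 0 N}
    (hUN : ∀ (ψ : Fin N → landauLevel B n) (Ψ : landauLevelN B n N),
        (Ψ : L2N N) = levelSlater B n N ψ →
          (UN Ψ : L2N N) = levelSlater B 0 N fun i => levelUnitary hB n (ψ i)) :
    UN '' formDomain B n N = formDomain B 0 N := by
  ext Φ
  constructor
  · rintro ⟨Ψ, ⟨F, hF, hΨ⟩, rfl⟩
    obtain ⟨F₀, hp⟩ := exists_corePairs_of_mem_formCore hF
    obtain ⟨Ψ', h1, h2⟩ := exists_image_of_corePairs hB hUN hp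
    have : Ψ' = Ψ := Subtype.ext (Lp.ext (h1.trans hΨ.symm))
    subst this
    exact ⟨F₀, (mem_formCore_of_corePairs hp).2, h2⟩
  · rintro ⟨F₀, hF₀, hΦ⟩
    obtain ⟨F, hp⟩ := exists_corePairs_of_mem_formCore_zero (n := n) hF₀
    obtain ⟨Ψ, h1, h2⟩ := exists_image_of_corePairs hB hUN hp
    exact ⟨Ψ, ⟨F, (mem_formCore_of_corePairs hp).1, h1⟩, Subtype.ext (Lp.ext (h2.trans hΦ.symm))⟩

/-! ### Laguerre polynomials of the Laplacian -/

lemma coeff_laguerre (n l : ℕ) :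
    (laguerre n).coeff l = (-1) ^ l * ((n.choose l : ℝ) / l.factorial) := by
  have h : ∀ k : ℕ, Polynomial.C ((n.choose k : ℝ) / (k.factorial : ℝ)) * (-Polynomial.X) ^ k
      = Polynomial.C ((-1) ^ k * ((n.choose k : ℝ) / (k.factorial : ℝ))) * Polynomial.X ^ k := by
    intro k
    rw [neg_pow, Polynomial.C_mul, Polynomial.C_pow, Polynomial.C_neg, Polynomial.C_1]
    ring
  simp only [laguerre, h, Polynomial.finsetSum_coeff, Polynomial.coeff_C_mul_X_pow]
  rw [Finset.sum_ite_eq]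
  split_ifs with hl
  · rfl
  · rw [Nat.choose_eq_zero_of_lt (by simpa using hl)]
    simp

lemma laguerre_zero : laguerre 0 = 1 := by simp [laguerre]

lemma laguerre_one : laguerre 1 = 1 - Polynomial.X := by
  simp [laguerre, Finset.sum_range_succ, sub_eq_add_neg]

/-- The three-term recurrence of the Laguerre polynomials. -/
lemma laguerre_recurrence (n : ℕ) :
    ((n : ℝ) + 2) • laguerre (n + 2)
      = (2 * (n : ℝ) + 3) • laguerre (n + 1) - Polynomial.X * laguerre (n + 1)
        - ((n : ℝ) + 1) • laguerre n := by
  ext l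
  simp only [Polynomial.coeff_sub, Polynomial.coeff_smul, smul_eq_mul]
  rcases l with _ | l
  · simp [coeff_laguerre]; ring
  · rw [Polynomial.coeff_X_mul]
    simp only [coeff_laguerre]
    have h1 : ((n + 2).choose (l + 1) : ℝ) = (n + 1).choose l + (n + 1).choose (l + 1) := by
      exact_mod_cast Nat.choose_succ_succ (n + 1) l
    have h2 : ((n + 1).choose (l + 1) : ℝ) = n.choose l + n.choose (l + 1) := by
      exact_mod_cast Nat.choose_succ_succ n l
    have h3 : (n.choose l : ℝ) * (n + 1) = (n + 1).choose l * (n + 1 - l) := by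
      rcases le_or_gt l (n + 1) with hl | hl
      · have := Nat.choose_mul_succ_eq n l
        have h4 : ((n.choose l * (n + 1) : ℕ) : ℝ) = (((n + 1).choose l * (n + 1 - l) : ℕ) : ℝ) := by
          rw [this]
        rw [Nat.cast_mul, Nat.cast_mul, Nat.cast_sub hl] at h4
        exact_mod_cast h4
      · rw [Nat.choose_eq_zero_of_lt hl, Nat.choose_eq_zero_of_lt (by omega)]
        simp
    rw [h1, h2, Nat.factorial_succ, pow_succ]
    push_cast
    have hf : (l.factorial : ℝ) ≠ 0 := by positivity
    have hl : (l : ℝ) + 1 ≠ 0 := by positivity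
    field_simp
    linear_combination h3

/-- The Laplacian as an endomorphism of Schwartz space. -/
def schwartzLaplacian : Module.End ℂ 𝓢(ℂ, ℂ) :=
  (LineDeriv.laplacianCLM ℂ ℂ 𝓢(ℂ, ℂ)).toLinearMap

lemma schwartzLaplacian_apply (η : 𝓢(ℂ, ℂ)) : schwartzLaplacian η = Laplacian.laplacian η :=
  SchwartzMap.laplacianCLM_eq ℂ η

lemma coe_schwartzLaplacian (η : 𝓢(ℂ, ℂ)) :
    ⇑(schwartzLaplacian η) = Laplacian.laplacian (⇑η) := by
  rw [schwartzLaplacian_apply]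
  exact funext fun z => SchwartzMap.laplacian_apply η z

lemma coe_schwartzLaplacian_pow (k : ℕ) (η : 𝓢(ℂ, ℂ)) :
    ⇑((schwartzLaplacian ^ k) η) = Laplacian.laplacian^[k] ⇑η := by
  induction k with
  | zero => rfl
  | succ k ih =>
    rw [pow_succ', Module.End.mul_apply, coe_schwartzLaplacian, ih, Function.iterate_succ_apply']

/-- The operator `-Δ/(2B)` raises and lowers the level index of the diagonal densities with the
coefficients of the Laguerre recurrence. For `n = 0` the term with the truncated index `n - 1` has
the coefficient zero. -/
lemma neg_laplacian_overlap_state {B : ℝ} (hB : 0 < B) (n a b : ℕ) :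
    (-((1 / (2 * B)) • schwartzLaplacian)) (overlap (state hB n a) (state hB n b))
      = (2 * (n : ℝ) + 1) • overlap (state hB n a) (state hB n b)
        - (n : ℝ) • overlap (state hB (n - 1) a) (state hB (n - 1) b)
        - ((n : ℝ) + 1) • overlap (state hB (n + 1) a) (state hB (n + 1) b) := by
  have hB' : B ≠ 0 := hB.ne'
  have hs : ∀ k : ℕ, (Real.sqrt (k + 1) : ℂ) * (Real.sqrt (k + 1) : ℂ) = k + 1 := by
    intro k
    rw [← Complex.ofReal_mul, Real.mul_self_sqrt (by positivity)]
    push_cast; rfl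
  have hann : overlap (annihilate B (state hB n a)) (annihilate B (state hB n b))
      = (n : ℂ) • overlap (state hB (n - 1) a) (state hB (n - 1) b) := by
    rcases n with _ | n
    · simp [annihilate_state_zero]
    · rw [annihilate_state_succ, annihilate_state_succ, overlap_smul_left, overlap_smul_right,
        smul_smul, Complex.conj_ofReal, hs]
      push_cast; rfl
  have hac : annihilate B (create B (state hB n a)) = (n + 1 : ℂ) • state hB n a := by
    rw [create_state, map_smul, annihilate_state_succ, smul_smul, hs]
  rw [LinearMap.neg_apply, LinearMap.smul_apply, schwartzLaplacian_apply, laplacian_overlap hB,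
    hann, hac, create_annihilate_state, create_state, create_state, overlap_smul_left,
    overlap_smul_right, overlap_smul_left, overlap_smul_right, Complex.conj_ofReal, smul_smul, hs]
  ext z
  simp only [neg_apply, smul_apply, sub_apply, add_apply, smul_eq_mul, Complex.real_smul,
    map_add, map_one, map_natCast]
  push_cast
  have hBC : (B : ℂ) ≠ 0 := by exact_mod_cast hB'
  field_simp
  ring

/-- The density `φ̄_{n,a} φ_{n,b}` is `L_n(-Δ/(2B))` applied to `φ̄_{0,a} φ_{0,b}`. -/
theorem laguerre_laplacian_overlap {B : ℝ} (hB : 0 < B) (n a b : ℕ) :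
    Polynomial.aeval (-((1 / (2 * B)) • schwartzLaplacian)) (laguerre n)
        (overlap (state hB 0 a) (state hB 0 b))
      = overlap (state hB n a) (state hB n b) := by
  induction n using Nat.twoStepInduction with
  | zero => simp [laguerre_zero]
  | one =>
    rw [laguerre_one, map_sub, map_one, Polynomial.aeval_X, LinearMap.sub_apply,
      Module.End.one_apply, neg_laplacian_overlap_state]
    simp
  | more n ih ih' =>
    have h := congrArg (fun p => Polynomial.aeval (-((1 / (2 * B)) • schwartzLaplacian)) p
      (overlap (state hB 0 a) (state hB 0 b))) (laguerre_recurrence n)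
    simp only [map_sub, map_smul, map_mul, Polynomial.aeval_X, LinearMap.sub_apply,
      LinearMap.smul_apply, Module.End.mul_apply, ih, ih'] at h
    rw [neg_laplacian_overlap_state] at h
    have hn : ((n : ℝ) + 2) ≠ 0 := by positivity
    refine smul_right_injective _ hn ?_
    simp only [Nat.add_sub_cancel] at h
    simp only
    rw [h]
    push_cast
    module

/-! ### Pairings of generalized potentials -/

lemma distLaplacian_pow_apply (k : ℕ) (T : GenPotential) (η : ℂ → ℂ) :
    (distLaplacian ^ k) T η = T (Laplacian.laplacian^[k] η) := by
  induction k generalizing T with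
  | zero => rfl
  | succ k ih =>
    rw [pow_succ, Module.End.mul_apply, ih, Function.iterate_succ_apply']
    rfl

lemma aeval_distLaplacian_apply (c : ℝ) (p : Polynomial ℝ) (T : GenPotential) (η : ℂ → ℂ) :
    Polynomial.aeval (-(c • distLaplacian)) p T η
      = ∑ k ∈ Finset.range (p.natDegree + 1),
        (p.coeff k * (-c) ^ k) • T (Laplacian.laplacian^[k] η) := by
  rw [Polynomial.aeval_eq_sum_range, LinearMap.sum_apply, Finset.sum_apply]
  refine Finset.sum_congr rfl fun k _ => ?_
  have hneg : -(c • distLaplacian) = (-c) • distLaplacian := (neg_smul c distLaplacian).symm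
  rw [hneg, smul_pow, LinearMap.smul_apply, LinearMap.smul_apply, Pi.smul_apply,
    Pi.smul_apply, distLaplacian_pow_apply, smul_smul]

lemma mul_aeval_schwartzLaplacian_apply (c : ℝ) (p : Polynomial ℝ) (V : ℂ → ℝ) (η : 𝓢(ℂ, ℂ))
    (z : ℂ) : (V z : ℂ) * Polynomial.aeval (-(c • schwartzLaplacian)) p η z
      = ∑ k ∈ Finset.range (p.natDegree + 1),
        ((p.coeff k * (-c) ^ k : ℝ) : ℂ) * ((V z : ℂ) * (schwartzLaplacian ^ k) η z) := by
  rw [Polynomial.aeval_eq_sum_range, LinearMap.sum_apply, sum_apply, Finset.mul_sum]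
  refine Finset.sum_congr rfl fun k _ => ?_
  rw [← neg_smul, smul_pow, LinearMap.smul_apply, LinearMap.smul_apply, smul_smul, smul_apply,
    Complex.real_smul]
  ring

/-- The distributional derivatives of a potential, moved to the test function. -/
lemma aeval_distLaplacian_ofFunction (c : ℝ) (p : Polynomial ℝ) (V : ℂ → ℝ) (η : 𝓢(ℂ, ℂ))
    (h : ∀ k, Integrable fun z => (V z : ℂ) * (schwartzLaplacian ^ k) η z) :
    Polynomial.aeval (-(c • distLaplacian)) p (ofFunction V) ⇑η
      = ∫ z, (V z : ℂ) * Polynomial.aeval (-(c • schwartzLaplacian)) p η z := by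
  simp_rw [mul_aeval_schwartzLaplacian_apply]
  rw [integral_finsetSum _ fun k _ => (h k).const_mul _, aeval_distLaplacian_apply]
  refine Finset.sum_congr rfl fun k _ => ?_
  rw [integral_const_mul, ← coe_schwartzLaplacian_pow, Complex.real_smul, ofFunction]

lemma laplacian_comp_isometry (R : ℂ ≃ₗᵢ[ℝ] ℂ) (η : ℂ → ℂ) :
    Laplacian.laplacian (fun s => η (R s)) = fun s => Laplacian.laplacian η (R s) := by
  funext s
  rw [InnerProductSpace.laplacian_eq_iteratedFDeriv_orthonormalBasis _
      Complex.orthonormalBasisOneI,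
    InnerProductSpace.laplacian_eq_iteratedFDeriv_orthonormalBasis η
      (Complex.orthonormalBasisOneI.map R)]
  refine Finset.sum_congr rfl fun i _ => ?_
  have h := R.toContinuousLinearEquiv.iteratedFDerivWithin_comp_right (𝕜 := ℝ) η
    uniqueDiffOn_univ (x := s) (Set.mem_univ _) 2
  rw [Set.preimage_univ, iteratedFDerivWithin_univ, iteratedFDerivWithin_univ] at h
  have h2 : (fun s => η (R s)) = η ∘ R.toContinuousLinearEquiv := rfl
  rw [h2, h, ContinuousMultilinearMap.compContinuousLinearMap_apply]
  congr 1
  funext j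
  fin_cases j <;> simp

lemma laplacian_iterate_comp_isometry (R : ℂ ≃ₗᵢ[ℝ] ℂ) (k : ℕ) (η : ℂ → ℂ) :
    Laplacian.laplacian^[k] (fun s => η (R s)) = fun s => Laplacian.laplacian^[k] η (R s) := by
  induction k with
  | zero => rfl
  | succ k ih =>
    rw [Function.iterate_succ_apply', ih, laplacian_comp_isometry, Function.iterate_succ_apply']

lemma effInteraction_comp_isometry (B : ℝ) (n : ℕ) {w : ℂ → ℝ}
    (hw : ∀ z z' : ℂ, ‖z‖ = ‖z'‖ → w z = w z') (R : ℂ ≃ₗᵢ[ℝ] ℂ) (η : ℂ → ℂ) :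
    effInteraction B n w (fun s => η (R s)) = effInteraction B n w η := by
  rw [effInteraction, aeval_distLaplacian_apply, aeval_distLaplacian_apply]
  refine Finset.sum_congr rfl fun k _ => ?_
  congr 1
  rw [laplacian_iterate_comp_isometry, ofFunction, ofFunction]
  have h := R.measurePreserving.integral_comp R.toHomeomorph.measurableEmbedding
    (fun s => (w s : ℂ) * Laplacian.laplacian^[k] η s)
  simp only [hw (R _) _ (R.norm_map _)] at h
  exact h

/-! ### Gaussian bounds and integrability -/

/-- `η` is bounded by a polynomial times `exp(-c|z|²)`. -/
def GaussBound (c : ℝ) (η : ℂ → ℂ) : Prop :=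
  ∃ (C : ℝ) (j : ℕ), 0 ≤ C ∧ ∀ z, ‖η z‖ ≤ C * (1 + ‖z‖) ^ j * Real.exp (-c * ‖z‖ ^ 2)

lemma gaussBound_state {B : ℝ} (hB : 0 < B) (n m : ℕ) : GaussBound (B / 4) (state hB n m) :=
  exists_norm_state_le hB n m

lemma GaussBound.add {c : ℝ} {η θ : ℂ → ℂ} (hη : GaussBound c η) (hθ : GaussBound c θ) :
    GaussBound c (η + θ) := by
  obtain ⟨C, j, hC, h⟩ := hη
  obtain ⟨C', j', hC', h'⟩ := hθ
  refine ⟨C + C', max j j', by positivity, fun z => ?_⟩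
  have hz : 1 ≤ 1 + ‖z‖ := by linarith [norm_nonneg z]
  calc ‖(η + θ) z‖ ≤ ‖η z‖ + ‖θ z‖ := norm_add_le _ _
    _ ≤ C * (1 + ‖z‖) ^ (max j j') * Real.exp (-c * ‖z‖ ^ 2)
        + C' * (1 + ‖z‖) ^ (max j j') * Real.exp (-c * ‖z‖ ^ 2) := by
      refine add_le_add ((h z).trans ?_) ((h' z).trans ?_)
      · gcongr
        exact le_max_left _ _
      · gcongr
        exact le_max_right _ _
    _ = _ := by ring

lemma GaussBound.mul {c c' : ℝ} {η θ : ℂ → ℂ} (hη : GaussBound c η) (hθ : GaussBound c' θ) :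
    GaussBound (c + c') (η * θ) := by
  obtain ⟨C, j, hC, h⟩ := hη
  obtain ⟨C', j', hC', h'⟩ := hθ
  refine ⟨C * C', j + j', by positivity, fun z => ?_⟩
  calc ‖(η * θ) z‖ = ‖η z‖ * ‖θ z‖ := norm_mul _ _
    _ ≤ (C * (1 + ‖z‖) ^ j * Real.exp (-c * ‖z‖ ^ 2))
        * (C' * (1 + ‖z‖) ^ j' * Real.exp (-c' * ‖z‖ ^ 2)) := by
      gcongr
      exacts [h z, h' z]
    _ = C * C' * (1 + ‖z‖) ^ (j + j')
        * (Real.exp (-c * ‖z‖ ^ 2) * Real.exp (-c' * ‖z‖ ^ 2)) := by ring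
    _ = _ := by rw [← Real.exp_add]; ring_nf

lemma GaussBound.conj {c : ℝ} {η : ℂ → ℂ} (hη : GaussBound c η) :
    GaussBound c fun z => conj (η z) := by
  simpa only [GaussBound, RCLike.norm_conj] using hη

lemma GaussBound.const_smul {c : ℝ} {η : ℂ → ℂ} (hη : GaussBound c η) (a : ℂ) :
    GaussBound c (a • η) := by
  obtain ⟨C, j, hC, h⟩ := hη
  refine ⟨‖a‖ * C, j, by positivity, fun z => ?_⟩
  rw [Pi.smul_apply, norm_smul, mul_assoc, mul_assoc, ← mul_assoc C]
  gcongr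
  exact h z

lemma gaussBound_overlap_state {B : ℝ} (hB : 0 < B) (n n' a b : ℕ) :
    GaussBound (B / 2) (overlap (state hB n a) (state hB n' b)) := by
  have h := (gaussBound_state hB n a).conj.mul (gaussBound_state hB n' b)
  rw [coe_overlap, show B / 2 = B / 4 + B / 4 by ring]
  exact h

/-- Moments against the lowest level densities control polynomials of every degree. -/
lemma integrable_mul_pow_mul_exp {B : ℝ} (hB : 0 < B) {V : ℂ → ℝ} (hVm : Measurable V)
    (hV : ∀ m : ℕ, Integrable fun r : ℂ => |V r| * ‖landauState B 0 m r‖ ^ 2) (j : ℕ) :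
    Integrable fun z : ℂ => |V z| * ((1 + ‖z‖) ^ j * Real.exp (-(B / 2) * ‖z‖ ^ 2)) := by
  have hform : ∀ (m : ℕ), ∃ K : ℝ, 0 < K ∧ ∀ z : ℂ, ‖landauState B 0 m z‖ ^ 2
      = K * (‖z‖ ^ (2 * m) * Real.exp (-(B / 2) * ‖z‖ ^ 2)) := by
    intro m
    have hpi := Real.pi_pos
    refine ⟨(B / 2) ^ (m + 1) / (Real.pi * m.factorial), by positivity, fun z => ?_⟩
    rw [← coe_state hB, state_zero_apply, norm_mul, norm_mul, Complex.norm_real, Complex.norm_real,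
      Real.norm_eq_abs, Real.norm_eq_abs, Real.abs_exp, abs_of_nonneg (Real.sqrt_nonneg _), mul_pow,
      mul_pow, Real.sq_sqrt (by positivity), norm_pow, ← pow_mul, mul_comm m 2, ← Real.exp_nat_mul]
    ring_nf
  obtain ⟨K0, hK0, h0⟩ := hform 0
  obtain ⟨Kj, hKj, hj⟩ := hform j
  refine (((hV 0).const_mul (2 ^ j / K0)).add ((hV j).const_mul (2 ^ j / Kj))).mono' ?_
    (Filter.Eventually.of_forall fun z => ?_)
  · refine hVm.abs.aestronglyMeasurable.mul ?_
    exact (by fun_prop : Continuous fun z : ℂ =>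
      (1 + ‖z‖) ^ j * Real.exp (-(B / 2) * ‖z‖ ^ 2)).aestronglyMeasurable
  · have hz : 0 ≤ ‖z‖ := norm_nonneg z
    have hpow : (1 + ‖z‖) ^ j ≤ 2 ^ j * (1 + ‖z‖ ^ (2 * j)) := by
      rcases le_total ‖z‖ 1 with h | h
      · calc (1 + ‖z‖) ^ j ≤ 2 ^ j := by gcongr; linarith
          _ ≤ 2 ^ j * (1 + ‖z‖ ^ (2 * j)) :=
            le_mul_of_one_le_right (by positivity) (by linarith [pow_nonneg hz (2 * j)])
      · calc (1 + ‖z‖) ^ j ≤ (2 * ‖z‖) ^ j := by gcongr; linarith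
          _ = 2 ^ j * ‖z‖ ^ j := mul_pow _ _ _
          _ ≤ 2 ^ j * (1 + ‖z‖ ^ (2 * j)) := by
            gcongr
            have : ‖z‖ ^ j ≤ ‖z‖ ^ (2 * j) := pow_le_pow_right₀ h (by omega)
            linarith
    simp only [Pi.add_apply, h0, hj, Real.norm_eq_abs]
    rw [abs_of_nonneg (by positivity)]
    calc |V z| * ((1 + ‖z‖) ^ j * Real.exp (-(B / 2) * ‖z‖ ^ 2))
        ≤ |V z| * ((2 ^ j * (1 + ‖z‖ ^ (2 * j))) * Real.exp (-(B / 2) * ‖z‖ ^ 2)) := by gcongr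
      _ = _ := by
        field_simp
        ring

lemma integrable_mul_of_gaussBound {B : ℝ} (hB : 0 < B) {V : ℂ → ℝ} (hVm : Measurable V)
    (hV : ∀ m : ℕ, Integrable fun r : ℂ => |V r| * ‖landauState B 0 m r‖ ^ 2) {η : 𝓢(ℂ, ℂ)}
    (hη : GaussBound (B / 2) η) : Integrable fun z => (V z : ℂ) * η z := by
  obtain ⟨C, j, hC, h⟩ := hη
  refine ((integrable_mul_pow_mul_exp hB hVm hV j).const_mul C).mono' ?_
    (Filter.Eventually.of_forall fun z => ?_)
  · exact (Complex.measurable_ofReal.comp hVm).aestronglyMeasurable.mul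
      η.continuous.aestronglyMeasurable
  · rw [norm_mul, Complex.norm_real, Real.norm_eq_abs]
    calc |V z| * ‖η z‖ ≤ |V z| * (C * (1 + ‖z‖) ^ j * Real.exp (-(B / 2) * ‖z‖ ^ 2)) := by
          gcongr; exact h z
      _ = _ := by ring

lemma gaussBound_laplacian_pow_overlap {B : ℝ} (hB : 0 < B) (k a b : ℕ) :
    GaussBound (B / 2) ((schwartzLaplacian ^ k) (overlap (state hB 0 a) (state hB 0 b))) := by
  set S := Submodule.span ℂ (Set.range fun n => overlap (state hB n a) (state hB n b)) with hS
  have hmem : ∀ n, overlap (state hB n a) (state hB n b) ∈ S := fun n =>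
    Submodule.subset_span ⟨n, rfl⟩
  have hstep : S ≤ S.comap schwartzLaplacian := by
    rw [hS, Submodule.span_le]
    rintro _ ⟨n, rfl⟩
    change schwartzLaplacian _ ∈ S
    have h := neg_laplacian_overlap_state hB n a b
    rw [← neg_smul, LinearMap.smul_apply] at h
    have hc : -(1 / (2 * B)) ≠ 0 := neg_ne_zero.2 (by positivity)
    rw [← inv_smul_smul₀ hc (schwartzLaplacian _), h]
    exact S.smul_of_tower_mem _ (S.sub_mem (S.sub_mem (S.smul_of_tower_mem _ (hmem _))
      (S.smul_of_tower_mem _ (hmem _))) (S.smul_of_tower_mem _ (hmem _)))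
  have hk : (schwartzLaplacian ^ k) (overlap (state hB 0 a) (state hB 0 b)) ∈ S := by
    induction k with
    | zero => exact hmem 0
    | succ k ih =>
      rw [pow_succ', Module.End.mul_apply]
      exact hstep ih
  generalize (schwartzLaplacian ^ k) (overlap (state hB 0 a) (state hB 0 b)) = η at hk
  induction hk using Submodule.span_induction with
  | mem _ h => obtain ⟨n, rfl⟩ := h; exact gaussBound_overlap_state hB n n a b
  | zero => exact ⟨0, 0, le_rfl, fun z => by simp⟩
  | add x y _ _ hx hy => exact hx.add hy
  | smul c x _ hx => exact hx.const_smul c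

lemma integrable_mul_laplacian_pow_overlap {B : ℝ} (hB : 0 < B) {V : ℂ → ℝ} (hVm : Measurable V)
    (hV : ∀ m : ℕ, Integrable fun r : ℂ => |V r| * ‖landauState B 0 m r‖ ^ 2) (k a b : ℕ) :
    Integrable fun z =>
      (V z : ℂ) * (schwartzLaplacian ^ k) (overlap (state hB 0 a) (state hB 0 b)) z :=
  integrable_mul_of_gaussBound hB hVm hV (gaussBound_laplacian_pow_overlap hB k a b)

lemma stateProduct_eq {B : ℝ} (hB : 0 < B) (m l : ℕ) :
    stateProduct B m l = ⇑(overlap (state hB 0 m) (state hB 0 l)) := by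
  funext z
  rw [stateProduct, overlap_apply, coe_state, coe_state]

/-- `⟨φ_{0,a}| V_n |φ_{0,b}⟩ = ⟨φ_{n,a}| V |φ_{n,b}⟩`. -/
theorem effExternal_stateProduct {B : ℝ} (hB : 0 < B) (n : ℕ) {V : ℂ → ℝ} (hVm : Measurable V)
    (hV : ∀ m : ℕ, Integrable fun r : ℂ => |V r| * ‖landauState B 0 m r‖ ^ 2) (a b : ℕ) :
    effExternal B n V (stateProduct B a b)
      = ∫ z, (V z : ℂ) * overlap (state hB n a) (state hB n b) z := by
  rw [effExternal, stateProduct_eq hB, aeval_distLaplacian_ofFunction _ _ _ _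
    (integrable_mul_laplacian_pow_overlap hB hVm hV · a b), laguerre_laplacian_overlap]

/-! ### Correlations of densities -/

/-- The reflection `z ↦ -z` on Schwartz functions. -/
def reflect : 𝓢(ℂ, ℂ) →ₗ[ℂ] 𝓢(ℂ, ℂ) :=
  (SchwartzMap.compCLMOfContinuousLinearEquiv ℂ (ContinuousLinearEquiv.neg ℝ)).toLinearMap

lemma reflect_apply (η : 𝓢(ℂ, ℂ)) (z : ℂ) : reflect η z = η (-z) := by
  simp [reflect]

lemma coe_reflect (η : 𝓢(ℂ, ℂ)) :
    ⇑(reflect η) = fun z => η (LinearIsometryEquiv.neg ℝ z) :=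
  funext (reflect_apply η)

/-- The correlation `s ↦ ∫ u(R + s/2) v(R - s/2) dR` of two densities. It is a convolution of
Schwartz functions, so that a derivative can be moved to either factor. -/
def correlation : 𝓢(ℂ, ℂ) →ₗ[ℂ] 𝓢(ℂ, ℂ) →ₗ[ℂ] 𝓢(ℂ, ℂ) :=
  LinearMap.mk₂ ℂ
    (fun u v => SchwartzMap.convolution (ContinuousLinearMap.mul ℂ ℂ) u (reflect v))
    (by simp) (by simp) (by simp) (by simp)

lemma correlation_eq_convolution (u v : 𝓢(ℂ, ℂ)) :
    correlation u v
      = SchwartzMap.convolution (ContinuousLinearMap.mul ℂ ℂ) u (reflect v) := rfl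

lemma correlation_apply (u v : 𝓢(ℂ, ℂ)) (s : ℂ) :
    correlation u v s = ∫ R, u (R + s / 2) * v (R - s / 2) := by
  rw [← integral_sub_right_eq_self (μ := volume) (fun R => u (R + s / 2) * v (R - s / 2)) (s / 2)]
  simp only [correlation, LinearMap.mk₂_apply, SchwartzMap.convolution_apply, convolution_def,
    ContinuousLinearMap.mul_apply', reflect_apply]
  refine integral_congr_ae (Filter.Eventually.of_forall fun t => ?_)
  simp only
  congr 2 <;> ring

lemma schwartzLaplacian_convolution (u v : 𝓢(ℂ, ℂ)) :
    schwartzLaplacian (SchwartzMap.convolution (ContinuousLinearMap.mul ℂ ℂ) u v)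
      = SchwartzMap.convolution (ContinuousLinearMap.mul ℂ ℂ) (schwartzLaplacian u) v := by
  have hg : (fun x : ℂ => ‖x‖ ^ 2).HasTemperateGrowth := Function.hasTemperateGrowth_norm_sq ℂ
  have hF : ∀ (η : 𝓢(ℂ, ℂ)) (x : ℂ), (FourierTransform.fourier (schwartzLaplacian η) : 𝓢(ℂ, ℂ)) x
      = -(2 * Real.pi) ^ 2 * ‖x‖ ^ 2 * (FourierTransform.fourier η : 𝓢(ℂ, ℂ)) x := by
    intro η x
    rw [schwartzLaplacian_apply, SchwartzMap.laplacian_eq_fourierMultiplierCLM,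
      FourierTransform.fourier_smul, SchwartzMap.fourierMultiplierCLM_apply]
    simp [SchwartzMap.smulLeftCLM_apply_apply hg]
    ring
  refine (FourierTransform.fourierCLE ℂ 𝓢(ℂ, ℂ)).injective ?_
  ext x
  simp only [FourierTransform.fourierCLE_apply]
  rw [hF, SchwartzMap.fourier_convolution, SchwartzMap.fourier_convolution,
    SchwartzMap.pairing_apply_apply, SchwartzMap.pairing_apply_apply, hF]
  simp only [ContinuousLinearMap.mul_apply']
  ring

lemma convolution_mul_comm (u v : 𝓢(ℂ, ℂ)) :
    SchwartzMap.convolution (ContinuousLinearMap.mul ℂ ℂ) u v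
      = SchwartzMap.convolution (ContinuousLinearMap.mul ℂ ℂ) v u := by
  rw [← SchwartzMap.convolution_flip]
  congr 2
  ext; simp

lemma reflect_schwartzLaplacian (v : 𝓢(ℂ, ℂ)) :
    reflect (schwartzLaplacian v) = schwartzLaplacian (reflect v) := by
  refine DFunLike.coe_injective ?_
  rw [coe_reflect, coe_schwartzLaplacian, coe_schwartzLaplacian, coe_reflect,
    laplacian_comp_isometry]

lemma correlation_schwartzLaplacian_left (u v : 𝓢(ℂ, ℂ)) :
    correlation (schwartzLaplacian u) v = schwartzLaplacian (correlation u v) := by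
  rw [correlation_eq_convolution, correlation_eq_convolution, schwartzLaplacian_convolution]

lemma correlation_schwartzLaplacian_right (u v : 𝓢(ℂ, ℂ)) :
    correlation u (schwartzLaplacian v) = schwartzLaplacian (correlation u v) := by
  rw [correlation_eq_convolution, correlation_eq_convolution, reflect_schwartzLaplacian,
    convolution_mul_comm, ← schwartzLaplacian_convolution, convolution_mul_comm]

lemma map_aeval_of_commute {E : Type*} [AddCommGroup E] [Module ℂ E] {L T : Module.End ℂ E}
    (h : Commute L T) (p : Polynomial ℝ) : Commute L (Polynomial.aeval T p) := by
  induction p using Polynomial.induction_on with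
  | C a => rw [Polynomial.aeval_C]; exact (Algebra.commutes a L).symm
  | add p q hp hq => rw [map_add]; exact hp.add_right hq
  | monomial k a _ =>
    rw [map_mul, map_pow, Polynomial.aeval_C, Polynomial.aeval_X]
    exact (show Commute L (algebraMap ℝ (Module.End ℂ E) a) from
      (Algebra.commutes a L).symm).mul_right (h.pow_right _)

/-- Polynomials of the Laplacian acting on both factors of a correlation multiply. -/
lemma correlation_aeval (c : ℝ) (p q : Polynomial ℝ) (u v : 𝓢(ℂ, ℂ)) :
    correlation (Polynomial.aeval (-(c • schwartzLaplacian)) p u)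
        (Polynomial.aeval (-(c • schwartzLaplacian)) q v)
      = Polynomial.aeval (-(c • schwartzLaplacian)) (p * q) (correlation u v) := by
  have hl : ∀ v, Commute (correlation.flip v) (-(c • schwartzLaplacian)) := fun v =>
    ((show Commute (correlation.flip v) schwartzLaplacian from LinearMap.ext fun u =>
      correlation_schwartzLaplacian_left u v).smul_right c).neg_right
  have hr : ∀ u, Commute (correlation u) (-(c • schwartzLaplacian)) := fun u =>
    ((show Commute (correlation u) schwartzLaplacian from LinearMap.ext fun v =>
      correlation_schwartzLaplacian_right u v).smul_right c).neg_right
  have h1 := LinearMap.congr_fun (map_aeval_of_commute (hl (Polynomial.aeval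
    (-(c • schwartzLaplacian)) q v)) p) u
  have h2 := LinearMap.congr_fun (map_aeval_of_commute (hr u) q) v
  simp only [Module.End.mul_apply, LinearMap.flip_apply] at h1 h2
  rw [h1, h2, map_mul, Module.End.mul_apply]

/-! ### Centre and relative coordinates -/

/-- The coordinates `(r₁, r₂) = (R + s/2, R - s/2)` in terms of the relative coordinate `s` and
the centre `R`. -/
def centerRelative : (ℂ × ℂ) ≃ᵐ (ℂ × ℂ) where
  toFun q := (q.2 + q.1 / 2, q.2 - q.1 / 2)
  invFun p := (p.1 - p.2, (p.1 + p.2) / 2)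
  left_inv q := by ext1 <;> (simp only; ring)
  right_inv p := by ext1 <;> (simp only; ring)
  measurable_toFun := (by fun_prop : Continuous fun q : ℂ × ℂ =>
    (q.2 + q.1 / 2, q.2 - q.1 / 2)).measurable
  measurable_invFun := (by fun_prop : Continuous fun p : ℂ × ℂ =>
    (p.1 - p.2, (p.1 + p.2) / 2)).measurable

lemma centerRelative_apply (q : ℂ × ℂ) :
    centerRelative q = (q.2 + q.1 / 2, q.2 - q.1 / 2) := rfl

lemma measurePreserving_centerRelative :
    MeasurePreserving centerRelative (volume : Measure (ℂ × ℂ)) volume := by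
  have h1 : MeasurePreserving (fun q : ℂ × ℂ => (q.1, q.2 - q.1 / 2)) volume volume :=
    (MeasurePreserving.id (volume : Measure ℂ)).skew_product
      (g := fun s R => R - s / 2) (by fun_prop)
      (Filter.Eventually.of_forall fun s => map_sub_right_eq_self volume (s / 2))
  have h2 : MeasurePreserving (fun q : ℂ × ℂ => (q.2, q.2 + q.1)) volume volume :=
    measurePreserving_prod_add_swap (volume : Measure ℂ) (volume : Measure ℂ)
  have h3 : MeasurePreserving (Prod.swap : ℂ × ℂ → ℂ × ℂ) volume volume :=
    Measure.measurePreserving_swap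
  have h4 := (h3.comp h2).comp h1
  have : ⇑centerRelative = (Prod.swap ∘ fun q : ℂ × ℂ => (q.2, q.2 + q.1))
      ∘ fun q : ℂ × ℂ => (q.1, q.2 - q.1 / 2) := by
    funext q
    simp only [centerRelative_apply, Function.comp_apply, Prod.swap_prod_mk]
    congr 1
    ring
  rw [this]
  exact h4

lemma norm_sq_add_norm_sq_centerRelative (R s : ℂ) :
    ‖R + s / 2‖ ^ 2 + ‖R - s / 2‖ ^ 2 = 2 * ‖R‖ ^ 2 + ‖s‖ ^ 2 / 2 := by
  have h := parallelogram_law_with_norm ℝ R (s / 2)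
  have h2 : ‖s / 2‖ = ‖s‖ / 2 := by simp
  rw [h2] at h
  nlinarith [h]

lemma integrable_one_add_pow_mul_exp {c : ℝ} (hc : 0 < c) (j : ℕ) :
    Integrable fun z : ℂ => (1 + ‖z‖) ^ j * Real.exp (-c * ‖z‖ ^ 2) := by
  obtain ⟨M, hM⟩ := one_add_pow_mul_exp_le (half_pos hc) j
  obtain ⟨θ, hθ⟩ := exists_schwartz_gaussian (half_pos hc)
  have hint : Integrable fun z : ℂ => M * ‖θ z‖ := θ.integrable.norm.const_mul M
  refine hint.mono' (by fun_prop : Continuous fun z : ℂ =>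
    (1 + ‖z‖) ^ j * Real.exp (-c * ‖z‖ ^ 2)).aestronglyMeasurable
    (Filter.Eventually.of_forall fun z => ?_)
  rw [hθ, Complex.norm_real, Real.norm_eq_abs, Real.norm_eq_abs, Real.abs_exp,
    abs_of_nonneg (by positivity)]
  calc (1 + ‖z‖) ^ j * Real.exp (-c * ‖z‖ ^ 2)
      = ((1 + ‖z‖) ^ j * Real.exp (-(c / 2) * ‖z‖ ^ 2)) * Real.exp (-(c / 2) * ‖z‖ ^ 2) := by
        rw [mul_assoc, ← Real.exp_add]; ring_nf
    _ ≤ _ := by gcongr; exact hM _ (norm_nonneg z)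

/-- The interaction energy density of two densities with Gaussian bounds is integrable. -/
lemma integrable_interaction {B : ℝ} (hB : 0 < B) {w : ℂ → ℝ} (hwm : Measurable w)
    (hw : ∀ m : ℕ, Integrable fun s : ℂ => |w s| * ‖landauState (B / 2) 0 m s‖ ^ 2)
    {u v : 𝓢(ℂ, ℂ)} (hu : GaussBound (B / 2) u) (hv : GaussBound (B / 2) v) :
    Integrable fun p : ℂ × ℂ => (w (p.1 - p.2) : ℂ) * (u p.1 * v p.2) := by
  rw [← measurePreserving_centerRelative.integrable_comp_emb centerRelative.measurableEmbedding]
  obtain ⟨C, j, hC, hu⟩ := hu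
  obtain ⟨C', j', hC', hv⟩ := hv
  have h1 := integrable_mul_pow_mul_exp (half_pos hB) hwm hw (j + j')
  have h2 := integrable_one_add_pow_mul_exp hB (j + j')
  refine ((h1.mul_prod h2).const_mul (C * C')).mono' ?_ (Filter.Eventually.of_forall fun q => ?_)
  · refine Measurable.aestronglyMeasurable ?_
    refine Measurable.comp ?_ centerRelative.measurable
    have hc : Measurable fun p : ℂ × ℂ => u p.1 * v p.2 := by
      have := u.continuous
      have := v.continuous
      exact (by fun_prop : Continuous fun p : ℂ × ℂ => u p.1 * v p.2).measurable
    exact (Complex.measurable_ofReal.comp (hwm.comp (measurable_fst.sub measurable_snd))).mul hc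
  · obtain ⟨s, R⟩ := q
    simp only [Function.comp_apply, centerRelative_apply]
    have hs : R + s / 2 - (R - s / 2) = s := by ring
    have hn1 : 1 + ‖R + s / 2‖ ≤ (1 + ‖s‖) * (1 + ‖R‖) := by
      have := norm_add_le R (s / 2)
      have h3 : ‖s / 2‖ = ‖s‖ / 2 := by simp
      nlinarith [norm_nonneg R, norm_nonneg s, mul_nonneg (norm_nonneg R) (norm_nonneg s)]
    have hn2 : 1 + ‖R - s / 2‖ ≤ (1 + ‖s‖) * (1 + ‖R‖) := by
      have := norm_sub_le R (s / 2)
      have h3 : ‖s / 2‖ = ‖s‖ / 2 := by simp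
      nlinarith [norm_nonneg R, norm_nonneg s, mul_nonneg (norm_nonneg R) (norm_nonneg s)]
    have hexp : Real.exp (-(B / 2) * ‖R + s / 2‖ ^ 2) * Real.exp (-(B / 2) * ‖R - s / 2‖ ^ 2)
        = Real.exp (-(B / 2 / 2) * ‖s‖ ^ 2) * Real.exp (-B * ‖R‖ ^ 2) := by
      rw [← Real.exp_add, ← Real.exp_add]
      congr 1
      linear_combination (-(B / 2)) * norm_sq_add_norm_sq_centerRelative R s
    rw [hs, norm_mul, norm_mul, Complex.norm_real, Real.norm_eq_abs]
    calc |w s| * (‖u (R + s / 2)‖ * ‖v (R - s / 2)‖)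
        ≤ |w s| * ((C * ((1 + ‖s‖) * (1 + ‖R‖)) ^ j * Real.exp (-(B / 2) * ‖R + s / 2‖ ^ 2))
          * (C' * ((1 + ‖s‖) * (1 + ‖R‖)) ^ j' * Real.exp (-(B / 2) * ‖R - s / 2‖ ^ 2))) := by
          gcongr
          · refine (hu _).trans ?_
            gcongr
          · refine (hv _).trans ?_
            gcongr
      _ = |w s| * (C * C' * ((1 + ‖s‖) * (1 + ‖R‖)) ^ (j + j')
          * (Real.exp (-(B / 2) * ‖R + s / 2‖ ^ 2) * Real.exp (-(B / 2) * ‖R - s / 2‖ ^ 2))) := by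
          ring
      _ = _ := by rw [hexp, mul_pow]; ring

/-- The interaction energy of two densities, through their correlation. -/
lemma integral_interaction {B : ℝ} (hB : 0 < B) {w : ℂ → ℝ} (hwm : Measurable w)
    (hw : ∀ m : ℕ, Integrable fun s : ℂ => |w s| * ‖landauState (B / 2) 0 m s‖ ^ 2)
    {u v : 𝓢(ℂ, ℂ)} (hu : GaussBound (B / 2) u) (hv : GaussBound (B / 2) v) :
    ∫ p : ℂ × ℂ, (w (p.1 - p.2) : ℂ) * (u p.1 * v p.2) = ∫ s, (w s : ℂ) * correlation u v s := by
  have hint := integrable_interaction hB hwm hw hu hv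
  rw [← measurePreserving_centerRelative.integrable_comp_emb
    centerRelative.measurableEmbedding] at hint
  rw [← measurePreserving_centerRelative.integral_comp centerRelative.measurableEmbedding,
    Measure.volume_eq_prod]
  refine (integral_prod _ hint).trans ?_
  refine integral_congr_ae (Filter.Eventually.of_forall fun s => ?_)
  simp only [Function.comp_apply, centerRelative_apply, correlation_apply]
  rw [← integral_const_mul]
  refine integral_congr_ae (Filter.Eventually.of_forall fun R => ?_)
  simp only
  rw [show R + s / 2 - (R - s / 2) = s by ring]

/-! ### Pairs of particles in the lowest level -/

/-- Two particles in the lowest level for the field `B` have a relative motion in the lowest level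
for the field `B/2`: `z₁^c z₂^d` is a polynomial in `R` and `s`, and the Gaussians combine by the
parallelogram law. -/
lemma exists_center_expansion {B : ℝ} (hB : 0 < B) (c d : ℕ) :
    ∃ h : ℕ → 𝓢(ℂ, ℂ), (∀ m, c + d + 1 ≤ m → h m = 0) ∧
      ∀ R s : ℂ, state hB 0 c (R + s / 2) * state hB 0 d (R - s / 2)
        = ∑ m ∈ Finset.range (c + d + 1), h m R * state (half_pos hB) 0 m s := by
  set K : ℕ → ℂ := fun m => (Real.sqrt ((B / 2) ^ (m + 1) / (Real.pi * m.factorial)) : ℂ) with hK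
  set K' : ℕ → ℂ :=
    fun m => (Real.sqrt ((B / 2 / 2) ^ (m + 1) / (Real.pi * m.factorial)) : ℂ) with hK'
  have hK'0 : ∀ m, K' m ≠ 0 := by
    intro m
    have hpi := Real.pi_pos
    have : Real.sqrt ((B / 2 / 2) ^ (m + 1) / (Real.pi * m.factorial)) ≠ 0 := by positivity
    exact Complex.ofReal_ne_zero.2 this
  set P := Finset.range (c + 1) ×ˢ Finset.range (d + 1) with hP
  set k : ℕ × ℕ → 𝓢(ℂ, ℂ) := fun p =>
    (K c * K d * (K' (p.1 + p.2))⁻¹ * (c.choose p.1 * (1 / 2) ^ p.1)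
      * (d.choose p.2 * (-1 / 2) ^ p.2)) •
      gaussMonomial (half_pos hB) ((c - p.1) + (d - p.2)) 0 with hk
  refine ⟨fun m => ∑ p ∈ P with p.1 + p.2 = m, k p, fun m hm => ?_, fun R s => ?_⟩
  · refine Finset.sum_eq_zero fun p hp => ?_
    simp only [hP, Finset.mem_filter, Finset.mem_product, Finset.mem_range] at hp
    omega
  · have hexp : (Real.exp (-(B / 4) * ‖R + s / 2‖ ^ 2) : ℂ)
          * (Real.exp (-(B / 4) * ‖R - s / 2‖ ^ 2) : ℂ)
        = (Real.exp (-(B / 2) * ‖R‖ ^ 2) : ℂ) * (Real.exp (-(B / 2 / 4) * ‖s‖ ^ 2) : ℂ) := by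
      rw [← Complex.ofReal_mul, ← Complex.ofReal_mul, ← Real.exp_add, ← Real.exp_add]
      congr 2
      linear_combination (-(B / 4)) * norm_sq_add_norm_sq_centerRelative R s
    have h1 : (R + s / 2) ^ c = ∑ i ∈ Finset.range (c + 1),
        (c.choose i * (1 / 2) ^ i) * R ^ (c - i) * s ^ i := by
      rw [add_comm, add_pow]
      refine Finset.sum_congr rfl fun i _ => ?_
      rw [div_pow, div_pow, one_pow]; ring
    have h2 : (R - s / 2) ^ d = ∑ i ∈ Finset.range (d + 1),
        (d.choose i * (-1 / 2) ^ i) * R ^ (d - i) * s ^ i := by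
      rw [sub_eq_add_neg, add_comm, add_pow]
      refine Finset.sum_congr rfl fun i _ => ?_
      rw [show -(s / 2) = (-1 / 2) * s by ring, mul_pow]; ring
    have h3 : ∑ m ∈ Finset.range (c + d + 1),
        (∑ p ∈ P with p.1 + p.2 = m, k p) R * state (half_pos hB) 0 m s
        = ∑ p ∈ P, k p R * state (half_pos hB) 0 (p.1 + p.2) s := by
      rw [← Finset.sum_fiberwise_of_maps_to (s := P) (t := Finset.range (c + d + 1))
        (g := fun p => p.1 + p.2)]
      · refine Finset.sum_congr rfl fun m _ => ?_
        rw [sum_apply, Finset.sum_mul]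
        refine Finset.sum_congr rfl fun p hp => ?_
        rw [(Finset.mem_filter.1 hp).2]
      · intro p hp
        simp only [hP, Finset.mem_product, Finset.mem_range] at hp ⊢
        omega
    rw [h3, state_zero_apply, state_zero_apply]
    change K c * _ * (K d * _) = _
    calc K c * ((R + s / 2) ^ c * (Real.exp (-(B / 4) * ‖R + s / 2‖ ^ 2) : ℂ))
          * (K d * ((R - s / 2) ^ d * (Real.exp (-(B / 4) * ‖R - s / 2‖ ^ 2) : ℂ)))
        = K c * K d * ((Real.exp (-(B / 2) * ‖R‖ ^ 2) : ℂ)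
          * (Real.exp (-(B / 2 / 4) * ‖s‖ ^ 2) : ℂ)) * ((R + s / 2) ^ c * (R - s / 2) ^ d) := by
          rw [← hexp]; ring
      _ = ∑ p ∈ P, K c * K d * ((Real.exp (-(B / 2) * ‖R‖ ^ 2) : ℂ)
          * (Real.exp (-(B / 2 / 4) * ‖s‖ ^ 2) : ℂ)) *
          (((c.choose p.1 * (1 / 2) ^ p.1) * R ^ (c - p.1) * s ^ p.1) *
            ((d.choose p.2 * (-1 / 2) ^ p.2) * R ^ (d - p.2) * s ^ p.2)) := by
          rw [h1, h2, Finset.sum_mul_sum, ← Finset.sum_product', Finset.mul_sum]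
      _ = _ := by
          refine Finset.sum_congr rfl fun p _ => ?_
          rw [state_zero_apply]
          change _ = _ * (K' (p.1 + p.2) * _)
          simp only [hk, smul_apply, gaussMonomial_apply, smul_eq_mul, pow_zero, pow_add, mul_one]
          have := hK'0 (p.1 + p.2)
          field_simp

/-- The factor of the centre of mass in the expansion of the pair `φ_{0,c} ⊗ φ_{0,d}` with respect
to the relative states `χ_m`. -/
def centerPart {B : ℝ} (hB : 0 < B) (c d m : ℕ) : 𝓢(ℂ, ℂ) :=
  (exists_center_expansion hB c d).choose m

lemma centerPart_eq_zero {B : ℝ} (hB : 0 < B) {c d m : ℕ} (h : c + d + 1 ≤ m) :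
    centerPart hB c d m = 0 :=
  (exists_center_expansion hB c d).choose_spec.1 m h

lemma state_mul_state {B : ℝ} (hB : 0 < B) (c d : ℕ) (R s : ℂ) :
    state hB 0 c (R + s / 2) * state hB 0 d (R - s / 2)
      = ∑ m ∈ Finset.range (c + d + 1), centerPart hB c d m R * state (half_pos hB) 0 m s :=
  (exists_center_expansion hB c d).choose_spec.2 R s

lemma integral_conj_relState_mul {B : ℝ} (hB : 0 < B) (c d m : ℕ) (R : ℂ) :
    ∫ s, conj (state (half_pos hB) 0 m s) *
      (state hB 0 c (R + s / 2) * state hB 0 d (R - s / 2)) = centerPart hB c d m R := by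
  have h : ∀ s, conj (state (half_pos hB) 0 m s) *
      (state hB 0 c (R + s / 2) * state hB 0 d (R - s / 2))
      = ∑ m' ∈ Finset.range (c + d + 1), centerPart hB c d m' R
        * overlap (state (half_pos hB) 0 m) (state (half_pos hB) 0 m') s := by
    intro s
    rw [state_mul_state, Finset.mul_sum]
    refine Finset.sum_congr rfl fun m' _ => ?_
    rw [overlap_apply]; ring
  simp_rw [h]
  rw [integral_finsetSum _ fun m' _ => (SchwartzMap.integrable _).const_mul _]
  simp only [integral_const_mul, integral_overlap_state_zero, mul_ite, mul_one, mul_zero]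
  rw [Finset.sum_ite_eq]
  split_ifs with hm
  · rfl
  · rw [centerPart_eq_zero hB (by simpa using hm)]; rfl

/-- The matrix elements of the relative states between the pairs `(a, b)` and `(c, d)`. -/
def pairCoeff {B : ℝ} (hB : 0 < B) (a b c d m m' : ℕ) : ℂ :=
  ∫ R, overlap (centerPart hB a b m) (centerPart hB c d m') R

lemma pairCoeff_eq_zero_left {B : ℝ} (hB : 0 < B) {a b c d m m' : ℕ} (h : a + b + 1 ≤ m) :
    pairCoeff hB a b c d m m' = 0 := by
  simp [pairCoeff, centerPart_eq_zero hB h]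

lemma pairCoeff_eq_zero_right {B : ℝ} (hB : 0 < B) {a b c d m m' : ℕ} (h : c + d + 1 ≤ m') :
    pairCoeff hB a b c d m m' = 0 := by
  simp [pairCoeff, centerPart_eq_zero hB h]

lemma overlap_mul_overlap {B : ℝ} (hB : 0 < B) (a b c d : ℕ) (R s : ℂ) :
    overlap (state hB 0 a) (state hB 0 c) (R + s / 2)
        * overlap (state hB 0 b) (state hB 0 d) (R - s / 2)
      = ∑ m ∈ Finset.range (a + b + 1), ∑ m' ∈ Finset.range (c + d + 1),
        overlap (centerPart hB a b m) (centerPart hB c d m') R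
          * overlap (state (half_pos hB) 0 m) (state (half_pos hB) 0 m') s := by
  simp only [overlap_apply]
  calc _ = conj (state hB 0 a (R + s / 2) * state hB 0 b (R - s / 2))
        * (state hB 0 c (R + s / 2) * state hB 0 d (R - s / 2)) := by rw [map_mul]; ring
    _ = _ := by
      rw [state_mul_state, state_mul_state, map_sum, Finset.sum_mul_sum]
      refine Finset.sum_congr rfl fun m _ => Finset.sum_congr rfl fun m' _ => ?_
      rw [map_mul]; ring

/-- The correlation of two lowest level densities is a combination of relative densities. -/
lemma correlation_overlap_state {B : ℝ} (hB : 0 < B) (a b c d : ℕ) :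
    correlation (overlap (state hB 0 a) (state hB 0 c)) (overlap (state hB 0 b) (state hB 0 d))
      = ∑ m ∈ Finset.range (a + b + 1), ∑ m' ∈ Finset.range (c + d + 1),
        pairCoeff hB a b c d m m' • overlap (state (half_pos hB) 0 m) (state (half_pos hB) 0 m') := by
  ext s
  simp only [correlation_apply, overlap_mul_overlap, sum_apply, smul_apply, smul_eq_mul]
  rw [integral_finsetSum _ fun m _ => integrable_finsetSum _ fun m' _ =>
    (SchwartzMap.integrable _).mul_const _]
  refine Finset.sum_congr rfl fun m _ => ?_
  rw [integral_finsetSum _ fun m' _ => (SchwartzMap.integrable _).mul_const _]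
  refine Finset.sum_congr rfl fun m' _ => ?_
  rw [integral_mul_const, pairCoeff]

lemma relState_mul_centerPart_comp {B : ℝ} (hB : 0 < B) (a b c d m : ℕ) (q : ℂ × ℂ) :
    conj (state hB 0 a (centerRelative q).1 * state hB 0 b (centerRelative q).2)
        * (state (half_pos hB) 0 m ((centerRelative q).1 - (centerRelative q).2)
          * centerPart hB c d m (((centerRelative q).1 + (centerRelative q).2) / 2))
      = ∑ m' ∈ Finset.range (a + b + 1),
        overlap (state (half_pos hB) 0 m') (state (half_pos hB) 0 m) q.1
          * overlap (centerPart hB a b m') (centerPart hB c d m) q.2 := by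
  obtain ⟨s, R⟩ := q
  simp only [centerRelative_apply]
  rw [show R + s / 2 - (R - s / 2) = s by ring, show (R + s / 2 + (R - s / 2)) / 2 = R by ring,
    state_mul_state, map_sum, Finset.sum_mul]
  refine Finset.sum_congr rfl fun m' _ => ?_
  simp only [overlap_apply, map_mul]
  ring

lemma integrable_relState_mul_centerPart {B : ℝ} (hB : 0 < B) (a b c d m : ℕ) :
    Integrable fun p : ℂ × ℂ => conj (state hB 0 a p.1 * state hB 0 b p.2)
      * (state (half_pos hB) 0 m (p.1 - p.2) * centerPart hB c d m ((p.1 + p.2) / 2)) := by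
  rw [← measurePreserving_centerRelative.integrable_comp_emb centerRelative.measurableEmbedding]
  simp only [Function.comp_def, relState_mul_centerPart_comp]
  exact integrable_finsetSum _ fun m' _ =>
    (SchwartzMap.integrable _).mul_prod (SchwartzMap.integrable _)

lemma integral_relState_mul_centerPart {B : ℝ} (hB : 0 < B) (a b c d m : ℕ) :
    ∫ p : ℂ × ℂ, conj (state hB 0 a p.1 * state hB 0 b p.2)
      * (state (half_pos hB) 0 m (p.1 - p.2) * centerPart hB c d m ((p.1 + p.2) / 2))
      = pairCoeff hB a b c d m m := by
  rw [← measurePreserving_centerRelative.integral_comp centerRelative.measurableEmbedding]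
  simp only [relState_mul_centerPart_comp]
  rw [integral_finsetSum _ fun m' _ =>
    (SchwartzMap.integrable _).mul_prod (SchwartzMap.integrable _)]
  have h : ∀ m' : ℕ, ∫ q : ℂ × ℂ, overlap (state (half_pos hB) 0 m') (state (half_pos hB) 0 m) q.1
      * overlap (centerPart hB a b m') (centerPart hB c d m) q.2
      = if m' = m then pairCoeff hB a b c d m' m else 0 := by
    intro m'
    rw [Measure.volume_eq_prod, integral_prod_mul (fun s => overlap (state (half_pos hB) 0 m')
      (state (half_pos hB) 0 m) s) (fun R => overlap (centerPart hB a b m')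
      (centerPart hB c d m) R), integral_overlap_state_zero, pairCoeff]
    split_ifs <;> simp
  simp only [h]
  rw [Finset.sum_ite_eq']
  split_ifs with hm
  · rfl
  · rw [pairCoeff_eq_zero_left hB (by simpa using hm)]

/-! ### Haldane pseudo-potentials -/

lemma effInteraction_overlap {B : ℝ} (hB : 0 < B) (n : ℕ) {w : ℂ → ℝ} (hwm : Measurable w)
    (hw : ∀ m : ℕ, Integrable fun s : ℂ => |w s| * ‖landauState (B / 2) 0 m s‖ ^ 2) (m m' : ℕ) :
    effInteraction B n w (overlap (state (half_pos hB) 0 m) (state (half_pos hB) 0 m'))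
      = ∫ s, (w s : ℂ) * Polynomial.aeval (-((1 / (2 * B)) • schwartzLaplacian)) (laguerre n ^ 2)
        (overlap (state (half_pos hB) 0 m) (state (half_pos hB) 0 m')) s :=
  aeval_distLaplacian_ofFunction _ _ _ _
    (integrable_mul_laplacian_pow_overlap (half_pos hB) hwm hw · m m')

lemma integrable_mul_aeval (c : ℝ) (p : Polynomial ℝ) {V : ℂ → ℝ} {η : 𝓢(ℂ, ℂ)}
    (h : ∀ k, Integrable fun z => (V z : ℂ) * (schwartzLaplacian ^ k) η z) :
    Integrable fun z => (V z : ℂ) * Polynomial.aeval (-(c • schwartzLaplacian)) p η z := by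
  simp_rw [mul_aeval_schwartzLaplacian_apply]
  exact integrable_finsetSum _ fun k _ => (h k).const_mul _

/-- The relative angular momentum is conserved by a radial interaction. -/
lemma effInteraction_overlap_of_ne {B : ℝ} (hB : 0 < B) (n : ℕ) {w : ℂ → ℝ} (hwm : Measurable w)
    (hrad : ∀ z z' : ℂ, ‖z‖ = ‖z'‖ → w z = w z')
    (hw : ∀ m : ℕ, Integrable fun s : ℂ => |w s| * ‖landauState (B / 2) 0 m s‖ ^ 2) {m m' : ℕ}
    (h : m ≠ m') :
    effInteraction B n w (overlap (state (half_pos hB) 0 m) (state (half_pos hB) 0 m')) = 0 := by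
  obtain ⟨a, ha⟩ := exists_circle_pow_eq_neg_one h
  set η := overlap (state (half_pos hB) 0 m) (state (half_pos hB) 0 m') with hη
  have hrot := effInteraction_comp_isometry B n hrad (rotation a) η
  have hneg : (fun s => η (rotation a s)) = ⇑(-η) :=
    funext fun s => overlap_state_zero_rotation (half_pos hB) m m' a ha s
  have hint : ∀ k, Integrable fun z => (w z : ℂ) * (schwartzLaplacian ^ k) (-η) z := by
    intro k
    simp only [map_neg, neg_apply, mul_neg]
    exact (integrable_mul_laplacian_pow_overlap (half_pos hB) hwm hw k m m').neg
  rw [hneg, effInteraction_overlap hB n hwm hw, effInteraction,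
    aeval_distLaplacian_ofFunction _ _ _ _ hint] at hrot
  simp only [map_neg, neg_apply, mul_neg, integral_neg] at hrot
  rw [effInteraction_overlap hB n hwm hw]
  linear_combination (-1 / 2 : ℂ) * hrot

/-- The interaction energy in the `n`-th level is given by the Haldane pseudo-potentials of the
effective interaction. -/
theorem integral_interaction_state {B : ℝ} (hB : 0 < B) (n : ℕ) {w : ℂ → ℝ} (hwm : Measurable w)
    (hrad : ∀ z z' : ℂ, ‖z‖ = ‖z'‖ → w z = w z')
    (hw : ∀ m : ℕ, Integrable fun s : ℂ => |w s| * ‖landauState (B / 2) 0 m s‖ ^ 2)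
    (a b c d : ℕ) :
    HasSum (fun m => effInteraction B n w (stateProduct (B / 2) m m) * pairCoeff hB a b c d m m)
      (∫ p : ℂ × ℂ, (w (p.1 - p.2) : ℂ) * (overlap (state hB n a) (state hB n c) p.1
        * overlap (state hB n b) (state hB n d) p.2)) := by
  have hint := fun m m' => integrable_mul_aeval (1 / (2 * B)) (laguerre n ^ 2)
    (integrable_mul_laplacian_pow_overlap (half_pos hB) hwm hw · m m')
  have h : ∫ p : ℂ × ℂ, (w (p.1 - p.2) : ℂ) * (overlap (state hB n a) (state hB n c) p.1
        * overlap (state hB n b) (state hB n d) p.2)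
      = ∑ m ∈ Finset.range (a + b + 1),
        effInteraction B n w (stateProduct (B / 2) m m) * pairCoeff hB a b c d m m := by
    rw [integral_interaction hB hwm hw (gaussBound_overlap_state hB n n a c)
      (gaussBound_overlap_state hB n n b d), ← laguerre_laplacian_overlap hB n a c,
      ← laguerre_laplacian_overlap hB n b d, correlation_aeval, ← sq, correlation_overlap_state]
    simp only [map_sum, map_smul, sum_apply, smul_apply, smul_eq_mul, Finset.mul_sum,
      mul_left_comm _ (pairCoeff hB a b c d _ _)]
    rw [integral_finsetSum _ fun m _ => integrable_finsetSum _ fun m' _ =>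
      (hint m m').const_mul _]
    refine Finset.sum_congr rfl fun m _ => ?_
    rw [integral_finsetSum _ fun m' _ => (hint m m').const_mul _]
    simp only [integral_const_mul, ← effInteraction_overlap hB n hwm hw]
    rw [Finset.sum_eq_single m, stateProduct_eq (half_pos hB), mul_comm]
    · intro m' _ hm
      rw [effInteraction_overlap_of_ne hB n hwm hrad hw hm.symm, mul_zero]
    · intro hm
      rw [pairCoeff_eq_zero_right hB (by simpa using hm), zero_mul]
  rw [h]
  refine hasSum_sum_of_ne_finset_zero fun m hm => ?_
  rw [pairCoeff_eq_zero_left hB (by simpa using hm), mul_zero]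

/-! ### Integrals of products over configuration space -/

/-- The two-element index type `{i, j}`. -/
def pairIndexEquiv {N : ℕ} {i j : Fin N} (hij : i ≠ j) : Fin 2 ≃ {k // k = i ∨ k = j} where
  toFun := ![⟨i, Or.inl rfl⟩, ⟨j, Or.inr rfl⟩]
  invFun := fun k => if k.1 = i then 0 else 1
  left_inv := by
    intro a
    fin_cases a
    · simp
    · simp [hij.symm]
  right_inv := by
    rintro ⟨k, rfl | rfl⟩
    · simp
    · simp [hij.symm]

/-- Splitting a configuration into the particles `i`, `j` and all the others. -/
def pairSplit {N : ℕ} {i j : Fin N} (hij : i ≠ j) :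
    (Fin N → ℂ) ≃ᵐ (ℂ × ℂ) × ({k // ¬(k = i ∨ k = j)} → ℂ) :=
  (MeasurableEquiv.piEquivPiSubtypeProd (fun _ : Fin N => ℂ) (fun k => k = i ∨ k = j)).trans
    (MeasurableEquiv.prodCongr
      ((MeasurableEquiv.piCongrLeft (fun _ => ℂ) (pairIndexEquiv hij)).symm.trans
        MeasurableEquiv.finTwoArrow)
      (MeasurableEquiv.refl _))

lemma pairSplit_apply {N : ℕ} {i j : Fin N} (hij : i ≠ j) (X : Fin N → ℂ) :
    pairSplit hij X = ((X i, X j), fun k : {k // ¬(k = i ∨ k = j)} => X k.1) := rfl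

lemma measurePreserving_pairSplit {N : ℕ} {i j : Fin N} (hij : i ≠ j) :
    MeasurePreserving (pairSplit hij) volume volume := by
  have h1 := volume_preserving_piEquivPiSubtypeProd (fun _ : Fin N => ℂ) (fun k => k = i ∨ k = j)
  have h2 := (volume_preserving_finTwoArrow ℂ).comp
    (volume_measurePreserving_piCongrLeft (fun _ => ℂ) (pairIndexEquiv hij)).symm
  have h3 := (h2.prod
    (MeasurePreserving.id (volume : Measure ({k // ¬(k = i ∨ k = j)} → ℂ)))).comp h1
  exact h3

lemma comp_pairSplit {N : ℕ} {i j : Fin N} (hij : i ≠ j) (h : ℂ × ℂ → ℂ) (u : Fin N → ℂ → ℂ) :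
    (fun X : Fin N → ℂ => h (X i, X j) * ∏ k ∈ {i, j}ᶜ, u k (X k))
      = (fun q : (ℂ × ℂ) × ({k // ¬(k = i ∨ k = j)} → ℂ) =>
          h q.1 * ∏ k : {k // ¬(k = i ∨ k = j)}, u k.1 (q.2 k)) ∘ pairSplit hij := by
  funext X
  rw [Function.comp_apply, pairSplit_apply,
    Finset.prod_subtype (p := fun k => ¬(k = i ∨ k = j)) {i, j}ᶜ (by simp)]

lemma integrable_pair_mul {N : ℕ} {i j : Fin N} (hij : i ≠ j) {h : ℂ × ℂ → ℂ}
    {g : ({k // ¬(k = i ∨ k = j)} → ℂ) → ℂ} (hh : Integrable h) (hg : Integrable g) :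
    Integrable ((fun q : (ℂ × ℂ) × ({k // ¬(k = i ∨ k = j)} → ℂ) => h q.1 * g q.2)
      ∘ pairSplit hij) :=
  ((measurePreserving_pairSplit hij).integrable_comp_emb
    (pairSplit hij).measurableEmbedding).2 (hh.mul_prod hg)

lemma integrable_pair_mul_prod {N : ℕ} {i j : Fin N} (hij : i ≠ j) {h : ℂ × ℂ → ℂ}
    {u : Fin N → ℂ → ℂ} (hh : Integrable h) (hu : ∀ k, Integrable (u k)) :
    Integrable fun X : Fin N → ℂ => h (X i, X j) * ∏ k ∈ {i, j}ᶜ, u k (X k) := by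
  obtain ⟨g, hg, hgi⟩ : ∃ g : ({k // ¬(k = i ∨ k = j)} → ℂ) → ℂ,
      (g = fun y => ∏ k : {k // ¬(k = i ∨ k = j)}, u k.1 (y k)) ∧ Integrable g :=
    ⟨_, rfl, Integrable.fintype_prod (f := fun (k : {k // ¬(k = i ∨ k = j)}) z => u k.1 z)
      fun k => hu k.1⟩
  have hq := integrable_pair_mul hij hh hgi
  rw [hg] at hq
  rw [comp_pairSplit hij]
  exact hq

lemma integral_pair_mul_prod {N : ℕ} {i j : Fin N} (hij : i ≠ j) (h : ℂ × ℂ → ℂ)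
    (u : Fin N → ℂ → ℂ) :
    ∫ X : Fin N → ℂ, h (X i, X j) * ∏ k ∈ {i, j}ᶜ, u k (X k)
      = (∫ p, h p) * ∏ k ∈ {i, j}ᶜ, ∫ z, u k z := by
  rw [comp_pairSplit hij]
  refine ((measurePreserving_pairSplit hij).integral_comp (pairSplit hij).measurableEmbedding
    (fun q : (ℂ × ℂ) × ({k // ¬(k = i ∨ k = j)} → ℂ) =>
      h q.1 * ∏ k : {k // ¬(k = i ∨ k = j)}, u k.1 (q.2 k))).trans ?_
  rw [Measure.volume_eq_prod, integral_prod_mul h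
    (fun y : {k // ¬(k = i ∨ k = j)} → ℂ => ∏ k, u k.1 (y k)),
    integral_fintype_prod_volume_eq_prod (fun k : {k // ¬(k = i ∨ k = j)} => u k.1),
    Finset.prod_subtype (p := fun k => ¬(k = i ∨ k = j)) {i, j}ᶜ (by simp)]

/-! ### Product states -/

/-- The product state `φ_{n,m_1} ⊗ ⋯ ⊗ φ_{n,m_N}`. -/
def prodState {B : ℝ} (hB : 0 < B) (n : ℕ) {N : ℕ} (m : Fin N → ℕ) : (Fin N → ℂ) → ℂ :=
  tensorFun fun i => state hB n (m i)

lemma tensorFun_slice {N : ℕ} (ψ : Fin N → ℂ → ℂ) (j : Fin N) (r : ℂ) (X : Fin N → ℂ) :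
    tensorFun ψ (Function.update X j r) = ψ j r * ∏ k ∈ {j}ᶜ, ψ k (X k) := by
  rw [tensorFun, ← Finset.prod_mul_prod_compl {j}, Finset.prod_singleton, Function.update_self]
  congr 1
  refine Finset.prod_congr rfl fun k hk => ?_
  rw [Function.update_of_ne (by simpa using hk)]

lemma tensorFun_eq_mul_prod {N : ℕ} (ψ : Fin N → ℂ → ℂ) (j : Fin N) (X : Fin N → ℂ) :
    tensorFun ψ X = ψ j (X j) * ∏ k ∈ {j}ᶜ, ψ k (X k) := by
  rw [← tensorFun_slice, Function.update_eq_self]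

lemma tensorFun_slice_pair {N : ℕ} (ψ : Fin N → ℂ → ℂ) {i j : Fin N} (hij : i ≠ j) (r r' : ℂ)
    (X : Fin N → ℂ) :
    tensorFun ψ (Function.update (Function.update X i r) j r')
      = (ψ i r * ψ j r') * ∏ k ∈ {i, j}ᶜ, ψ k (X k) := by
  rw [tensorFun, ← Finset.prod_mul_prod_compl {i, j}, Finset.prod_pair hij, Function.update_self,
    Function.update_of_ne hij, Function.update_self]
  congr 1
  refine Finset.prod_congr rfl fun k hk => ?_
  simp only [Finset.mem_compl, Finset.mem_insert, Finset.mem_singleton, not_or] at hk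
  rw [Function.update_of_ne hk.2, Function.update_of_ne hk.1]

lemma tensorFun_eq_pair_mul_prod {N : ℕ} (ψ : Fin N → ℂ → ℂ) {i j : Fin N} (hij : i ≠ j)
    (X : Fin N → ℂ) :
    tensorFun ψ X = (ψ i (X i) * ψ j (X j)) * ∏ k ∈ {i, j}ᶜ, ψ k (X k) := by
  rw [← tensorFun_slice_pair ψ hij, Function.update_eq_self, Function.update_eq_self]

lemma conj_prodState_mul {B : ℝ} (hB : 0 < B) (n : ℕ) {N : ℕ} (a b : Fin N → ℕ) :
    (fun X => conj (prodState hB n a X) * prodState hB n b X)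
      = tensorFun fun i => overlap (state hB n (a i)) (state hB n (b i)) := by
  funext X
  simp only [prodState, tensorFun, map_prod, ← Finset.prod_mul_distrib, overlap_apply]

lemma integrable_conj_prodState_mul {B : ℝ} (hB : 0 < B) (n : ℕ) {N : ℕ} (a b : Fin N → ℕ) :
    Integrable fun X => conj (prodState hB n a X) * prodState hB n b X := by
  rw [conj_prodState_mul]
  exact Integrable.fintype_prod fun i => SchwartzMap.integrable _

lemma integral_overlap_state_same {B : ℝ} (hB : 0 < B) (n a b : ℕ) :
    ∫ z, overlap (state hB n a) (state hB n b) z = if a = b then 1 else 0 := by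
  simp [integral_overlap_state]

lemma integral_conj_prodState_mul {B : ℝ} (hB : 0 < B) (n : ℕ) {N : ℕ} (a b : Fin N → ℕ) :
    ∫ X, conj (prodState hB n a X) * prodState hB n b X = if a = b then 1 else 0 := by
  rw [conj_prodState_mul]
  refine (integral_fintype_prod_volume_eq_prod fun i z =>
    overlap (state hB n (a i)) (state hB n (b i)) z).trans ?_
  simp only [integral_overlap_state_same]
  rw [Finset.prod_ite_zero]
  simp [funext_iff]

/-! ### One-body terms of product states -/

lemma ketBra_prodState {B : ℝ} (hB : 0 < B) {N : ℕ} (j : Fin N) (m l : ℕ) (b : Fin N → ℕ) :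
    ketBra B j m l (prodState hB 0 b)
      = if l = b j then prodState hB 0 (Function.update b j m) else 0 := by
  funext X
  have h : ∀ r, conj (landauState B 0 l r) * prodState hB 0 b (Function.update X j r)
      = overlap (state hB 0 l) (state hB 0 (b j)) r * ∏ k ∈ {j}ᶜ, state hB 0 (b k) (X k) := by
    intro r
    rw [prodState, tensorFun_slice, overlap_apply, coe_state, coe_state]
    ring
  have h2 : prodState hB 0 (Function.update b j m) X
      = landauState B 0 m (X j) * ∏ k ∈ {j}ᶜ, state hB 0 (b k) (X k) := by
    rw [prodState, tensorFun_eq_mul_prod _ j, Function.update_self, coe_state]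
    congr 1
    refine Finset.prod_congr rfl fun k hk => ?_
    rw [Function.update_of_ne (by simpa using hk)]
  simp_rw [ketBra, h]
  rw [integral_mul_const, integral_overlap_state_same]
  split_ifs with hl
  · rw [h2, one_mul]
  · simp

lemma integrable_conj_mul_ketBra {B : ℝ} (hB : 0 < B) {N : ℕ} (j : Fin N) (m l : ℕ)
    (a b : Fin N → ℕ) :
    Integrable fun X => conj (prodState hB 0 a X) * ketBra B j m l (prodState hB 0 b) X := by
  rw [ketBra_prodState]
  split_ifs
  · exact integrable_conj_prodState_mul hB 0 _ _
  · simp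

lemma hasSum_oneBodyTerm_prodState {B : ℝ} (hB : 0 < B) (T : GenPotential) {N : ℕ} (j : Fin N)
    (a b : Fin N → ℕ) :
    HasSum (oneBodyTerm B T (prodState hB 0 a) (prodState hB 0 b) j)
      (T (stateProduct B (a j) (b j)) * ∏ k ∈ {j}ᶜ, if a k = b k then 1 else 0) := by
  have hval : oneBodyTerm B T (prodState hB 0 a) (prodState hB 0 b) j (a j, b j)
      = T (stateProduct B (a j) (b j)) * ∏ k ∈ {j}ᶜ, if a k = b k then 1 else 0 := by
    rw [oneBodyTerm, ketBra_prodState, if_pos rfl, integral_conj_prodState_mul,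
      Finset.prod_ite_zero, Finset.prod_const_one]
    congr 2
    simp [Function.eq_update_iff]
  rw [← hval]
  refine hasSum_single _ fun p hp => ?_
  rw [oneBodyTerm, ketBra_prodState]
  split_ifs with hl
  · rw [integral_conj_prodState_mul, if_neg, mul_zero]
    intro h
    refine hp (Prod.ext ?_ hl)
    rw [h, Function.update_self]
  · simp

lemma potential_prodState_eq {B : ℝ} (hB : 0 < B) (n : ℕ) (V : ℂ → ℝ) {N : ℕ} (j : Fin N)
    (a b : Fin N → ℕ) :
    (fun X => conj (prodState hB n a X) * ((V (X j) : ℂ) * prodState hB n b X))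
      = tensorFun fun i z => (if i = j then (V z : ℂ) else 1)
        * overlap (state hB n (a i)) (state hB n (b i)) z := by
  funext X
  have h := congrFun (conj_prodState_mul hB n a b) X
  simp only [tensorFun, Finset.prod_mul_distrib] at h ⊢
  rw [← h, Finset.prod_ite_eq' Finset.univ j]
  simp only [Finset.mem_univ, if_true]
  ring

lemma integrable_potential_prodState {B : ℝ} (hB : 0 < B) (n : ℕ) {V : ℂ → ℝ} (hVm : Measurable V)
    (hV : ∀ m : ℕ, Integrable fun r : ℂ => |V r| * ‖landauState B 0 m r‖ ^ 2) {N : ℕ} (j : Fin N)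
    (a b : Fin N → ℕ) :
    Integrable fun X => conj (prodState hB n a X) * ((V (X j) : ℂ) * prodState hB n b X) := by
  rw [potential_prodState_eq]
  refine Integrable.fintype_prod (f := fun i z => (if i = j then (V z : ℂ) else 1)
    * overlap (state hB n (a i)) (state hB n (b i)) z) fun i => ?_
  split_ifs
  · exact integrable_mul_of_gaussBound hB hVm hV (gaussBound_overlap_state hB n n _ _)
  · simpa only [one_mul] using (overlap (state hB n (a i)) (state hB n (b i))).integrable

lemma integral_potential_prodState {B : ℝ} (hB : 0 < B) (n : ℕ) (V : ℂ → ℝ) {N : ℕ} (j : Fin N)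
    (a b : Fin N → ℕ) :
    ∫ X, conj (prodState hB n a X) * ((V (X j) : ℂ) * prodState hB n b X)
      = (∫ z, (V z : ℂ) * overlap (state hB n (a j)) (state hB n (b j)) z)
        * ∏ k ∈ {j}ᶜ, if a k = b k then 1 else 0 := by
  rw [potential_prodState_eq]
  refine (integral_fintype_prod_volume_eq_prod fun i z => (if i = j then (V z : ℂ) else 1)
        * overlap (state hB n (a i)) (state hB n (b i)) z).trans ?_
  rw [← Finset.prod_mul_prod_compl {j}, Finset.prod_singleton]
  simp only [if_true]
  congr 1
  refine Finset.prod_congr rfl fun k hk => ?_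
  simp only [if_neg (show k ≠ j by simpa using hk), one_mul, integral_overlap_state_same]

/-! ### Two-body terms of product states -/

lemma relProj_prodState {B : ℝ} (hB : 0 < B) {N : ℕ} {i j : Fin N} (hij : i ≠ j) (m : ℕ)
    (b : Fin N → ℕ) (X : Fin N → ℂ) :
    relProj B i j m (prodState hB 0 b) X
      = (state (half_pos hB) 0 m (X i - X j) * centerPart hB (b i) (b j) m ((X i + X j) / 2))
        * ∏ k ∈ {i, j}ᶜ, state hB 0 (b k) (X k) := by
  simp only [relProj, prodState, tensorFun_slice_pair _ hij, ← coe_state (half_pos hB),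
    ← mul_assoc (conj _)]
  rw [integral_mul_const]
  simp only [mul_assoc (conj _)]
  rw [integral_conj_relState_mul]
  ring

lemma conj_mul_relProj {B : ℝ} (hB : 0 < B) {N : ℕ} {i j : Fin N} (hij : i ≠ j) (m : ℕ)
    (a b : Fin N → ℕ) :
    (fun X => conj (prodState hB 0 a X) * relProj B i j m (prodState hB 0 b) X)
      = fun X => (fun p : ℂ × ℂ => conj (state hB 0 (a i) p.1 * state hB 0 (a j) p.2)
          * (state (half_pos hB) 0 m (p.1 - p.2) * centerPart hB (b i) (b j) m ((p.1 + p.2) / 2)))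
          (X i, X j)
        * ∏ k ∈ {i, j}ᶜ, overlap (state hB 0 (a k)) (state hB 0 (b k)) (X k) := by
  funext X
  rw [relProj_prodState hB hij, prodState, tensorFun_eq_pair_mul_prod _ hij, map_mul, map_prod]
  simp only [overlap_apply, Finset.prod_mul_distrib]
  ring

lemma integrable_conj_mul_relProj {B : ℝ} (hB : 0 < B) {N : ℕ} {i j : Fin N} (hij : i ≠ j) (m : ℕ)
    (a b : Fin N → ℕ) :
    Integrable fun X => conj (prodState hB 0 a X) * relProj B i j m (prodState hB 0 b) X := by
  rw [conj_mul_relProj hB hij]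
  exact integrable_pair_mul_prod hij (integrable_relState_mul_centerPart hB _ _ _ _ m)
    fun k => SchwartzMap.integrable (overlap (state hB 0 (a k)) (state hB 0 (b k)))

lemma twoBodyTerm_prodState {B : ℝ} (hB : 0 < B) (S : GenPotential) {N : ℕ} {i j : Fin N}
    (hij : i ≠ j) (a b : Fin N → ℕ) (m : ℕ) :
    twoBodyTerm B S (prodState hB 0 a) (prodState hB 0 b) i j m
      = S (stateProduct (B / 2) m m) * pairCoeff hB (a i) (a j) (b i) (b j) m m
        * ∏ k ∈ {i, j}ᶜ, if a k = b k then 1 else 0 := by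
  rw [twoBodyTerm, conj_mul_relProj hB hij, integral_pair_mul_prod hij
    (fun p => conj (state hB 0 (a i) p.1 * state hB 0 (a j) p.2)
      * (state (half_pos hB) 0 m (p.1 - p.2) * centerPart hB (b i) (b j) m ((p.1 + p.2) / 2)))
    (fun k z => overlap (state hB 0 (a k)) (state hB 0 (b k)) z), integral_relState_mul_centerPart]
  simp only [integral_overlap_state_same]
  ring

lemma interaction_prodState_eq {B : ℝ} (hB : 0 < B) (n : ℕ) (w : ℂ → ℝ) {N : ℕ} {i j : Fin N}
    (hij : i ≠ j) (a b : Fin N → ℕ) :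
    (fun X => conj (prodState hB n a X) * ((w (X i - X j) : ℂ) * prodState hB n b X))
      = fun X => (fun p : ℂ × ℂ => (w (p.1 - p.2) : ℂ)
          * (overlap (state hB n (a i)) (state hB n (b i)) p.1
            * overlap (state hB n (a j)) (state hB n (b j)) p.2)) (X i, X j)
        * ∏ k ∈ {i, j}ᶜ, overlap (state hB n (a k)) (state hB n (b k)) (X k) := by
  funext X
  have h := congrFun (conj_prodState_mul hB n a b) X
  rw [tensorFun_eq_pair_mul_prod _ hij] at h
  simp only [mul_assoc] at h ⊢
  rw [← h]
  ring

lemma integrable_interaction_prodState {B : ℝ} (hB : 0 < B) (n : ℕ) {w : ℂ → ℝ}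
    (hwm : Measurable w)
    (hw : ∀ m : ℕ, Integrable fun s : ℂ => |w s| * ‖landauState (B / 2) 0 m s‖ ^ 2) {N : ℕ}
    {i j : Fin N} (hij : i ≠ j) (a b : Fin N → ℕ) :
    Integrable fun X =>
      conj (prodState hB n a X) * ((w (X i - X j) : ℂ) * prodState hB n b X) := by
  rw [interaction_prodState_eq hB n w hij]
  exact integrable_pair_mul_prod hij (integrable_interaction hB hwm hw
    (gaussBound_overlap_state hB n n _ _) (gaussBound_overlap_state hB n n _ _))
    fun k => SchwartzMap.integrable (overlap (state hB n (a k)) (state hB n (b k)))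

lemma hasSum_twoBodyTerm_prodState {B : ℝ} (hB : 0 < B) (n : ℕ) {w : ℂ → ℝ} (hwm : Measurable w)
    (hrad : ∀ z z' : ℂ, ‖z‖ = ‖z'‖ → w z = w z')
    (hw : ∀ m : ℕ, Integrable fun s : ℂ => |w s| * ‖landauState (B / 2) 0 m s‖ ^ 2) {N : ℕ}
    {i j : Fin N} (hij : i ≠ j) (a b : Fin N → ℕ) :
    HasSum (twoBodyTerm B (effInteraction B n w) (prodState hB 0 a) (prodState hB 0 b) i j)
      (∫ X, conj (prodState hB n a X) * ((w (X i - X j) : ℂ) * prodState hB n b X)) := by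
  rw [interaction_prodState_eq hB n w hij, integral_pair_mul_prod hij
    (fun p => (w (p.1 - p.2) : ℂ) * (overlap (state hB n (a i)) (state hB n (b i)) p.1
      * overlap (state hB n (a j)) (state hB n (b j)) p.2))
    (fun k z => overlap (state hB n (a k)) (state hB n (b k)) z)]
  simp only [integral_overlap_state_same]
  have h := (integral_interaction_state hB n hwm hrad hw (a i) (a j) (b i) (b j)).mul_right
    (∏ k ∈ {i, j}ᶜ, if a k = b k then (1 : ℂ) else 0)
  simpa only [← twoBodyTerm_prodState hB _ hij] using h

/-! ### Sesquilinear extension -/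

/-- Pairs of corresponding combinations of product states, without antisymmetrization. -/
def prodPairs {B : ℝ} (hB : 0 < B) (n N : ℕ) :
    Submodule ℂ (((Fin N → ℂ) → ℂ) × ((Fin N → ℂ) → ℂ)) :=
  Submodule.span ℂ (Set.range fun m : Fin N → ℕ => (prodState hB n m, prodState hB 0 m))

lemma corePairs_le_prodPairs {B : ℝ} (hB : 0 < B) (n N : ℕ) :
    corePairs B n N ≤ prodPairs hB n N := by
  rw [corePairs, Submodule.span_le]
  rintro _ ⟨m, rfl⟩
  have h : ∀ n', slater (fun i => landauState B n' (m i))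
      = ∑ σ : Equiv.Perm (Fin N), ((Equiv.Perm.sign σ : ℤ) : ℂ) •
        prodState hB n' fun j => m (σ j) := by
    intro n'
    simp only [slater_eq_sum, prodState, coe_state]
  have h2 : (slater (fun i => landauState B n (m i)), slater (fun i => landauState B 0 (m i)))
      = ∑ σ : Equiv.Perm (Fin N), ((Equiv.Perm.sign σ : ℤ) : ℂ) •
        (prodState hB n (fun j => m (σ j)), prodState hB 0 fun j => m (σ j)) := by
    refine Prod.ext ?_ ?_
    · rw [Prod.fst_sum]; exact h n
    · rw [Prod.snd_sum]; exact h 0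
  simp only [SetLike.mem_coe]
  rw [h2]
  exact Submodule.sum_mem _ fun σ _ => Submodule.smul_mem _ _ (Submodule.subset_span ⟨_, rfl⟩)

/-- The span of the product states of the `n`-th level. -/
def prodSpan {B : ℝ} (hB : 0 < B) (n N : ℕ) : Submodule ℂ ((Fin N → ℂ) → ℂ) :=
  Submodule.span ℂ (Set.range fun m : Fin N → ℕ => prodState hB n m)

lemma mem_prodSpan_of_prodPairs {B : ℝ} {hB : 0 < B} {n N : ℕ}
    {p : ((Fin N → ℂ) → ℂ) × ((Fin N → ℂ) → ℂ)} (hp : p ∈ prodPairs hB n N) :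
    p.1 ∈ prodSpan hB n N ∧ p.2 ∈ prodSpan hB 0 N := by
  induction hp using Submodule.span_induction with
  | mem _ h =>
    obtain ⟨m, rfl⟩ := h
    exact ⟨Submodule.subset_span ⟨m, rfl⟩, Submodule.subset_span ⟨m, rfl⟩⟩
  | zero => exact ⟨Submodule.zero_mem _, Submodule.zero_mem _⟩
  | add x y _ _ hx hy => exact ⟨Submodule.add_mem _ hx.1 hy.1, Submodule.add_mem _ hx.2 hy.2⟩
  | smul c x _ hx => exact ⟨Submodule.smul_mem _ _ hx.1, Submodule.smul_mem _ _ hx.2⟩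

/-- The statement that the form of the multiplication operator `Q` on `x.1`, `y.1` is the sum of
the forms of the operators `K p` on `x.2`, `y.2`, with coefficients `c p`. -/
def FormExpansion {N : ℕ} {ι : Type*} (Q : (Fin N → ℂ) → ℂ)
    (K : ι → ((Fin N → ℂ) → ℂ) → (Fin N → ℂ) → ℂ) (c : ι → ℂ)
    (x y : ((Fin N → ℂ) → ℂ) × ((Fin N → ℂ) → ℂ)) : Prop :=
  Integrable (fun X => conj (x.1 X) * (Q X * y.1 X)) ∧
    (∀ p, Integrable fun X => conj (x.2 X) * K p y.2 X) ∧
    HasSum (fun p => c p * ∫ X, conj (x.2 X) * K p y.2 X)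
      (∫ X, conj (x.1 X) * (Q X * y.1 X))

/-- Expansions of forms extend from product states to their combinations. -/
lemma formExpansion_of_prodState {B : ℝ} (hB : 0 < B) {n N : ℕ} {ι : Type*}
    {Q : (Fin N → ℂ) → ℂ} {K : ι → ((Fin N → ℂ) → ℂ) → (Fin N → ℂ) → ℂ} {c : ι → ℂ}
    (hadd : ∀ p, ∀ G ∈ prodSpan hB 0 N, ∀ G' ∈ prodSpan hB 0 N,
      K p (G + G') = K p G + K p G')
    (hsmul : ∀ p (a : ℂ) G, K p (a • G) = a • K p G)
    (h : ∀ a b : Fin N → ℕ, FormExpansion Q K c (prodState hB n a, prodState hB 0 a)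
      (prodState hB n b, prodState hB 0 b))
    {x y : ((Fin N → ℂ) → ℂ) × ((Fin N → ℂ) → ℂ)} (hx : x ∈ prodPairs hB n N)
    (hy : y ∈ prodPairs hB n N) : FormExpansion Q K c x y := by
  have hzero : ∀ p, K p 0 = 0 := fun p => by simpa using hsmul p 0 0
  induction hy using Submodule.span_induction with
  | mem _ hy' =>
    obtain ⟨b, rfl⟩ := hy'
    induction hx using Submodule.span_induction with
    | mem _ hx' =>
      obtain ⟨a, rfl⟩ := hx'
      exact h a b
    | zero => simp [FormExpansion]
    | add x x' _ _ hx hx' =>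
      obtain ⟨h1, h2, h3⟩ := hx
      obtain ⟨h1', h2', h3'⟩ := hx'
      simp only [FormExpansion, Prod.fst_add, Prod.snd_add, Pi.add_apply, map_add, add_mul]
      refine ⟨h1.add h1', fun p => (h2 p).add (h2' p), ?_⟩
      simp only [integral_add h1 h1', integral_add (h2 _) (h2' _), mul_add]
      exact h3.add h3'
    | smul a x _ hx =>
      obtain ⟨h1, h2, h3⟩ := hx
      simp only [FormExpansion, Prod.smul_fst, Prod.smul_snd, Pi.smul_apply, smul_eq_mul, map_mul,
        mul_assoc]
      refine ⟨h1.const_mul _, fun p => (h2 p).const_mul _, ?_⟩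
      simp only [integral_const_mul, mul_left_comm _ (conj a)]
      exact h3.mul_left _
  | zero => simp [FormExpansion, hzero]
  | add y y' hy hy' ih ih' =>
    obtain ⟨h1, h2, h3⟩ := ih
    obtain ⟨h1', h2', h3'⟩ := ih'
    simp only [FormExpansion, Prod.fst_add, Prod.snd_add,
      hadd _ _ (mem_prodSpan_of_prodPairs hy).2 _ (mem_prodSpan_of_prodPairs hy').2,
      Pi.add_apply, mul_add]
    refine ⟨h1.add h1', fun p => (h2 p).add (h2' p), ?_⟩
    simp only [integral_add h1 h1', integral_add (h2 _) (h2' _), mul_add]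
    exact h3.add h3'
  | smul a y _ ih =>
    obtain ⟨h1, h2, h3⟩ := ih
    simp only [FormExpansion, Prod.smul_fst, Prod.smul_snd, hsmul, Pi.smul_apply, smul_eq_mul,
      mul_left_comm _ a]
    refine ⟨h1.const_mul _, fun p => (h2 p).const_mul _, ?_⟩
    simp only [integral_const_mul, mul_left_comm _ a]
    exact h3.mul_left _

/-! ### Slices of wave functions -/

lemma exists_schwartz_slice {B : ℝ} (hB : 0 < B) {n N : ℕ} {G : (Fin N → ℂ) → ℂ}
    (hG : G ∈ prodSpan hB n N) (j : Fin N) (X : Fin N → ℂ) :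
    ∃ θ : 𝓢(ℂ, ℂ), (⇑θ = fun r => G (Function.update X j r)) ∧
      create B (annihilate B θ) = (n : ℂ) • θ := by
  induction hG using Submodule.span_induction with
  | mem _ h =>
    obtain ⟨m, rfl⟩ := h
    refine ⟨(∏ k ∈ {j}ᶜ, state hB n (m k) (X k)) • state hB n (m j), ?_, ?_⟩
    · funext r
      simp only [prodState, tensorFun_slice, smul_apply, smul_eq_mul, mul_comm]
    · rw [map_smul, map_smul, create_annihilate_state, smul_comm]
  | zero => exact ⟨0, rfl, by simp⟩
  | add G G' _ _ h h' =>
    obtain ⟨θ, h1, h2⟩ := h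
    obtain ⟨θ', h1', h2'⟩ := h'
    refine ⟨θ + θ', ?_, by rw [map_add, map_add, h2, h2', smul_add]⟩
    funext r
    rw [add_apply, h1, h1', Pi.add_apply]
  | smul a G _ h =>
    obtain ⟨θ, h1, h2⟩ := h
    refine ⟨a • θ, ?_, by rw [map_smul, map_smul, h2, smul_comm]⟩
    funext r
    rw [smul_apply, h1, Pi.smul_apply]

lemma exists_schwartz_pair_slice {B : ℝ} (hB : 0 < B) {N : ℕ} {G : (Fin N → ℂ) → ℂ}
    (hG : G ∈ prodSpan hB 0 N) {i j : Fin N} (hij : i ≠ j) (X : Fin N → ℂ) (R : ℂ) :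
    ∃ θ : 𝓢(ℂ, ℂ), ⇑θ = fun s =>
      G (Function.update (Function.update X i (R + s / 2)) j (R - s / 2)) := by
  induction hG using Submodule.span_induction with
  | mem _ h =>
    obtain ⟨m, rfl⟩ := h
    refine ⟨(∏ k ∈ {i, j}ᶜ, state hB 0 (m k) (X k)) • ∑ l ∈ Finset.range (m i + m j + 1),
      centerPart hB (m i) (m j) l R • state (half_pos hB) 0 l, ?_⟩
    funext s
    simp only [prodState, tensorFun_slice_pair _ hij, state_mul_state, smul_apply, sum_apply,
      smul_eq_mul, mul_comm]
  | zero => exact ⟨0, rfl⟩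
  | add G G' _ _ h h' =>
    obtain ⟨θ, h1⟩ := h
    obtain ⟨θ', h1'⟩ := h'
    exact ⟨θ + θ', by funext s; rw [add_apply, h1, h1', Pi.add_apply]⟩
  | smul a G _ h =>
    obtain ⟨θ, h1⟩ := h
    exact ⟨a • θ, by funext s; rw [smul_apply, h1, Pi.smul_apply]⟩

lemma ketBra_add {B : ℝ} (hB : 0 < B) {N : ℕ} (j : Fin N) (m l : ℕ) {G G' : (Fin N → ℂ) → ℂ}
    (hG : G ∈ prodSpan hB 0 N) (hG' : G' ∈ prodSpan hB 0 N) :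
    ketBra B j m l (G + G') = ketBra B j m l G + ketBra B j m l G' := by
  funext X
  obtain ⟨θ, h, _⟩ := exists_schwartz_slice hB hG j X
  obtain ⟨θ', h', _⟩ := exists_schwartz_slice hB hG' j X
  have hi : ∀ η : 𝓢(ℂ, ℂ), Integrable fun r => conj (landauState B 0 l r) * η r := fun η => by
    simpa only [coe_overlap, coe_state] using (overlap (state hB 0 l) η).integrable (μ := volume)
  simp only [Pi.add_apply, ketBra, mul_add, ← congrFun h, ← congrFun h']
  rw [integral_add (hi θ) (hi θ'), mul_add]

lemma ketBra_smul (B : ℝ) {N : ℕ} (j : Fin N) (m l : ℕ) (a : ℂ) (G : (Fin N → ℂ) → ℂ) :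
    ketBra B j m l (a • G) = a • ketBra B j m l G := by
  funext X
  simp only [Pi.smul_apply, ketBra, smul_eq_mul, mul_left_comm _ a, integral_const_mul]

lemma relProj_add {B : ℝ} (hB : 0 < B) {N : ℕ} {i j : Fin N} (hij : i ≠ j) (m : ℕ)
    {G G' : (Fin N → ℂ) → ℂ} (hG : G ∈ prodSpan hB 0 N) (hG' : G' ∈ prodSpan hB 0 N) :
    relProj B i j m (G + G') = relProj B i j m G + relProj B i j m G' := by
  funext X
  obtain ⟨θ, h⟩ := exists_schwartz_pair_slice hB hG hij X ((X i + X j) / 2)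
  obtain ⟨θ', h'⟩ := exists_schwartz_pair_slice hB hG' hij X ((X i + X j) / 2)
  have hi : ∀ η : 𝓢(ℂ, ℂ), Integrable fun r => conj (landauState (B / 2) 0 m r) * η r :=
    fun η => by
      simpa only [coe_overlap, coe_state] using
        (overlap (state (half_pos hB) 0 m) η).integrable (μ := volume)
  simp only [Pi.add_apply, relProj, mul_add, ← congrFun h, ← congrFun h']
  rw [integral_add (hi θ) (hi θ'), mul_add]

lemma relProj_smul (B : ℝ) {N : ℕ} (i j : Fin N) (m : ℕ) (a : ℂ) (G : (Fin N → ℂ) → ℂ) :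
    relProj B i j m (a • G) = a • relProj B i j m G := by
  funext X
  simp only [Pi.smul_apply, relProj, smul_eq_mul, mul_left_comm _ a, integral_const_mul]

/-- Wave functions of the `n`-th level have constant kinetic energy. -/
lemma hamiltonian_eq {B : ℝ} (hB : 0 < B) (V w : ℂ → ℝ) {n N : ℕ} {G : (Fin N → ℂ) → ℂ}
    (hG : G ∈ prodSpan hB n N) (X : Fin N → ℂ) :
    hamiltonian B V w G X = ((n * (2 * B * N) : ℝ) : ℂ) * G X + (∑ j, (V (X j) : ℂ) * G X
      + ∑ i, ∑ j ∈ Finset.univ.filter (fun j => i < j), (w (X i - X j) : ℂ) * G X) := by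
  have h : ∀ j, landauOp B (fun r => G (Function.update X j r)) (X j)
      = ((2 * B * n : ℝ) : ℂ) * G X + (B : ℂ) * G X := by
    intro j
    obtain ⟨θ, h1, h2⟩ := exists_schwartz_slice hB hG j X
    have h3 : θ (X j) = G X := by rw [h1]; exact congrArg G (Function.update_eq_self j X)
    rw [← h1, landauOp_eq hB, h2, smul_apply, add_apply, smul_apply, smul_apply, h3]
    simp only [smul_eq_mul]
    push_cast
    ring
  simp only [hamiltonian, h]
  rw [← add_assoc]
  congr 1
  simp only [add_sub_cancel_right, Finset.sum_add_distrib, Finset.sum_const, Finset.card_univ,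
    Fintype.card_fin, nsmul_eq_mul]
  push_cast
  ring

/-! ### The effective Hamiltonian -/

lemma formExpansion_external {B : ℝ} (hB : 0 < B) (n : ℕ) {V : ℂ → ℝ} (hVm : Measurable V)
    (hV : ∀ m : ℕ, Integrable fun r : ℂ => |V r| * ‖landauState B 0 m r‖ ^ 2) {N : ℕ} (j : Fin N)
    {x y : ((Fin N → ℂ) → ℂ) × ((Fin N → ℂ) → ℂ)} (hx : x ∈ corePairs B n N)
    (hy : y ∈ corePairs B n N) :
    FormExpansion (fun X => (V (X j) : ℂ)) (fun p : ℕ × ℕ => ketBra B j p.1 p.2)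
      (fun p => effExternal B n V (stateProduct B p.1 p.2)) x y := by
  refine formExpansion_of_prodState hB (fun _ _ hG _ hG' => ketBra_add hB j _ _ hG hG')
    (fun _ => ketBra_smul B j _ _) (fun a b => ⟨?_, fun p => ?_, ?_⟩)
    (corePairs_le_prodPairs hB n N hx) (corePairs_le_prodPairs hB n N hy)
  · exact integrable_potential_prodState hB n hVm hV j a b
  · exact integrable_conj_mul_ketBra hB j p.1 p.2 a b
  · have h := hasSum_oneBodyTerm_prodState hB (effExternal B n V) j a b
    rw [effExternal_stateProduct hB n hVm hV, ← integral_potential_prodState] at h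
    exact h

lemma formExpansion_interaction {B : ℝ} (hB : 0 < B) (n : ℕ) {w : ℂ → ℝ} (hwm : Measurable w)
    (hrad : ∀ z z' : ℂ, ‖z‖ = ‖z'‖ → w z = w z')
    (hw : ∀ m : ℕ, Integrable fun s : ℂ => |w s| * ‖landauState (B / 2) 0 m s‖ ^ 2) {N : ℕ}
    {i j : Fin N} (hij : i ≠ j) {x y : ((Fin N → ℂ) → ℂ) × ((Fin N → ℂ) → ℂ)}
    (hx : x ∈ corePairs B n N) (hy : y ∈ corePairs B n N) :
    FormExpansion (fun X => (w (X i - X j) : ℂ)) (fun m : ℕ => relProj B i j m)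
      (fun m => effInteraction B n w (stateProduct (B / 2) m m)) x y :=
  formExpansion_of_prodState hB (fun _ _ hG _ hG' => relProj_add hB hij _ hG hG')
    (fun _ => relProj_smul B i j _)
    (fun a b => ⟨integrable_interaction_prodState hB n hwm hw hij a b,
      fun m => integrable_conj_mul_relProj hB hij m a b,
      hasSum_twoBodyTerm_prodState hB n hwm hrad hw hij a b⟩)
    (corePairs_le_prodPairs hB n N hx) (corePairs_le_prodPairs hB n N hy)

/-- The form of the full Hamiltonian on corresponding wave functions. -/
theorem hamiltonianForm_eq_lllForm {B : ℝ} (hB : 0 < B) (n : ℕ) {V w : ℂ → ℝ}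
    (hVm : Measurable V) (hwm : Measurable w) (hrad : ∀ z z' : ℂ, ‖z‖ = ‖z'‖ → w z = w z')
    (hV : ∀ m : ℕ, Integrable fun r : ℂ => |V r| * ‖landauState B 0 m r‖ ^ 2)
    (hw : ∀ m : ℕ, Integrable fun s : ℂ => |w s| * ‖landauState (B / 2) 0 m s‖ ^ 2) {N : ℕ}
    {F G F₀ G₀ : (Fin N → ℂ) → ℂ} (hF : (F, F₀) ∈ corePairs B n N) (hG : (G, G₀) ∈ corePairs B n N)
    (hFG : Integrable fun X => conj (F X) * G X) :
    Integrable (fun X => conj (F X) * hamiltonian B V w G X) ∧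
      hamiltonianForm B V w F G = ((n * (2 * B * N) : ℝ) : ℂ) * (∫ X, conj (F X) * G X)
        + lllForm B (effExternal B n V) (effInteraction B n w) F₀ G₀ := by
  have h1 := fun j => formExpansion_external hB n hVm hV j hF hG
  have h2 := fun (i j : Fin N) (hij : i < j) =>
    formExpansion_interaction hB n hwm hrad hw hij.ne hF hG
  have hmem := (mem_prodSpan_of_prodPairs (corePairs_le_prodPairs hB n N hG)).1
  have hexp : (fun X => conj (F X) * hamiltonian B V w G X)
      = fun X => ((n * (2 * B * N) : ℝ) : ℂ) * (conj (F X) * G X)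
        + (∑ j, conj (F X) * ((V (X j) : ℂ) * G X)
          + ∑ i, ∑ j ∈ Finset.univ.filter (fun j => i < j),
            conj (F X) * ((w (X i - X j) : ℂ) * G X)) := by
    funext X
    rw [hamiltonian_eq hB V w hmem, mul_add, mul_add, Finset.mul_sum, Finset.mul_sum]
    simp only [Finset.mul_sum]
    ring
  have hi1 : Integrable fun X => ∑ j, conj (F X) * ((V (X j) : ℂ) * G X) :=
    integrable_finsetSum _ fun j _ => (h1 j).1
  have hi2 : ∀ i, Integrable fun X => ∑ j ∈ Finset.univ.filter (fun j => i < j),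
      conj (F X) * ((w (X i - X j) : ℂ) * G X) := fun i =>
    integrable_finsetSum _ fun j hj => (h2 i j (Finset.mem_filter.1 hj).2).1
  have hi3 := integrable_finsetSum Finset.univ fun i _ => hi2 i
  have hi0 := hFG.const_mul ((n * (2 * B * N) : ℝ) : ℂ)
  have hi4 : Integrable fun X => ∑ j, conj (F X) * ((V (X j) : ℂ) * G X)
      + ∑ i, ∑ j ∈ Finset.univ.filter (fun j => i < j),
        conj (F X) * ((w (X i - X j) : ℂ) * G X) := hi1.add hi3
  refine ⟨by rw [hexp]; exact hi0.add hi4, ?_⟩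
  rw [hamiltonianForm, hexp, integral_add hi0 hi4, integral_add hi1 hi3,
    integral_const_mul, integral_finsetSum _ fun j _ => (h1 j).1,
    integral_finsetSum _ fun i _ => hi2 i, lllForm]
  congr 2
  · exact Finset.sum_congr rfl fun j _ => (h1 j).2.2.tsum_eq.symm
  · refine Finset.sum_congr rfl fun i _ => ?_
    rw [integral_finsetSum _ fun j hj => (h2 i j (Finset.mem_filter.1 hj).2).1]
    exact Finset.sum_congr rfl fun j hj =>
      (h2 i j (Finset.mem_filter.1 hj).2).2.2.tsum_eq.symm

lemma inner_eq_integral_conj_mul {N : ℕ} {Ψ Φ : L2N N} {F G : (Fin N → ℂ) → ℂ}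
    (hF : Ψ =ᵐ[volume] F) (hG : Φ =ᵐ[volume] G) :
    inner ℂ Ψ Φ = ∫ X, conj (F X) * G X := by
  rw [L2.inner_def]
  refine integral_congr_ae ?_
  filter_upwards [hF, hG] with X h1 h2
  rw [RCLike.inner_apply, h1, h2, mul_comm]

lemma integrable_conj_mul_of_ae {N : ℕ} {Ψ Φ : L2N N} {F G : (Fin N → ℂ) → ℂ}
    (hF : Ψ =ᵐ[volume] F) (hG : Φ =ᵐ[volume] G) : Integrable fun X => conj (F X) * G X := by
  refine (L2.integrable_inner (𝕜 := ℂ) Ψ Φ).congr ?_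
  filter_upwards [hF, hG] with X h1 h2
  rw [RCLike.inner_apply, h1, h2, mul_comm]

end LandauLevels

end

open LandauLevels in
theorem theorem2p1 (B : ℝ) (hB : 0 < B) (n : ℕ) :
    ∃ U : landauLevel B n ≃ₗᵢ[ℂ] landauLevel B 0,
      -- `U φ_{n,m} = φ_{0,m}`
      (∀ m : ℕ, ∃ ψ : landauLevel B n,
        (ψ : Lp ℂ 2 (volume : Measure ℂ)) =ᵐ[volume] landauState B n m ∧
        (U ψ : Lp ℂ 2 (volume : Measure ℂ)) =ᵐ[volume] landauState B 0 m) ∧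
      ∀ N : ℕ, ∃ UN : landauLevelN B n N ≃ₗᵢ[ℂ] landauLevelN B 0 N,
        -- `UN` is the antisymmetric tensor power of `U`
        (∀ ψ : Fin N → landauLevel B n, ∃ Ψ : landauLevelN B n N,
          (Ψ : L2N N) =ᵐ[volume] slater (fun i => (ψ i : ℂ → ℂ)) ∧
          (UN Ψ : L2N N) =ᵐ[volume] slater (fun i => (U (ψ i) : ℂ → ℂ))) ∧
        -- the form domains are dense and correspond to each other
        Dense (formDomain B n N) ∧ Dense (formDomain B 0 N) ∧
        UN '' formDomain B n N = formDomain B 0 N ∧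
        ∀ V w : ℂ → ℝ, Measurable V → Measurable w →
          (∀ z z' : ℂ, ‖z‖ = ‖z'‖ → w z = w z') →
          (∀ m : ℕ, Integrable (fun r : ℂ => |V r| * ‖landauState B 0 m r‖ ^ 2)) →
          (∀ m : ℕ, Integrable (fun s : ℂ => |w s| * ‖landauState (B / 2) 0 m s‖ ^ 2)) →
          -- the pairings defining the matrix elements of the effective potentials converge
          (∀ k m l : ℕ, Integrable (fun r : ℂ =>
            (V r : ℂ) * (Laplacian.laplacian)^[k] (stateProduct B m l) r)) ∧
          (∀ k m : ℕ, Integrable (fun s : ℂ =>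
            (w s : ℂ) * (Laplacian.laplacian)^[k] (stateProduct (B / 2) m m) s)) ∧
          -- the effective interaction is radial
          (∀ (R : ℂ ≃ₗᵢ[ℝ] ℂ) (η : ℂ → ℂ), ContDiff ℝ (⊤ : ℕ∞) η →
            effInteraction B n w (fun s => η (R s)) = effInteraction B n w η) ∧
          -- `P H P - 2nBN` and the effective Hamiltonian in the lowest level
          ∀ Ψ Φ : L2N N, IsAntisymmetric Ψ → IsAntisymmetric Φ →
          ∀ F ∈ formCore B n N, ∀ G ∈ formCore B n N,
          ∀ F₀ ∈ formCore B 0 N, ∀ G₀ ∈ formCore B 0 N,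
            (projLevelN B n N Ψ : L2N N) =ᵐ[volume] F →
            (projLevelN B n N Φ : L2N N) =ᵐ[volume] G →
            (UN (projLevelN B n N Ψ) : L2N N) =ᵐ[volume] F₀ →
            (UN (projLevelN B n N Φ) : L2N N) =ᵐ[volume] G₀ →
            -- well-definedness of the two forms
            Integrable (fun X => conj (F X) * hamiltonian B V w G X) ∧
            (∀ j, Summable (oneBodyTerm B (effExternal B n V) F₀ G₀ j)) ∧
            (∀ i j, i < j → Summable (twoBodyTerm B (effInteraction B n w) F₀ G₀ i j)) ∧
            -- equality as quadratic forms
            hamiltonianForm B V w F G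
                - ((n * (2 * B * N) : ℝ) : ℂ) *
                  inner ℂ (projLevelN B n N Ψ)
                    (projLevelN B n N Φ)
              = lllForm B (effExternal B n V) (effInteraction B n w) F₀ G₀ ∧
            -- the same with the operator `P H P`, whenever `H` maps `P Φ` into `L²`
            ∀ K : L2N N, K =ᵐ[volume] hamiltonian B V w G →
              inner ℂ (UN (projLevelN B n N Ψ))
                (UN (projLevelN B n N K
                  - ((n * (2 * B * N) : ℝ) : ℂ) • projLevelN B n N Φ))
              = lllForm B (effExternal B n V) (effInteraction B n w) F₀ G₀ := by
  have hB2 := half_pos hB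
  refine ⟨levelUnitary hB n, fun m => ⟨levelState hB n m, levelState_ae hB n m, ?_⟩, fun N => ?_⟩
  · rw [levelUnitary_levelState]
    exact levelState_ae hB 0 m
  obtain ⟨UN, hUN⟩ := exists_tensor_power (levelUnitary hB n) N
  refine ⟨UN, fun ψ => ⟨⟨_, levelSlater_mem ψ⟩, levelSlater_ae ψ, ?_⟩, formDomain_dense hB n N,
    formDomain_dense hB 0 N, image_formDomain hB hUN, ?_⟩
  · rw [hUN ψ _ rfl]
    exact levelSlater_ae _
  intro V w hVm hwm hrad hV hw
  refine ⟨fun k m l => ?_, fun k m => ?_, fun R η _ => effInteraction_comp_isometry B n hrad R η, ?_⟩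
  · rw [stateProduct_eq hB, ← coe_schwartzLaplacian_pow]
    exact integrable_mul_laplacian_pow_overlap hB hVm hV k m l
  · rw [stateProduct_eq hB2, ← coe_schwartzLaplacian_pow]
    exact integrable_mul_laplacian_pow_overlap hB2 hwm hw k m m
  intro Ψ Φ _ _ F hF G hG F₀ hF₀ G₀ hG₀ hΨ hΦ hΨ₀ hΦ₀
  have hFp := mem_corePairs_of_ae hB hUN hF hF₀ hΨ hΨ₀
  have hGp := mem_corePairs_of_ae hB hUN hG hG₀ hΦ hΦ₀
  obtain ⟨hint, hform⟩ := hamiltonianForm_eq_lllForm hB n hVm hwm hrad hV hw hFp hGp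
    (integrable_conj_mul_of_ae hΨ hΦ)
  have hinner : inner ℂ (projLevelN B n N Ψ) (projLevelN B n N Φ) = ∫ X, conj (F X) * G X :=
    inner_eq_integral_conj_mul hΨ hΦ
  refine ⟨hint, fun j => (formExpansion_external hB n hVm hV j hFp hGp).2.2.summable,
    fun i j hij =>
      (formExpansion_interaction hB n hwm hrad hw hij.ne hFp hGp).2.2.summable, ?_, ?_⟩
  · rw [hform, hinner]
    ring
  · intro K hK
    have hK' : inner ℂ (projLevelN B n N Ψ) (projLevelN B n N K) = hamiltonianForm B V w F G := by
      rw [Submodule.inner_orthogonalProjectionOnto_eq_of_mem_left]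
      exact inner_eq_integral_conj_mul hΨ hK
    have hsmul : inner ℂ (projLevelN B n N Ψ)
        (((n * (2 * B * N) : ℝ) : ℂ) • projLevelN B n N Φ)
          = ((n * (2 * B * N) : ℝ) : ℂ) * inner ℂ (projLevelN B n N Ψ) (projLevelN B n N Φ) := by
      rw [Submodule.coe_inner, Submodule.coe_inner, Submodule.coe_smul]
      exact inner_smul_right _ _ _
    rw [UN.inner_map_map, inner_sub_right, hsmul, hK', hinner, hform]
    ring
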